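/- **Parameters.** Fix: infinite sets of program variables $x$, heap locations $\ell$, ghost locations $\hat\ell$ and IDs $id$; infinite well-founded partially ordered sets of levels $L$ and degrees $\delta$; an infinite well-ordered set of thread IDs $\theta$; a set of values $v$ that contains a unit value $\mathtt{tt}$, the Booleans $\mathsf{True}\ne\mathsf{False}$ and all heap locations; a set of ghost values $\hat v$; and a set of operations, i.e. partial functions on lists of values. **Language.** Expressions: $e ::= x\mid v\mid e=e\mid\neg e\mid op(\bar e)$, with the evident partial evaluation $[\![e]\!]$ (variables are undefined, $=$ is equality of values, $\neg$ is defined on Booleans only). Commands: $$c ::= \mathbf{while}\ c\ \mathbf{do}\ \mathbf{skip}\mid \mathbf{fork}\ c\mid \mathbf{let}\ x:=c\ \mathbf{in}\ c\mid \mathbf{if}\ c\ \mathbf{then}\ c\mid \mathbf{cons}(e)\mid [e]\mid [e]:=e\mid \mathbf{new\_mutex}\mid \mathbf{acquire}\ e\mid \mathbf{release}\ e\mid e\mid \mathbf{consumeItPerm},$$ where the last, intermediate, command has no reduction rule and no proof rule. A physical heap $h$ is a finite set of resources $\ell\mapsto v$, $\mathsf{unlocked}(\ell)$, $\mathsf{locked}(\ell)$.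 Single-thread steps (closed expressions are identified with their values): $\mathbf{fork}\ c$ reduces to $\mathtt{tt}$ and forks $c$; $\mathbf{while}\ c\ \mathbf{do}\ \mathbf{skip}$ reduces to $\mathbf{if}\ c\ \mathbf{then}\ \mathbf{while}\ c\ \mathbf{do}\ \mathbf{skip}$; $\mathbf{if}\ \mathsf{True}\ \mathbf{then}\ c$ to $c$; $\mathbf{if}\ \mathsf{False}\ \mathbf{then}\ c$ to $\mathtt{tt}$; $\mathbf{let}\ x:=v\ \mathbf{in}\ c$ to $c[x\mapsto v]$; $\mathbf{cons}(v)$ adds $\ell\mapsto v$ and $\mathbf{new\_mutex}$ adds $\mathsf{unlocked}(\ell)$ for an unallocated $\ell$, each with result $\ell$; $[\ell]$ reduces to $v$ if $\ell\mapsto v\in h$; $[\ell]:=v'$ replaces $\ell\mapsto v$ by $\ell\mapsto v'$, $\mathbf{acquire}\ \ell$ replaces $\mathsf{unlocked}(\ell)$ by $\mathsf{locked}(\ell)$ and $\mathbf{release}\ \ell$ does the reverse, each with result $\mathtt{tt}$; and steps may be taken under $\mathbf{if}\ \square\ \mathbf{then}\ c$ and $\mathbf{let}\ x:=\square\ \mathbf{in}\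 c$. A thread pool is a finite partial function from thread IDs to commands or the symbol $\mathsf{term}$. A step of thread $\theta$ either performs a single-thread step of its command and adds the forked thread, if any, under the least unused ID, or replaces a thread that has become a value by $\mathsf{term}$. A *reduction sequence* is an infinite sequence $(h_i,tp_i)_{i\in\mathbb N}$ for which there are thread IDs $\theta_i$ such that $(h_i,tp_i)$ steps to $(h_{i+1},tp_{i+1})$ by thread $\theta_i$, for each $i$. It is *fair* if for all $i$ and all $\theta\in\mathrm{dom}(tp_i)$ with $tp_i(\theta)\neq\mathsf{term}$ there is $k\ge i$ such that $(h_k,tp_k)$ steps to $(h_{k+1},tp_{k+1})$ by thread $\theta$. **Assertions.** Fractions are rationals $0<f\le1$. A phase ID $\tau$ is a finite sequence over $\{\mathsf{Forker},\mathsf{Forkee}\}$; $\tau'\sqsubseteq\tau$ means that $\tau'$ is a prefix of $\tau$. A signal $s=(id,L)$ is an ID with a level, a mutex $m=(\ell,L)$ a location with a level; either is also an obligation of level $L$. $O$ ranges over bags of obligations; $L\prec O$ means that $L$ is strictly below the level of each member of $O$. Assertions: $$A ::= \mathsf{true}\mid\mathsf{false}\mid\neg A\mid A\wedge A\mid A\vee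 A\mid A*A\mid \ell\overset{f}{\mapsto}v\mid\hat\ell\overset{f}{\mapsto}\hat v\mid\textstyle\bigvee_{i\in I}A_i\mid [f]\mathsf{uninit}(\ell)\mid[f]\mathsf{mutex}(m,A)\mid[f]\mathsf{locked}(m,A,f')\mid[f]\mathsf{signal}(s,b)\mid\mathsf{phase}(\tau)\mid\mathsf{obs}(O)\mid\mathsf{waitPerm}(\tau,id,\delta)\mid\mathsf{itPerm}(\tau,\delta),$$ with $b$ a Boolean; $\exists i.A_i$ is $\bigvee_iA_i$, and a missing fraction is $1$. Logical resources are the atomic assertions without the prefixed fraction, and a logical heap $H$ maps logical resources to $\mathbb Q_{\ge0}$. $H\models A$ is defined with the classical connectives; $H\models A_1*A_2$ iff $H=H_1+H_2$ (pointwise) with $H_i\models A_i$; a fractional atom $[f]r$ holds iff $H(r)\ge f$, and the last four atoms hold iff $H(r)\ge1$. $H$ is *consistent* if it is integral on phase, obs, waitPerm and itPerm resources and no two distinct resources that occur in $H$ share a heap or ghost location, except that $\mathsf{locked}(m,P,f)$ and $\mathsf{mutex}(m,P)$ may both occur. Let $P^\circ$ abbreviate $P\wedge\neg(\exists\tau.\,\mathsf{phase}(\tau)\vee\exists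 O.\,\mathsf{obs}(O))$. **View shifts** $A\Rrightarrow B$ are generated by: $A\Rrightarrow B$ if every consistent $H$ with $H\models A$ satisfies $H\models B$; transitivity; $A_1\vee A_2\Rrightarrow B$ if $A_1\Rrightarrow B$ and $A_2\Rrightarrow B$; $A*F\Rrightarrow B*F$ if $A\Rrightarrow B$; and - $\mathsf{obs}(O)\Rrightarrow\exists id.\ \mathsf{obs}(O\uplus\{(id,L)\})*\mathsf{signal}((id,L),\mathsf{False})$; - $\mathsf{obs}(O\uplus\{s\})*\mathsf{signal}(s,\mathsf{False})\Rrightarrow\mathsf{obs}(O)*\mathsf{signal}(s,\mathsf{True})$; - $\mathsf{itPerm}(\tau,\delta)\Rrightarrow\mathsf{waitPerm}(\tau,id,\delta')$ if $\delta'<\delta$; - $W\Rrightarrow W*\mathsf{itPerm}(\tau,\delta)$ for $W=\mathsf{phase}(\tau)*\mathsf{obs}(O)*\mathsf{waitPerm}(\tau',id,\delta)*[f]\mathsf{signal}((id,L),\mathsf{False})$ if $\tau'\sqsubseteq\tau$ and $L\prec O$; - $\mathsf{itPerm}(\tau',\delta)\Rrightarrow\mathsf{itPerm}(\tau,\delta)$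 and $\mathsf{waitPerm}(\tau',id,\delta)\Rrightarrow\mathsf{waitPerm}(\tau,id,\delta)$ if $\tau'\sqsubseteq\tau$; - $\mathsf{itPerm}(\tau,\delta)\Rrightarrow\mathsf{itPerm}(\tau,\delta')*\cdots*\mathsf{itPerm}(\tau,\delta')$ ($n$ copies, $n\in\mathbb N$) if $\delta'<\delta$; - $\mathsf{uninit}(\ell)*P^\circ\Rrightarrow\mathsf{mutex}((\ell,L),P)$; - $\mathsf{true}\Rrightarrow\exists\hat\ell.\ \hat\ell\mapsto\hat v$ and $\hat\ell\mapsto\hat v\Rrightarrow\hat\ell\mapsto\hat v'$. **Proof rules.** $\vdash\{A\}\,c\,\{r.\,B(r)\}$ ($r$ the result value) is generated by: - frame: from $\{A\}c\{B\}$ infer $\{A*F\}c\{r.\,B(r)*F\}$; consequence: from $A\Rrightarrow A'$, $\{A'\}c\{B'\}$ and $B'(r)\Rrightarrow B(r)$ for all $r$ infer $\{A\}c\{B\}$; existential: from $\{A_i\}c\{B\}$ for all $i$ infer $\{\exists i.A_i\}c\{B\}$; - $\{\mathsf{true}\}\,e\,\{r.\,r=v\}$ if $[\![e]\!]=v$;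 - fork: from $\{\mathsf{phase}(\tau.\mathsf{Forkee})*\mathsf{obs}(O_f)*A\}\,c\,\{\mathsf{obs}(\emptyset)\}$ infer $\{\mathsf{phase}(\tau)*\mathsf{obs}(O_m\uplus O_f)*A\}\ \mathbf{fork}\ c\ \{r.\,r=\mathtt{tt}*\mathsf{phase}(\tau.\mathsf{Forker})*\mathsf{obs}(O_m)\}$; - if: from $\{A\}c\{b.\,C(b)\wedge(b=\mathsf{True}\vee b=\mathsf{False})\}$, $\{C(\mathsf{True})\}c'\{B\}$ and $C(\mathsf{False})\Rrightarrow B(\mathtt{tt})$ infer $\{A\}\ \mathbf{if}\ c\ \mathbf{then}\ c'\ \{B\}$; - while: from $\{I\}\,c\,\{b.\ (b=\mathsf{True}*\exists\tau,\tau',\delta.\ \tau'\sqsubseteq\tau*\mathsf{phase}(\tau)*\mathsf{itPerm}(\tau',\delta)*J(\tau))\vee(b=\mathsf{False}*B)\}$ and $\mathsf{phase}(\tau)*J(\tau)\Rrightarrow I$ for all $\tau$ infer $\{I\}\ \mathbf{while}\ c\ \mathbf{do}\ \mathbf{skip}\ \{r.\,r=\mathtt{tt}*B\}$; - let: from $\{A\}c\{C\}$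 and $\{C(v)\}\,c'[x\mapsto v]\,\{B\}$ for all $v$ infer $\{A\}\ \mathbf{let}\ x:=c\ \mathbf{in}\ c'\ \{B\}$; - acquire, for $m=(\ell,L)$, $[\![e]\!]=\ell$ and $L\prec O$: $\{\mathsf{obs}(O)*[f]\mathsf{mutex}(m,P)\}\ \mathbf{acquire}\ e\ \{r.\,r=\mathtt{tt}*\mathsf{obs}(O\uplus\{m\})*\mathsf{locked}(m,P,f)*P\}$; - release, for $m=(\ell,L)$ and $[\![e]\!]=\ell$: from $\mathsf{obs}(O)*A\Rrightarrow\mathsf{obs}(O')*P^\circ*B$ infer $\{\mathsf{obs}(O\uplus\{m\})*\mathsf{locked}(m,P,f)*A\}\ \mathbf{release}\ e\ \{r.\,r=\mathtt{tt}*\mathsf{obs}(O')*[f]\mathsf{mutex}(m,P)*B\}$; - $\{\mathsf{true}\}\,\mathbf{new\_mutex}\,\{r.\,\exists\ell.\,r=\ell*\mathsf{uninit}(\ell)\}$; $\{\mathsf{true}\}\,\mathbf{cons}(e)\,\{r.\,\exists\ell.\,r=\ell*\ell\mapsto[\![e]\!]\}$ if $[\![e]\!]$ is defined; if $[\![e]\!]=\ell$,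 then $\{\ell\overset f\mapsto v\}\,[e]\,\{r.\,r=v*\ell\overset f\mapsto v\}$ and, if also $[\![e']\!]=v'$, $\{\ell\mapsto v\}\,[e]:=e'\,\{r.\,r=\mathtt{tt}*\ell\mapsto v'\}$. **Theorem (Soundness).** Let $c$ be a command, $\tau$ a phase ID, $N\in\mathbb N$ and $\delta_1,\dots,\delta_N$ degrees, and suppose that $$\vdash\Big\{\mathsf{phase}(\tau)*\mathsf{obs}(\emptyset)*\mathop{\ast}_{i=1}^N\mathsf{itPerm}(\tau,\delta_i)\Big\}\ c\ \{\mathsf{obs}(\emptyset)\}.$$ Then for every thread ID $\theta_0$ there is no fair infinite reduction sequence $(h_i,tp_i)_{i\in\mathbb N}$ with $h_0=\emptyset$ and $tp_0=\{(\theta_0,c)\}$. -/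

import Mathlib

namespace GhostSignals

universe u

/-! ## Parameters of the programming language and of the logic -/

/-- The base sets. Inclusions `{tt}, 𝔹, HeapLocs ⊆ Values` are rendered by maps into `Val`.
`interp` gives the partial function on values denoted by an operation. -/
structure Univ : Type (u + 1) where
  Var : Type u
  Loc : Type u
  GLoc : Type u
  Level : Type u
  Degree : Type u
  ID : Type u
  ThreadID : Type u
  Val : Type u
  GVal : Type u
  Op : Type u
  varInfinite : Infinite Var
  locInfinite : Infinite Loc
  glocInfinite : Infinite GLoc
  levelOrder : PartialOrder Level
  levelWF : WellFoundedLT Level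
  levelInfinite : Infinite Level
  degreeOrder : PartialOrder Degree
  degreeWF : WellFoundedLT Degree
  degreeInfinite : Infinite Degree
  idInfinite : Infinite ID
  threadIDOrder : LinearOrder ThreadID
  threadIDWF : WellFoundedLT ThreadID
  threadIDInfinite : Infinite ThreadID
  unit : Val
  ofBool : Bool → Val
  ofBool_injective : Function.Injective ofBool
  ofLoc : Loc → Val
  ofLoc_injective : Function.Injective ofLoc
  interp : Op → List Val → Option Val

attribute [instance] Univ.varInfinite Univ.locInfinite Univ.glocInfinite Univ.levelOrder
  Univ.levelWF Univ.levelInfinite Univ.degreeOrder Univ.degreeWF Univ.degreeInfinite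
  Univ.idInfinite Univ.threadIDOrder Univ.threadIDWF Univ.threadIDInfinite

/-! ## Syntax -/

inductive Exp (U : Univ.{u}) : Type u where
  | var (x : U.Var)
  | val (v : U.Val)
  | eq (e₁ e₂ : Exp U)
  | not (e : Exp U)
  | op (o : U.Op) (args : List (Exp U))

/-- Commands. `whileSkip c` is `while c do skip`, `letIn x c c'` is `let x := c in c'`,
`ifThen c c'` is `if c then c'`, `alloc e` is `cons(e)`, `read e` is `[e]` and `assign e e'` is
`[e] := e'`. The intermediate command `consumeItPerm` has neither a reduction rule nor a
proof rule. -/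
inductive Cmd (U : Univ.{u}) : Type u where
  | whileSkip (c : Cmd U)
  | fork (c : Cmd U)
  | letIn (x : U.Var) (c c' : Cmd U)
  | ifThen (c c' : Cmd U)
  | alloc (e : Exp U)
  | read (e : Exp U)
  | assign (e e' : Exp U)
  | newMutex
  | acquire (e : Exp U)
  | release (e : Exp U)
  | exp (e : Exp U)
  | consumeItPerm

mutual
/-- Substitution of the value `v` for the variable `x` in an expression. -/
noncomputable def Exp.subst {U : Univ.{u}} (x : U.Var) (v : U.Val) : Exp U → Exp U
  | .var y => by
      classical
      exact if y = x then .val v else .var y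
  | .val w => .val w
  | .eq e₁ e₂ => .eq (Exp.subst x v e₁) (Exp.subst x v e₂)
  | .not e => .not (Exp.subst x v e)
  | .op o args => .op o (Exp.substList x v args)
/-- Substitution in a list of expressions. -/
noncomputable def Exp.substList {U : Univ.{u}} (x : U.Var) (v : U.Val) :
    List (Exp U) → List (Exp U)
  | [] => []
  | e :: es => Exp.subst x v e :: Exp.substList x v es
end

/-- Substitution of the value `v` for the free occurrences of `x` in a command. -/
noncomputable def Cmd.subst {U : Univ.{u}} (x : U.Var) (v : U.Val) : Cmd U → Cmd U
  | .whileSkip c => .whileSkip (c.subst x v)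
  | .fork c => .fork (c.subst x v)
  | .letIn y c c' => by
      classical
      exact .letIn y (c.subst x v) (if y = x then c' else c'.subst x v)
  | .ifThen c c' => .ifThen (c.subst x v) (c'.subst x v)
  | .alloc e => .alloc (e.subst x v)
  | .read e => .read (e.subst x v)
  | .assign e e' => .assign (e.subst x v) (e'.subst x v)
  | .newMutex => .newMutex
  | .acquire e => .acquire (e.subst x v)
  | .release e => .release (e.subst x v)
  | .exp e => .exp (e.subst x v)
  | .consumeItPerm => .consumeItPerm

mutual
/-- Partial evaluation of expressions; `none` is the undefined value `⊥`. -/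
noncomputable def Exp.eval {U : Univ.{u}} : Exp U → Option U.Val
  | .var _ => none
  | .val v => some v
  | .eq e₁ e₂ => by
      classical
      exact (Exp.eval e₁).bind fun v₁ => (Exp.eval e₂).bind fun v₂ =>
        some (U.ofBool (decide (v₁ = v₂)))
  | .not e => by
      classical
      exact (Exp.eval e).bind fun v =>
        if v = U.ofBool true then some (U.ofBool false)
        else if v = U.ofBool false then some (U.ofBool true)
        else none
  | .op o args => (Exp.evalList args).bind (U.interp o)
/-- Evaluation of a list of expressions: defined if all members have a value. -/
noncomputable def Exp.evalList {U : Univ.{u}} : List (Exp U) → Option (List U.Val)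
  | [] => some []
  | e :: es => (Exp.eval e).bind fun v => (Exp.evalList es).bind fun vs => some (v :: vs)
end

/-! ## Operational semantics -/

inductive PhysRes (U : Univ.{u}) : Type u where
  | pointsTo (ℓ : U.Loc) (v : U.Val)
  | unlocked (ℓ : U.Loc)
  | locked (ℓ : U.Loc)

/-- Physical heaps are finite sets of physical resources. -/
abbrev PhysHeap (U : Univ.{u}) : Type u := Finset (PhysRes U)

/-- The allocated heap locations of a physical heap. -/
def PhysHeap.locs {U : Univ.{u}} (h : PhysHeap U) : Set U.Loc :=
  {ℓ | .unlocked ℓ ∈ h ∨ .locked ℓ ∈ h ∨ ∃ v, .pointsTo ℓ v ∈ h}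

/-- `h ∪ {r}`. -/
noncomputable def PhysHeap.add {U : Univ.{u}} (h : PhysHeap U) (r : PhysRes U) : PhysHeap U := by
  classical
  exact insert r h

/-- `h \ {r}`. -/
noncomputable def PhysHeap.remove {U : Univ.{u}} (h : PhysHeap U) (r : PhysRes U) :
    PhysHeap U := by
  classical
  exact h.erase r

/-- Evaluation contexts `if □ then c` and `let x := □ in c`. -/
inductive EvalCtxt (U : Univ.{u}) : Type u where
  | ifThen (c : Cmd U)
  | letIn (x : U.Var) (c : Cmd U)

def EvalCtxt.fill {U : Univ.{u}} : EvalCtxt U → Cmd U → Cmd U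
  | .ifThen c', c => .ifThen c c'
  | .letIn x c', c => .letIn x c c'

/-- Single-thread reduction: `STStep h c h' c' T` says that command `c` in heap `h` reduces in one
step to `c'` and heap `h'`, forking the threads in `T` (none, or a single one). Closed
expressions are identified with their values. -/
inductive STStep {U : Univ.{u}} :
    PhysHeap U → Cmd U → PhysHeap U → Cmd U → Option (Cmd U) → Prop where
  | evalCtxt {h h' : PhysHeap U} {c c' : Cmd U} {T : Option (Cmd U)} (E : EvalCtxt U)
      (hc : STStep h c h' c' T) :
      STStep h (E.fill c) h' (E.fill c') T
  | fork (h : PhysHeap U) (c : Cmd U) :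
      STStep h (.fork c) h (.exp (.val U.unit)) (some c)
  | whileSkip (h : PhysHeap U) (c : Cmd U) :
      STStep h (.whileSkip c) h (.ifThen c (.whileSkip c)) none
  | ifTrue (h : PhysHeap U) (e : Exp U) (c : Cmd U) (he : e.eval = some (U.ofBool true)) :
      STStep h (.ifThen (.exp e) c) h c none
  | ifFalse (h : PhysHeap U) (e : Exp U) (c : Cmd U) (he : e.eval = some (U.ofBool false)) :
      STStep h (.ifThen (.exp e) c) h (.exp (.val U.unit)) none
  | letIn (h : PhysHeap U) (x : U.Var) (e : Exp U) (v : U.Val) (c : Cmd U)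
      (he : e.eval = some v) :
      STStep h (.letIn x (.exp e) c) h (c.subst x v) none
  | alloc (h : PhysHeap U) (e : Exp U) (v : U.Val) (ℓ : U.Loc) (he : e.eval = some v)
      (hℓ : ℓ ∉ h.locs) :
      STStep h (.alloc e) (h.add (.pointsTo ℓ v)) (.exp (.val (U.ofLoc ℓ))) none
  | read (h : PhysHeap U) (e : Exp U) (ℓ : U.Loc) (v : U.Val) (he : e.eval = some (U.ofLoc ℓ))
      (hℓ : .pointsTo ℓ v ∈ h) :
      STStep h (.read e) h (.exp (.val v)) none
  | assign (h : PhysHeap U) (e e' : Exp U) (ℓ : U.Loc) (v v' : U.Val)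
      (he : e.eval = some (U.ofLoc ℓ)) (he' : e'.eval = some v') (hℓ : .pointsTo ℓ v ∈ h) :
      STStep h (.assign e e') ((h.remove (.pointsTo ℓ v)).add (.pointsTo ℓ v'))
        (.exp (.val U.unit)) none
  | newMutex (h : PhysHeap U) (ℓ : U.Loc) (hℓ : ℓ ∉ h.locs) :
      STStep h .newMutex (h.add (.unlocked ℓ)) (.exp (.val (U.ofLoc ℓ))) none
  | acquire (h : PhysHeap U) (e : Exp U) (ℓ : U.Loc) (he : e.eval = some (U.ofLoc ℓ))
      (hℓ : .unlocked ℓ ∈ h) :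
      STStep h (.acquire e) ((h.remove (.unlocked ℓ)).add (.locked ℓ)) (.exp (.val U.unit)) none
  | release (h : PhysHeap U) (e : Exp U) (ℓ : U.Loc) (he : e.eval = some (U.ofLoc ℓ))
      (hℓ : .locked ℓ ∈ h) :
      STStep h (.release e) ((h.remove (.locked ℓ)).add (.unlocked ℓ)) (.exp (.val U.unit)) none

/-- A thread is a command still to be run, or the symbol for a terminated thread. -/
inductive Thread (U : Univ.{u}) : Type u where
  | running (c : Cmd U)
  | terminated

/-- Thread pools: finite partial functions from thread IDs to threads. -/
@[ext]
structure ThreadPool (U : Univ.{u}) : Type u where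
  get : U.ThreadID → Option (Thread U)
  finite_dom : {θ | get θ ≠ none}.Finite

/-- `tp[θ := t]`. -/
noncomputable def ThreadPool.set {U : Univ.{u}} (tp : ThreadPool U) (θ : U.ThreadID)
    (t : Thread U) : ThreadPool U where
  get := Function.update tp.get θ (some t)
  finite_dom := (tp.finite_dom.insert θ).subset fun θ' hθ' => by
    by_cases h : θ' = θ
    · exact Or.inl h
    · exact Or.inr (by simpa [Function.update_of_ne h] using hθ')

/-- The pool `{(θ, t)}` with exactly one thread. -/
noncomputable def ThreadPool.single {U : Univ.{u}} (θ : U.ThreadID) (t : Thread U) :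
    ThreadPool U :=
  ThreadPool.set ⟨fun _ => none, by simp⟩ θ t

theorem ThreadPool.exists_fresh {U : Univ.{u}} (tp : ThreadPool U) :
    {θ | tp.get θ = none}.Nonempty := by
  obtain ⟨θ, hθ⟩ := tp.finite_dom.infinite_compl.nonempty
  exact ⟨θ, by simpa using hθ⟩

/-- The least thread ID outside the domain of the pool. -/
noncomputable def ThreadPool.fresh {U : Univ.{u}} (tp : ThreadPool U) : U.ThreadID :=
  wellFounded_lt.min {θ | tp.get θ = none} tp.exists_fresh

/-- Extension of a pool by the forked thread, if there is one. -/
noncomputable def ThreadPool.add {U : Univ.{u}} (tp : ThreadPool U) :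
    Option (Cmd U) → ThreadPool U
  | none => tp
  | some c => tp.set tp.fresh (.running c)

/-- `TPStep h tp θ h' tp'`: the configuration `(h, tp)` reduces to `(h', tp')` in one step of
thread `θ`. -/
inductive TPStep {U : Univ.{u}} :
    PhysHeap U → ThreadPool U → U.ThreadID → PhysHeap U → ThreadPool U → Prop where
  | lift {h h' : PhysHeap U} {tp : ThreadPool U} {θ : U.ThreadID} {c c' : Cmd U}
      {T : Option (Cmd U)} (hθ : tp.get θ = some (.running c)) (hc : STStep h c h' c' T) :
      TPStep h tp θ h' ((tp.set θ (.running c')).add T)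
  | term {h : PhysHeap U} {tp : ThreadPool U} {θ : U.ThreadID} {e : Exp U} {v : U.Val}
      (hθ : tp.get θ = some (.running (.exp e))) (he : e.eval = some v) :
      TPStep h tp θ h (tp.set θ .terminated)

/-- Infinite reduction sequences. -/
def IsReductionSequence {U : Univ.{u}} (h : ℕ → PhysHeap U) (tp : ℕ → ThreadPool U) : Prop :=
  ∃ θ : ℕ → U.ThreadID, ∀ i, TPStep (h i) (tp i) (θ i) (h (i + 1)) (tp (i + 1))

/-- Fairness: a thread that has not terminated is always reduced eventually. -/
def IsFair {U : Univ.{u}} (h : ℕ → PhysHeap U) (tp : ℕ → ThreadPool U) : Prop :=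
  ∀ (i : ℕ) (θ : U.ThreadID) (c : Cmd U), (tp i).get θ = some (.running c) →
    ∃ k, i ≤ k ∧ TPStep (h k) (tp k) θ (h (k + 1)) (tp (k + 1))

/-! ## Assertions -/

/-- Fractions `0 < f ≤ 1`. -/
abbrev Frac : Type := {f : ℚ // 0 < f ∧ f ≤ 1}

/-- The full fraction. -/
def Frac.one : Frac := ⟨1, by norm_num⟩

/-- A fraction as a nonnegative rational. -/
def Frac.toNNRat (f : Frac) : NNRat := ⟨f.1, f.2.1.le⟩

inductive PhaseLit : Type u where
  | forker
  | forkee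

/-- Phase IDs; `τ₁ <+: τ₂` says that `τ₁` is a (non-strict) prefix of `τ₂`. -/
abbrev PhaseID : Type u := List PhaseLit.{u}

/-- Bags over `X`, with union `+`, the empty bag `0` and the singleton `Bag.single x`. -/
abbrev Bag (X : Type u) : Type u := X → ℕ

noncomputable def Bag.single {X : Type u} (x : X) : Bag X := by
  classical
  exact Pi.single x 1

/-- Ghost signals: an ID and a level. -/
abbrev Signal (U : Univ.{u}) : Type u := U.ID × U.Level

/-- Mutexes: a heap location and a level. -/
abbrev Mutex (U : Univ.{u}) : Type u := U.Loc × U.Level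

/-- Obligations: a heap location or an ID, and a level. -/
abbrev Ob (U : Univ.{u}) : Type u := (U.Loc ⊕ U.ID) × U.Level

/-- The obligation to set a signal. -/
def Signal.ob {U : Univ.{u}} (s : Signal U) : Ob U := (.inr s.1, s.2)

/-- The obligation to release a mutex. -/
def Mutex.ob {U : Univ.{u}} (m : Mutex U) : Ob U := (.inl m.1, m.2)

/-- `L ≺ O`: the level `L` is strictly below the level of every obligation in the bag `O`. -/
def LevelBelow {U : Univ.{u}} (L : U.Level) (O : Bag (Ob U)) : Prop :=
  ∀ o : Ob U, 0 < O o → L < o.2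

/-- Assertions. Disjunctions `⋁` are taken over families indexed by an arbitrary type; they
also serve as existential quantifiers. `mutex f m P` asserts fraction `f` of the mutex `m` with
lock invariant `P`; `locked f m P f'` asserts fraction `f` of the knowledge that `m` is locked,
where fraction `f'` of the mutex chunk was given up in acquiring it. -/
inductive Assertion (U : Univ.{u}) : Type (u + 1) where
  | tt
  | ff
  | neg (A : Assertion U)
  | and (A B : Assertion U)
  | or (A B : Assertion U)
  | star (A B : Assertion U)
  | pointsTo (f : Frac) (ℓ : U.Loc) (v : U.Val)
  | ghostPointsTo (f : Frac) (ℓ : U.GLoc) (v : U.GVal)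
  | bigOr {ι : Type u} (A : ι → Assertion U)
  | uninit (f : Frac) (ℓ : U.Loc)
  | mutex (f : Frac) (m : Mutex U) (P : Assertion U)
  | locked (f : Frac) (m : Mutex U) (P : Assertion U) (f' : Frac)
  | signal (f : Frac) (s : Signal U) (b : Bool)
  | phase (τ : PhaseID.{u})
  | obs (O : Bag (Ob U))
  | waitPerm (τ : PhaseID.{u}) (id : U.ID) (δ : U.Degree)
  | itPerm (τ : PhaseID.{u}) (δ : U.Degree)

infixr:67 " ∗∗ " => Assertion.star

/-- A pure fact as an assertion. -/
noncomputable def Assertion.pure {U : Univ.{u}} (p : Prop) : Assertion U := by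
  classical
  exact if p then .tt else .ff

/-- `A₁ ∗ ⋯ ∗ Aₙ`; the empty conjunction is `True`. -/
def Assertion.bigStar {U : Univ.{u}} (As : List (Assertion U)) : Assertion U :=
  As.foldr Assertion.star .tt

/-- "There is no phase chunk and no obligations chunk." -/
def Assertion.noPhaseObs {U : Univ.{u}} : Assertion U :=
  .neg (.or (.bigOr fun τ : PhaseID.{u} => .phase τ) (.bigOr fun O : Bag (Ob U) => .obs O))

/-- Logical resources. -/
inductive LogRes (U : Univ.{u}) : Type (u + 1) where
  | pointsTo (ℓ : U.Loc) (v : U.Val)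
  | ghostPointsTo (ℓ : U.GLoc) (v : U.GVal)
  | signal (s : Signal U) (b : Bool)
  | uninit (ℓ : U.Loc)
  | mutex (m : Mutex U) (P : Assertion U)
  | locked (m : Mutex U) (P : Assertion U) (f : Frac)
  | phase (τ : PhaseID.{u})
  | obs (O : Bag (Ob U))
  | waitPerm (τ : PhaseID.{u}) (id : U.ID) (δ : U.Degree)
  | itPerm (τ : PhaseID.{u}) (δ : U.Degree)

/-- The heap locations involved in a logical resource. -/
def LogRes.hlocs {U : Univ.{u}} : LogRes U → Set U.Loc
  | .pointsTo ℓ _ => {ℓ}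
  | .uninit ℓ => {ℓ}
  | .mutex m _ => {m.1}
  | .locked m _ _ => {m.1}
  | _ => ∅

/-- The ghost locations involved in a logical resource. -/
def LogRes.glocs {U : Univ.{u}} : LogRes U → Set U.GLoc
  | .ghostPointsTo ℓ _ => {ℓ}
  | _ => ∅

/-- Logical heaps. -/
abbrev LogHeap (U : Univ.{u}) : Type (u + 1) := LogRes U → NNRat

/-- The two resources describe the same mutex with the same invariant, one of them as a locked
chunk and the other as the remaining part of its mutex chunk. -/
def LogRes.LockedPair {U : Univ.{u}} (r₁ r₂ : LogRes U) : Prop :=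
  ∃ (m : Mutex U) (P : Assertion U) (f : Frac),
    (r₁ = .mutex m P ∧ r₂ = .locked m P f) ∨ (r₁ = .locked m P f ∧ r₂ = .mutex m P)

/-- Consistent logical heaps: phase, obligations, wait permission and iteration permission chunks
are not split, and heap and ghost locations are unique (except that the chunk of a locked mutex
may stand beside a remaining part of its mutex chunk). -/
structure LogHeap.Consistent {U : Univ.{u}} (H : LogHeap U) : Prop where
  phase : ∀ τ, ∃ n : ℕ, H (.phase τ) = n
  obs : ∀ O, ∃ n : ℕ, H (.obs O) = n
  waitPerm : ∀ τ id δ, ∃ n : ℕ, H (.waitPerm τ id δ) = n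
  itPerm : ∀ τ δ, ∃ n : ℕ, H (.itPerm τ δ) = n
  hlocs : ∀ r₁ r₂ : LogRes U, r₁ ≠ r₂ → 0 < H r₁ → 0 < H r₂ →
    Disjoint r₁.hlocs r₂.hlocs ∨ r₁.LockedPair r₂
  glocs : ∀ r₁ r₂ : LogRes U, r₁ ≠ r₂ → 0 < H r₁ → 0 < H r₂ → Disjoint r₁.glocs r₂.glocs

/-- The model relation `H ⊨ A`. -/
def Sat {U : Univ.{u}} (H : LogHeap U) : Assertion U → Prop
  | .tt => True
  | .ff => False
  | .neg A => ¬ Sat H A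
  | .and A B => Sat H A ∧ Sat H B
  | .or A B => Sat H A ∨ Sat H B
  | .star A B => ∃ H₁ H₂ : LogHeap U, H = H₁ + H₂ ∧ Sat H₁ A ∧ Sat H₂ B
  | .pointsTo f ℓ v => f.toNNRat ≤ H (.pointsTo ℓ v)
  | .ghostPointsTo f ℓ v => f.toNNRat ≤ H (.ghostPointsTo ℓ v)
  | .bigOr A => ∃ i, Sat H (A i)
  | .uninit f ℓ => f.toNNRat ≤ H (.uninit ℓ)
  | .mutex f m P => f.toNNRat ≤ H (.mutex m P)
  | .locked f m P f' => f.toNNRat ≤ H (.locked m P f')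
  | .signal f s b => f.toNNRat ≤ H (.signal s b)
  | .phase τ => 1 ≤ H (.phase τ)
  | .obs O => 1 ≤ H (.obs O)
  | .waitPerm τ id δ => 1 ≤ H (.waitPerm τ id δ)
  | .itPerm τ δ => 1 ≤ H (.itPerm τ δ)

/-! ## Proof rules -/

/-- View shifts `A ⇛ B`. -/
inductive ViewShift {U : Univ.{u}} : Assertion U → Assertion U → Prop where
  | semImp {A B : Assertion U} (hAB : ∀ H : LogHeap U, H.Consistent → Sat H A → Sat H B) :
      ViewShift A B
  | trans {A B C : Assertion U} (hAC : ViewShift A C) (hCB : ViewShift C B) : ViewShift A B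
  | or {A₁ A₂ B : Assertion U} (h₁ : ViewShift A₁ B) (h₂ : ViewShift A₂ B) :
      ViewShift (.or A₁ A₂) B
  | frame {A B : Assertion U} (F : Assertion U) (hAB : ViewShift A B) :
      ViewShift (A ∗∗ F) (B ∗∗ F)
  | newSignal (O : Bag (Ob U)) (L : U.Level) :
      ViewShift (.obs O)
        (.bigOr fun id : U.ID =>
          .obs (O + Bag.single (Signal.ob (id, L))) ∗∗ .signal .one (id, L) false)
  | setSignal (O : Bag (Ob U)) (s : Signal U) :
      ViewShift (.obs (O + Bag.single s.ob) ∗∗ .signal .one s false)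
        (.obs O ∗∗ .signal .one s true)
  | waitPerm (τ : PhaseID.{u}) (id : U.ID) {δ δ' : U.Degree} (hδ : δ' < δ) :
      ViewShift (.itPerm τ δ) (.waitPerm τ id δ')
  | wait {τ τ' : PhaseID.{u}} {O : Bag (Ob U)} {s : Signal U} (f : Frac) (δ : U.Degree)
      (hτ : τ' <+: τ) (hs : LevelBelow s.2 O) :
      ViewShift
        (.phase τ ∗∗ .obs O ∗∗ .waitPerm τ' s.1 δ ∗∗ .signal f s false)
        (.phase τ ∗∗ .obs O ∗∗ .waitPerm τ' s.1 δ ∗∗ .signal f s false ∗∗ .itPerm τ δ)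
  | specItPerm {τ τ' : PhaseID.{u}} (δ : U.Degree) (hτ : τ' <+: τ) :
      ViewShift (.itPerm τ' δ) (.itPerm τ δ)
  | specWaitPerm {τ τ' : PhaseID.{u}} (id : U.ID) (δ : U.Degree) (hτ : τ' <+: τ) :
      ViewShift (.waitPerm τ' id δ) (.waitPerm τ id δ)
  | weakItPerm (τ : PhaseID.{u}) {δ δ' : U.Degree} (n : ℕ) (hδ : δ' < δ) :
      ViewShift (.itPerm τ δ) (.bigStar (List.replicate n (.itPerm τ δ')))
  | mutInit (m : Mutex U) (P : Assertion U) :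
      ViewShift (.uninit .one m.1 ∗∗ .and P .noPhaseObs) (.mutex .one m P)
  | newGhostCell (v : U.GVal) :
      ViewShift .tt (.bigOr fun ℓ : U.GLoc => .ghostPointsTo .one ℓ v)
  | mutateGhostCell (ℓ : U.GLoc) (v v' : U.GVal) :
      ViewShift (.ghostPointsTo .one ℓ v) (.ghostPointsTo .one ℓ v')

/-- The proof relation: `Provable A c B` is `⊢ {A} c {r. B r}`. -/
inductive Provable {U : Univ.{u}} : Assertion U → Cmd U → (U.Val → Assertion U) → Prop where
  | frame {A : Assertion U} {c : Cmd U} {B : U.Val → Assertion U} (F : Assertion U)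
      (hc : Provable A c B) :
      Provable (A ∗∗ F) c (fun r => B r ∗∗ F)
  | viewShift {A A' : Assertion U} {c : Cmd U} {B B' : U.Val → Assertion U}
      (hA : ViewShift A A') (hc : Provable A' c B') (hB : ∀ r, ViewShift (B' r) (B r)) :
      Provable A c B
  | exp {e : Exp U} {v : U.Val} (he : e.eval = some v) :
      Provable .tt (.exp e) (fun r => .pure (r = v))
  | exists {ι : Type u} {A : ι → Assertion U} {c : Cmd U} {B : U.Val → Assertion U}
      (hc : ∀ i, Provable (A i) c B) :
      Provable (.bigOr A) c B
  | fork {τ : PhaseID.{u}} {Om Of : Bag (Ob U)} {A : Assertion U} {c : Cmd U}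
      (hc : Provable (.phase (τ ++ [.forkee]) ∗∗ .obs Of ∗∗ A) c (fun _ => .obs 0)) :
      Provable (.phase τ ∗∗ .obs (Om + Of) ∗∗ A) (.fork c)
        (fun r => .pure (r = U.unit) ∗∗ .phase (τ ++ [.forker]) ∗∗ .obs Om)
  | ifThen {A : Assertion U} {c c' : Cmd U} {C B : U.Val → Assertion U}
      (hc : Provable A c
        (fun b => .and (C b) (.pure (b = U.ofBool true ∨ b = U.ofBool false))))
      (hTrue : Provable (C (U.ofBool true)) c' B)
      (hFalse : ViewShift (C (U.ofBool false)) (B U.unit)) :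
      Provable A (.ifThen c c') B
  /- Whenever the condition evaluates to true, an iteration permission qualified by an ancestor of
  the current phase is consumed, and what remains has to re-establish the invariant `I`. -/
  | whileSkip {I B : Assertion U} {J : PhaseID.{u} → Assertion U} {c : Cmd U}
      (hc : Provable I c (fun b =>
        .or
          (.pure (b = U.ofBool true) ∗∗
            .bigOr fun p : PhaseID.{u} × PhaseID.{u} × U.Degree =>
              .pure (p.2.1 <+: p.1) ∗∗ .phase p.1 ∗∗ .itPerm p.2.1 p.2.2 ∗∗ J p.1)
          (.pure (b = U.ofBool false) ∗∗ B)))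
      (hI : ∀ τ, ViewShift (.phase τ ∗∗ J τ) I) :
      Provable I (.whileSkip c) (fun r => .pure (r = U.unit) ∗∗ B)
  | letIn {A : Assertion U} {x : U.Var} {c c' : Cmd U} {C B : U.Val → Assertion U}
      (hc : Provable A c C) (hc' : ∀ v, Provable (C v) (c'.subst x v) B) :
      Provable A (.letIn x c c') B
  | acquire {e : Exp U} {m : Mutex U} {P : Assertion U} {f : Frac} {O : Bag (Ob U)}
      (he : e.eval = some (U.ofLoc m.1)) (hm : LevelBelow m.2 O) :
      Provable (.obs O ∗∗ .mutex f m P) (.acquire e)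
        (fun r => .pure (r = U.unit) ∗∗ .obs (O + Bag.single m.ob) ∗∗ .locked .one m P f ∗∗ P)
  /- The view shift happens when the obligation to release `m` is already discharged but the lock
  invariant is not yet given up. -/
  | release {e : Exp U} {m : Mutex U} {P A B : Assertion U} {f : Frac} {O O' : Bag (Ob U)}
      (he : e.eval = some (U.ofLoc m.1))
      (hA : ViewShift (.obs O ∗∗ A) (.obs O' ∗∗ .and P .noPhaseObs ∗∗ B)) :
      Provable (.obs (O + Bag.single m.ob) ∗∗ .locked .one m P f ∗∗ A) (.release e)
        (fun r => .pure (r = U.unit) ∗∗ .obs O' ∗∗ .mutex f m P ∗∗ B)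
  | newMutex :
      Provable .tt .newMutex
        (fun r => .bigOr fun ℓ : U.Loc => .pure (r = U.ofLoc ℓ) ∗∗ .uninit .one ℓ)
  | alloc {e : Exp U} {v : U.Val} (he : e.eval = some v) :
      Provable .tt (.alloc e)
        (fun r => .bigOr fun ℓ : U.Loc => .pure (r = U.ofLoc ℓ) ∗∗ .pointsTo .one ℓ v)
  | read {e : Exp U} {ℓ : U.Loc} {f : Frac} {v : U.Val} (he : e.eval = some (U.ofLoc ℓ)) :
      Provable (.pointsTo f ℓ v) (.read e) (fun r => .pure (r = v) ∗∗ .pointsTo f ℓ v)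
  | assign {e e' : Exp U} {ℓ : U.Loc} {v v' : U.Val} (he : e.eval = some (U.ofLoc ℓ))
      (he' : e'.eval = some v') :
      Provable (.pointsTo .one ℓ v) (.assign e e')
        (fun r => .pure (r = U.unit) ∗∗ .pointsTo .one ℓ v')

end GhostSignals

namespace GhostSignals

universe u

variable {U : Univ.{u}}

/-! ## Indivisible resources and rounding -/

/-- Resources that occur in consistent heaps an integral number of times. -/
def LogRes.Indivisible : LogRes U → Prop
  | .phase _ => True
  | .obs _ => True
  | .waitPerm _ _ _ => True
  | .itPerm _ _ => True
  | _ => False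

/-- Resources that belong to one thread and cannot be passed on. -/
def LogRes.ThreadLocal : LogRes U → Prop
  | .phase _ => True
  | .obs _ => True
  | _ => False

/-- Heaps that agree up to rounding down the amounts of the indivisible resources. -/
def LogHeap.Sim (H H' : LogHeap U) : Prop :=
  ∀ r, (r.Indivisible → ⌊H r⌋₊ = ⌊H' r⌋₊) ∧ (¬ r.Indivisible → H r = H' r)

theorem LogHeap.Sim.symm {H H' : LogHeap U} (h : H.Sim H') : H'.Sim H :=
  fun r => ⟨fun hr => ((h r).1 hr).symm, fun hr => ((h r).2 hr).symm⟩

/-- Two fractional parts add up to less than 2, so `x` exceeds the sum of the two floors by some `t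
< 2`, and half of `t` can be given to each summand without reaching the next integer. -/
theorem exists_add_floor_eq (x₁ x₂ x : NNRat) (h : ⌊x₁ + x₂⌋₊ = ⌊x⌋₊) :
    ∃ y₁ y₂ : NNRat, x = y₁ + y₂ ∧ ⌊x₁⌋₊ = ⌊y₁⌋₊ ∧ ⌊x₂⌋₊ = ⌊y₂⌋₊ := by
  have h1 : (⌊x₁⌋₊ : NNRat) ≤ x₁ := Nat.floor_le zero_le
  have h2 : (⌊x₂⌋₊ : NNRat) ≤ x₂ := Nat.floor_le zero_le
  have h3 := Nat.lt_floor_add_one x₁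
  have h4 := Nat.lt_floor_add_one x₂
  have h5 : (⌊x⌋₊ : NNRat) ≤ x := Nat.floor_le zero_le
  have h6 := Nat.lt_floor_add_one x
  have hle : ⌊x₁⌋₊ + ⌊x₂⌋₊ ≤ ⌊x⌋₊ := by
    rw [← h]
    apply Nat.le_floor
    push_cast
    exact add_le_add h1 h2
  have hge : ⌊x⌋₊ < ⌊x₁⌋₊ + ⌊x₂⌋₊ + 2 := by
    rw [← h, Nat.floor_lt zero_le]
    push_cast
    calc x₁ + x₂ < (⌊x₁⌋₊ + 1) + (⌊x₂⌋₊ + 1) := add_lt_add h3 h4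
      _ = _ := by ring
  generalize ⌊x₁⌋₊ = a at *
  generalize ⌊x₂⌋₊ = b at *
  have hab : ((a + b : ℕ) : NNRat) ≤ x := le_trans (by exact_mod_cast hle) h5
  obtain ⟨t, rfl⟩ := exists_add_of_le hab
  have ht : t < 2 := by
    have : ((a + b : ℕ) : NNRat) + t < ((a + b : ℕ) : NNRat) + 2 := by
      refine lt_of_lt_of_le h6 ?_
      have : ⌊((a + b : ℕ) : NNRat) + t⌋₊ + 1 ≤ a + b + 2 := by omega
      exact_mod_cast this
    exact lt_of_add_lt_add_left this
  have ht' : t / 2 < 1 := by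
    rw [div_lt_one (by norm_num)]
    exact ht
  refine ⟨a + t / 2, b + t / 2, ?_, ?_, ?_⟩
  · push_cast
    rw [add_add_add_comm, add_halves]
  · rw [add_comm, Nat.floor_add_natCast zero_le, Nat.floor_eq_zero.2 ht', zero_add]
  · rw [add_comm, Nat.floor_add_natCast zero_le, Nat.floor_eq_zero.2 ht', zero_add]

/-- This is what makes rounding compatible with separating conjunction, even though a heap may be
split there into parts with fractions of indivisible resources. -/
theorem LogHeap.Sim.split {H₁ H₂ H : LogHeap U} (h : LogHeap.Sim (H₁ + H₂) H) :
    ∃ K₁ K₂ : LogHeap U, H = K₁ + K₂ ∧ H₁.Sim K₁ ∧ H₂.Sim K₂ := by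
  have : ∀ r, ∃ y₁ y₂ : NNRat, H r = y₁ + y₂ ∧
      ((r.Indivisible → ⌊H₁ r⌋₊ = ⌊y₁⌋₊) ∧ (¬ r.Indivisible → H₁ r = y₁)) ∧
      ((r.Indivisible → ⌊H₂ r⌋₊ = ⌊y₂⌋₊) ∧ (¬ r.Indivisible → H₂ r = y₂)) := by
    intro r
    by_cases hr : r.Indivisible
    · obtain ⟨y₁, y₂, h0, h1, h2⟩ := exists_add_floor_eq _ _ _ ((h r).1 hr)
      exact ⟨y₁, y₂, h0, ⟨fun _ => h1, fun h => absurd hr h⟩, ⟨fun _ => h2, fun h => absurd hr h⟩⟩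
    · exact ⟨H₁ r, H₂ r, ((h r).2 hr).symm, ⟨fun h => absurd h hr, fun _ => rfl⟩,
        ⟨fun h => absurd h hr, fun _ => rfl⟩⟩
  choose K₁ K₂ h0 h1 h2 using this
  exact ⟨K₁, K₂, funext h0, h1, h2⟩

theorem LogHeap.Sim.one_le {H H' : LogHeap U} (h : H.Sim H') {r : LogRes U}
    (hr : r.Indivisible) (h1 : 1 ≤ H r) : 1 ≤ H' r := by
  have := Nat.le_floor (n := 1) (a := H r) (by exact_mod_cast h1)
  rw [(h r).1 hr] at this
  exact_mod_cast (Nat.le_floor_iff zero_le).1 this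

/-- An indivisible atom asks for an amount of at least 1, which depends on the floor only. Negation
is harmless because `Sim` is symmetric. -/
theorem Sat.of_sim {A : Assertion U} : ∀ {H H' : LogHeap U}, H.Sim H' → Sat H A → Sat H' A := by
  induction A with
  | tt => intro H H' _ _; trivial
  | ff => intro H H' _ h; exact h
  | neg A ih => intro H H' hs h h'; exact h (ih hs.symm h')
  | and A B ihA ihB => intro H H' hs h; exact ⟨ihA hs h.1, ihB hs h.2⟩
  | or A B ihA ihB => intro H H' hs h; exact h.imp (ihA hs) (ihB hs)
  | star A B ihA ihB =>
      rintro H H' hs ⟨H₁, H₂, rfl, h1, h2⟩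
      obtain ⟨K₁, K₂, rfl, s1, s2⟩ := hs.split
      exact ⟨K₁, K₂, rfl, ihA s1 h1, ihB s2 h2⟩
  | bigOr A ih => rintro H H' hs ⟨i, h⟩; exact ⟨i, ih i hs h⟩
  | pointsTo | ghostPointsTo | uninit | mutex | locked | signal =>
      intro H H' hs h
      simp only [Sat] at h ⊢
      rwa [← (hs _).2 (by simp [LogRes.Indivisible])]
  | phase | obs | waitPerm | itPerm =>
      intro H H' hs h
      exact hs.one_le (by simp [LogRes.Indivisible]) h

/-- Rounding down the amounts of the indivisible resources. -/
noncomputable def LogHeap.round (H : LogHeap U) : LogHeap U := by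
  classical
  exact fun r => if r.Indivisible then (⌊H r⌋₊ : NNRat) else H r

theorem LogHeap.sim_round (H : LogHeap U) : H.Sim H.round := by
  intro r
  constructor <;> intro hr <;> simp [LogHeap.round, hr]

theorem LogHeap.round_le (H : LogHeap U) : H.round ≤ H := by
  intro r
  by_cases hr : r.Indivisible
  · simpa [LogHeap.round, hr] using Nat.floor_le (zero_le : 0 ≤ H r)
  · simp [LogHeap.round, hr]

/-- Removal of the thread-local resources. -/
noncomputable def LogHeap.shareable (H : LogHeap U) : LogHeap U := by
  classical
  exact fun r => if r.ThreadLocal then 0 else H r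

theorem LogHeap.shareable_apply_of_not {H : LogHeap U} {r : LogRes U} (hr : ¬ r.ThreadLocal) :
    H.shareable r = H r := by
  simp [LogHeap.shareable, hr]

theorem LogHeap.shareable_apply_of {H : LogHeap U} {r : LogRes U} (hr : r.ThreadLocal) :
    H.shareable r = 0 := by
  simp [LogHeap.shareable, hr]

theorem LogHeap.shareable_zero : (0 : LogHeap U).shareable = 0 := by
  funext r
  simp [LogHeap.shareable]

theorem LogHeap.shareable_le (H : LogHeap U) : H.shareable ≤ H := by
  intro r
  by_cases hr : r.ThreadLocal <;> simp [LogHeap.shareable, hr]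

/-- Without a full phase or obligations chunk, each thread-local amount is below 1 and rounds to 0.
So the contents of a lock invariant can be stripped of thread-local fractions and still satisfy the
invariant. -/
theorem LogHeap.sim_shareable {H : LogHeap U} (h : Sat H .noPhaseObs) : H.Sim H.shareable := by
  have hlt : ∀ r : LogRes U, r.ThreadLocal → H r < 1 := by
    intro r hr
    by_contra hc
    apply h
    cases r with
    | phase τ => exact Or.inl ⟨τ, not_lt.1 hc⟩
    | obs O => exact Or.inr ⟨O, not_lt.1 hc⟩
    | _ => exact absurd hr (by simp [LogRes.ThreadLocal])
  intro r
  by_cases hr : r.ThreadLocal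
  · refine ⟨fun _ => ?_, fun hn => absurd ?_ hn⟩
    · rw [LogHeap.shareable_apply_of hr, Nat.floor_eq_zero.2 (hlt r hr), Nat.floor_zero]
    · cases r <;> simp_all [LogRes.ThreadLocal, LogRes.Indivisible]
  · rw [LogHeap.shareable_apply_of_not hr]
    exact ⟨fun _ => rfl, fun _ => rfl⟩

/-- The heap with amount `a` of the resource `r` and nothing else. -/
noncomputable def LogHeap.chunk (r : LogRes U) (a : NNRat) : LogHeap U := by
  classical
  exact fun x => if x = r then a else 0

@[simp]
theorem LogHeap.chunk_self (r : LogRes U) (a : NNRat) : LogHeap.chunk r a r = a := by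
  simp [LogHeap.chunk]

theorem LogHeap.chunk_of_ne {r x : LogRes U} (h : x ≠ r) (a : NNRat) :
    LogHeap.chunk r a x = 0 := by
  simp [LogHeap.chunk, h]

theorem LogHeap.exists_eq_add_chunk {H : LogHeap U} {r : LogRes U} {a : NNRat} (h : a ≤ H r) :
    ∃ H₀ : LogHeap U, H = H₀ + LogHeap.chunk r a := by
  have : LogHeap.chunk r a ≤ H := by
    intro x
    by_cases hx : x = r
    · subst hx; simpa using h
    · simp [LogHeap.chunk_of_ne hx]
  obtain ⟨H₀, rfl⟩ := exists_add_of_le this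
  exact ⟨H₀, add_comm _ _⟩

@[simp]
theorem Frac.toNNRat_one : Frac.one.toNNRat = 1 := rfl

theorem Frac.toNNRat_pos (f : Frac) : 0 < f.toNNRat := f.2.1

theorem Frac.toNNRat_le_one (f : Frac) : f.toNNRat ≤ 1 := f.2.2

theorem sat_pure {H : LogHeap U} {p : Prop} : Sat H (.pure p) ↔ p := by
  unfold Assertion.pure
  split_ifs with h <;> simp [Sat, h]

/-- Total of a list of iteration permissions. -/
noncomputable def LogHeap.itPerms (τ : PhaseID.{u}) : List U.Degree → LogHeap U
  | [] => 0
  | δ :: ds => LogHeap.chunk (.itPerm τ δ) 1 + LogHeap.itPerms τ ds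

theorem sat_bigStar_itPerms (τ : PhaseID.{u}) (ds : List U.Degree) (H : LogHeap U) :
    Sat (LogHeap.itPerms τ ds + H) (.bigStar (ds.map fun δ => .itPerm τ δ)) := by
  induction ds with
  | nil => trivial
  | cons δ ds ih =>
      exact ⟨LogHeap.chunk (.itPerm τ δ) 1, LogHeap.itPerms τ ds + H, by
        simp [LogHeap.itPerms, add_assoc], by simp [Sat], ih⟩

open Classical in
theorem LogHeap.itPerms_apply (τ : PhaseID.{u}) (ds : List U.Degree) (r : LogRes U) :
    LogHeap.itPerms τ ds r =
      match r with
      | .itPerm τ' δ' => (((ds : Multiset U.Degree).map fun δ => (τ, δ)).count (τ', δ') : NNRat)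
      | _ => 0 := by
  induction ds with
  | nil => cases r <;> simp [LogHeap.itPerms]
  | cons δ ds ih =>
      have : ((δ :: ds : List U.Degree) : Multiset U.Degree) = δ ::ₘ (ds : Multiset U.Degree) := rfl
      rw [LogHeap.itPerms, Pi.add_apply, ih, this]
      cases r with
      | itPerm τ' δ' =>
          simp only [LogHeap.chunk, Multiset.map_cons, Multiset.count_cons, LogRes.itPerm.injEq,
            Prod.mk.injEq]
          split_ifs <;> simp [add_comm]
      | _ => simp [LogHeap.chunk]

/-! ## Worlds -/

/-- What is known of a heap location: it is unallocated, a memory cell, an uninitialized mutex, or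
an unlocked or locked mutex with a level and an invariant. A locked mutex remembers the fraction
given up in acquiring it. -/
inductive LocState (U : Univ.{u}) : Type (u + 1) where
  | free
  | cell (v : U.Val)
  | uninit
  | unlocked (L : U.Level) (P : Assertion U)
  | locked (L : U.Level) (P : Assertion U) (f : Frac)

/-- The physical resource at a location. -/
def LocState.phys (ℓ : U.Loc) : LocState U → Option (PhysRes U)
  | .free => none
  | .cell v => some (.pointsTo ℓ v)
  | .uninit => some (.unlocked ℓ)
  | .unlocked _ _ => some (.unlocked ℓ)
  | .locked _ _ _ => some (.locked ℓ)

open Classical in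
/-- The amount of mutex chunks in circulation. -/
noncomputable def LocState.mutexAmount : LocState U → U.Level → Assertion U → NNRat
  | .unlocked L' P', L, P => if L' = L ∧ P' = P then 1 else 0
  | .locked L' P' f, L, P => if L' = L ∧ P' = P then 1 - f.toNNRat else 0
  | _, _, _ => 0

/-- The part of the state that matters for termination: the signals that exist, and the iteration
and wait permissions in circulation. -/
structure Ghost (U : Univ.{u}) : Type u where
  sig : U.ID → Option (U.Level × Bool)
  it : Multiset (PhaseID.{u} × U.Degree)
  wait : Multiset (PhaseID.{u} × U.ID × U.Degree)

/-- The state shared by all threads; `inv` maps each unlocked mutex to the resources held by its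
invariant. -/
structure World (U : Univ.{u}) : Type (u + 1) where
  loc : U.Loc → LocState U
  inv : U.Loc →₀ LogHeap U
  cell : U.GLoc → Option U.GVal
  ghost : Ghost U

/-- The resources held by lock invariants. -/
noncomputable def World.held (S : World U) : LogHeap U := S.inv.sum fun _ H => H

open Classical in
/-- The greatest logical heap compatible with a world and a thread in phase `φ` with obligations
`O`. -/
noncomputable def World.cap (S : World U) (φ : PhaseID.{u}) (O : Bag (Ob U)) : LogHeap U
  | .pointsTo ℓ v => if S.loc ℓ = .cell v then 1 else 0
  | .ghostPointsTo g v => if S.cell g = some v then 1 else 0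
  | .signal s b => if S.ghost.sig s.1 = some (s.2, b) then 1 else 0
  | .uninit ℓ => if S.loc ℓ = .uninit then 1 else 0
  | .mutex m P => (S.loc m.1).mutexAmount m.2 P
  | .locked m P f => if S.loc m.1 = .locked m.2 P f then 1 else 0
  | .phase τ => if τ = φ then 1 else 0
  | .obs O' => if O' = O then 1 else 0
  | .waitPerm τ id δ => (S.ghost.wait.count (τ, id, δ) : NNRat)
  | .itPerm τ δ => (S.ghost.it.count (τ, δ) : NNRat)

/-- Since lock invariants own nothing thread-local, any thread may take over their contents. The
finiteness conditions guarantee fresh signal IDs and ghost locations. -/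
structure World.Valid (S : World U) : Prop where
  inv_sat : ∀ ℓ L P, S.loc ℓ = .unlocked L P → Sat (S.inv ℓ) P
  inv_local : ∀ ℓ r, r.ThreadLocal → S.inv ℓ r = 0
  finite_sig : {id | S.ghost.sig id ≠ none}.Finite
  finite_cell : {g | S.cell g ≠ none}.Finite

theorem World.cap_congr_of_not_threadLocal (S : World U) {r : LogRes U} (hr : ¬ r.ThreadLocal)
    (φ φ' : PhaseID.{u}) (O O' : Bag (Ob U)) : S.cap φ O r = S.cap φ' O' r := by
  cases r <;> simp_all [LogRes.ThreadLocal, World.cap]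

theorem World.cap_congr_of_threadLocal (S S' : World U) {r : LogRes U} (hr : r.ThreadLocal)
    (φ : PhaseID.{u}) (O : Bag (Ob U)) : S.cap φ O r = S'.cap φ O r := by
  cases r <;> simp_all [LogRes.ThreadLocal, World.cap]

theorem World.Valid.held_threadLocal {S : World U} (hS : S.Valid) {r : LogRes U}
    (hr : r.ThreadLocal) : S.held r = 0 := by
  simp only [World.held, Finsupp.sum, Finset.sum_apply]
  exact Finset.sum_eq_zero fun ℓ _ => hS.inv_local ℓ r hr

/-- A resource at the location `ℓ` agrees with the state of the location. -/
theorem World.loc_of_cap_pos {S : World U} {φ : PhaseID.{u}} {O : Bag (Ob U)} {r : LogRes U}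
    {ℓ : U.Loc} (hℓ : ℓ ∈ r.hlocs) (hr : 0 < S.cap φ O r) :
    (∃ v, r = .pointsTo ℓ v ∧ S.loc ℓ = .cell v) ∨ (r = .uninit ℓ ∧ S.loc ℓ = .uninit) ∨
      (∃ L P, r = .mutex (ℓ, L) P ∧ (S.loc ℓ = .unlocked L P ∨ ∃ f, S.loc ℓ = .locked L P f)) ∨
      ∃ L P f, r = .locked (ℓ, L) P f ∧ S.loc ℓ = .locked L P f := by
  cases r with
  | pointsTo ℓ' v =>
      obtain rfl : ℓ = ℓ' := hℓ
      left
      by_contra hc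
      simp_all [World.cap]
  | uninit ℓ' =>
      obtain rfl : ℓ = ℓ' := hℓ
      right; left
      by_contra hc
      simp_all [World.cap]
  | mutex m P =>
      obtain rfl : ℓ = m.1 := hℓ
      right; right; left
      refine ⟨m.2, P, rfl, ?_⟩
      simp only [World.cap] at hr
      cases hs : S.loc m.1 <;> simp only [hs, LocState.mutexAmount, lt_self_iff_false] at hr <;>
        split_ifs at hr with hc <;> simp_all
  | locked m P f =>
      obtain rfl : ℓ = m.1 := hℓ
      right; right; right
      refine ⟨m.2, P, f, rfl, ?_⟩
      by_contra hc
      simp_all [World.cap]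
  | _ => exact absurd hℓ (by simp [LogRes.hlocs])

/-- The capacity is positive only at resources that agree with the state of their location. Each
state admits a single such resource, except that a locked mutex admits its locked chunk beside the
rest of its mutex chunk. -/
theorem LogHeap.consistent_of_le_cap {S : World U} {φ : PhaseID.{u}} {O : Bag (Ob U)}
    {H : LogHeap U} (hH : H ≤ S.cap φ O) (hn : ∀ r, r.Indivisible → ∃ n : ℕ, H r = n) :
    H.Consistent where
  phase τ := hn _ trivial
  obs O := hn _ trivial
  waitPerm τ id δ := hn _ trivial
  itPerm τ δ := hn _ trivial
  hlocs r₁ r₂ hne h₁ h₂ := by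
    by_contra! hc
    obtain ⟨ℓ, hℓ₁, hℓ₂⟩ := Set.not_disjoint_iff.1 hc.1
    apply hc.2
    rcases World.loc_of_cap_pos hℓ₁ (h₁.trans_le (hH _)) with
        ⟨v, rfl, h⟩ | ⟨rfl, h⟩ | ⟨L, P, rfl, h | ⟨f, h⟩⟩ | ⟨L, P, f, rfl, h⟩ <;>
      rcases World.loc_of_cap_pos hℓ₂ (h₂.trans_le (hH _)) with
        ⟨v', rfl, h'⟩ | ⟨rfl, h'⟩ | ⟨L', P', rfl, h' | ⟨f', h'⟩⟩ | ⟨L', P', f', rfl, h'⟩ <;>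
      rw [h] at h' <;> simp_all [LogRes.LockedPair]
  glocs r₁ r₂ hne h₁ h₂ := by
    have h₁ := h₁.trans_le (hH _)
    have h₂ := h₂.trans_le (hH _)
    by_contra hc
    obtain ⟨x, hx, hx'⟩ := Set.not_disjoint_iff.1 hc
    cases r₁ <;> try (simp [LogRes.glocs] at hx; done)
    cases r₂ <;> try (simp [LogRes.glocs] at hx'; done)
    simp only [LogRes.glocs, Set.mem_singleton_iff] at hx hx'
    subst hx
    subst hx'
    apply hne
    simp only [World.cap] at h₁ h₂
    split_ifs at h₁ h₂ with e₁ e₂ <;> simp_all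

/-! ## Ghost steps -/

inductive Label (U : Univ.{u}) : Type u where
  | silent
  | wait (id : U.ID)
  | consume

open Classical in
/-- Elementary ghost steps of a thread in phase `φ`. -/
inductive GhostStep (φ : PhaseID.{u}) :
    Ghost U → Bag (Ob U) → Label U → Ghost U → Bag (Ob U) → Prop where
  | newSignal (G : Ghost U) (O : Bag (Ob U)) (id : U.ID) (L : U.Level) (h : G.sig id = none) :
      GhostStep φ G O .silent { G with sig := Function.update G.sig id (some (L, false)) }
        (O + Bag.single (Signal.ob (id, L)))
  | setSignal (G : Ghost U) (O : Bag (Ob U)) (s : Signal U)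
      (h : G.sig s.1 = some (s.2, false)) :
      GhostStep φ G (O + Bag.single s.ob) .silent
        { G with sig := Function.update G.sig s.1 (some (s.2, true)) } O
  | itToWait (G : Ghost U) (O : Bag (Ob U)) (τ : PhaseID.{u}) (id : U.ID) {δ δ' : U.Degree}
      (hδ : δ' < δ) {I : Multiset (PhaseID.{u} × U.Degree)} (hI : G.it = (τ, δ) ::ₘ I) :
      GhostStep φ G O .silent { G with it := I, wait := (τ, id, δ') ::ₘ G.wait } O
  | wait (G : Ghost U) (O : Bag (Ob U)) {τ : PhaseID.{u}} {id : U.ID} {δ : U.Degree}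
      {L : U.Level} (hτ : τ <+: φ) (hw : (τ, id, δ) ∈ G.wait) (hs : G.sig id = some (L, false))
      (hL : LevelBelow L O) :
      GhostStep φ G O (.wait id) { G with it := (φ, δ) ::ₘ G.it } O
  | specIt (G : Ghost U) (O : Bag (Ob U)) {τ τ' : PhaseID.{u}} (δ : U.Degree) (hτ : τ' <+: τ)
      {I : Multiset (PhaseID.{u} × U.Degree)} (hI : G.it = (τ', δ) ::ₘ I) :
      GhostStep φ G O .silent { G with it := (τ, δ) ::ₘ I } O
  | specWait (G : Ghost U) (O : Bag (Ob U)) {τ τ' : PhaseID.{u}} (id : U.ID) (δ : U.Degree)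
      (hτ : τ' <+: τ) {W : Multiset (PhaseID.{u} × U.ID × U.Degree)}
      (hW : G.wait = (τ', id, δ) ::ₘ W) :
      GhostStep φ G O .silent { G with wait := (τ, id, δ) ::ₘ W } O
  | weaken (G : Ghost U) (O : Bag (Ob U)) (τ : PhaseID.{u}) {δ δ' : U.Degree} (n : ℕ)
      (hδ : δ' < δ) {I : Multiset (PhaseID.{u} × U.Degree)} (hI : G.it = (τ, δ) ::ₘ I) :
      GhostStep φ G O .silent { G with it := Multiset.replicate n (τ, δ') + I } O
  | consume (G : Ghost U) (O : Bag (Ob U)) {τ : PhaseID.{u}} {δ : U.Degree} (hτ : τ <+: φ)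
      {I : Multiset (PhaseID.{u} × U.Degree)} (hI : G.it = (τ, δ) ::ₘ I) :
      GhostStep φ G O .consume { G with it := I } O
  | acquire (G : Ghost U) (O : Bag (Ob U)) (m : Mutex U) :
      GhostStep φ G O .silent G (O + Bag.single m.ob)
  | release (G : Ghost U) (O : Bag (Ob U)) (m : Mutex U) :
      GhostStep φ G (O + Bag.single m.ob) .silent G O

/-- Finite sequences of ghost steps, with their labels. -/
inductive GhostSteps (φ : PhaseID.{u}) :
    Ghost U → Bag (Ob U) → List (Label U) → Ghost U → Bag (Ob U) → Prop where
  | nil (G : Ghost U) (O : Bag (Ob U)) : GhostSteps φ G O [] G O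
  | cons {G₁ G₂ G₃ : Ghost U} {O₁ O₂ O₃ : Bag (Ob U)} {a : Label U} {l : List (Label U)}
      (h : GhostStep φ G₁ O₁ a G₂ O₂) (hs : GhostSteps φ G₂ O₂ l G₃ O₃) :
      GhostSteps φ G₁ O₁ (a :: l) G₃ O₃

theorem GhostSteps.append {φ : PhaseID.{u}} {G₁ G₂ G₃ : Ghost U} {O₁ O₂ O₃ : Bag (Ob U)}
    {l l' : List (Label U)} (h : GhostSteps φ G₁ O₁ l G₂ O₂) (h' : GhostSteps φ G₂ O₂ l' G₃ O₃) :
    GhostSteps φ G₁ O₁ (l ++ l') G₃ O₃ := by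
  induction h with
  | nil => exact h'
  | cons hs _ ih => exact .cons hs (ih h')

/-! ## Soundness of view shifts -/

/-- Ghost steps that consume no iteration permission and leave the physical heap alone. -/
def World.Shifts (φ : PhaseID.{u}) (S : World U) (O : Bag (Ob U)) (S' : World U)
    (O' : Bag (Ob U)) : Prop :=
  (∃ l, GhostSteps φ S.ghost O l S'.ghost O') ∧ ∀ ℓ, (S'.loc ℓ).phys ℓ = (S.loc ℓ).phys ℓ

theorem World.Shifts.refl (φ : PhaseID.{u}) (S : World U) (O : Bag (Ob U)) :
    World.Shifts φ S O S O :=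
  ⟨⟨[], .nil _ _⟩, fun _ => rfl⟩

theorem World.Shifts.trans {φ : PhaseID.{u}} {S₁ S₂ S₃ : World U} {O₁ O₂ O₃ : Bag (Ob U)}
    (h : World.Shifts φ S₁ O₁ S₂ O₂) (h' : World.Shifts φ S₂ O₂ S₃ O₃) :
    World.Shifts φ S₁ O₁ S₃ O₃ :=
  ⟨⟨_, h.1.choose_spec.append h'.1.choose_spec⟩, fun ℓ => (h'.2 ℓ).trans (h.2 ℓ)⟩

theorem World.Shifts.of_ghostStep {φ : PhaseID.{u}} {S : World U} {G : Ghost U}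
    {O O' : Bag (Ob U)} {a : Label U} (h : GhostStep φ S.ghost O a G O') :
    World.Shifts φ S O { S with ghost := G } O' :=
  ⟨⟨[a], .cons h (.nil _ _)⟩, fun _ => rfl⟩

-- Trading resources below the capacity.

theorem World.Valid.set_ghost {S : World U} (hS : S.Valid) {G : Ghost U}
    (hG : {id | G.sig id ≠ none}.Finite) : ({ S with ghost := G } : World U).Valid :=
  ⟨hS.inv_sat, hS.inv_local, hG, hS.finite_cell⟩

/-- The pattern of all later updates: a thread gives up `old` for `new` while the frame `F` and the
held resources `K` stay. Both sides of the comparison of capacities carry a summand, which avoids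
truncated subtraction. -/
theorem LogHeap.exchange {H₀ old new F K C C' : LogHeap U} (h : H₀ + old + F + K ≤ C)
    (hC : C + new ≤ C' + old) : H₀ + new + F + K ≤ C' := by
  refine le_of_add_le_add_right (a := old) ?_
  calc H₀ + new + F + K + old = H₀ + old + F + K + new := by abel
    _ ≤ C + new := by gcongr
    _ ≤ C' + old := hC

theorem LogHeap.le_of_sum_le {H F K C : LogHeap U} (h : H + F + K ≤ C) (r : LogRes U) :
    H r ≤ C r := by
  refine le_trans ?_ (h r)
  simp only [Pi.add_apply, add_assoc]
  exact le_self_add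

theorem World.eq_obs_of_one_le {S : World U} {φ : PhaseID.{u}} {O O' : Bag (Ob U)}
    (h : 1 ≤ S.cap φ O (.obs O')) : O' = O := by
  by_contra hc
  simp [World.cap, hc] at h

theorem World.eq_phase_of_one_le {S : World U} {φ τ : PhaseID.{u}} {O : Bag (Ob U)}
    (h : 1 ≤ S.cap φ O (.phase τ)) : τ = φ := by
  by_contra hc
  simp [World.cap, hc] at h

theorem World.sig_of_pos {S : World U} {φ : PhaseID.{u}} {O : Bag (Ob U)} {s : Signal U}
    {b : Bool} (h : 0 < S.cap φ O (.signal s b)) : S.ghost.sig s.1 = some (s.2, b) := by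
  by_contra hc
  simp [World.cap, hc] at h

theorem World.exists_it_of_one_le {S : World U} {φ τ : PhaseID.{u}} {O : Bag (Ob U)}
    {δ : U.Degree} (h : 1 ≤ S.cap φ O (.itPerm τ δ)) : ∃ I, S.ghost.it = (τ, δ) ::ₘ I := by
  classical
  apply Multiset.exists_cons_of_mem
  rw [← Multiset.one_le_count_iff_mem]
  simp only [World.cap, Nat.one_le_cast] at h
  convert h

theorem World.exists_wait_of_one_le {S : World U} {φ τ : PhaseID.{u}} {O : Bag (Ob U)}
    {id : U.ID} {δ : U.Degree} (h : 1 ≤ S.cap φ O (.waitPerm τ id δ)) :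
    ∃ W, S.ghost.wait = (τ, id, δ) ::ₘ W := by
  classical
  apply Multiset.exists_cons_of_mem
  rw [← Multiset.one_le_count_iff_mem]
  simp only [World.cap, Nat.one_le_cast] at h
  convert h

theorem finite_update_ne_none {α : Type*} {β : Type*} [DecidableEq α] {f : α → Option β}
    (hf : {x | f x ≠ none}.Finite) (a : α) (b : Option β) :
    {x | Function.update f a b x ≠ none}.Finite := by
  refine (hf.insert a).subset fun x hx => ?_
  by_cases h : x = a
  · exact Or.inl h
  · exact Or.inr (by simpa [Function.update_of_ne h] using hx)

-- Freshness of `id` means that the old capacity has no room for any signal chunk with this ID, so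
-- the new chunk fits; the obligations chunks trade places.
open Classical in
theorem World.cap_newSignal (S : World U) (φ : PhaseID.{u}) (O O' : Bag (Ob U)) {id : U.ID}
    (L : U.Level) (h : S.ghost.sig id = none) :
    S.cap φ O + (LogHeap.chunk (.obs O') 1 + LogHeap.chunk (.signal (id, L) false) 1) ≤
      World.cap { S with ghost :=
        { S.ghost with sig := Function.update S.ghost.sig id (some (L, false)) } } φ O' +
        LogHeap.chunk (.obs O) 1 := by
  intro r
  cases r with
  | signal s b =>
      obtain ⟨id', L'⟩ := s
      by_cases hid : id' = id
      · subst hid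
        by_cases hL : L' = L <;> cases b <;> simp [World.cap, LogHeap.chunk, h, hL, eq_comm]
      · simp [World.cap, LogHeap.chunk, hid]
  | obs X => simp [World.cap, LogHeap.chunk, add_comm]
  | _ => simp [World.cap, LogHeap.chunk]

open Classical in
theorem World.cap_setSignal (S : World U) (φ : PhaseID.{u}) (O O' : Bag (Ob U)) {s : Signal U}
    (h : S.ghost.sig s.1 = some (s.2, false)) :
    S.cap φ O + (LogHeap.chunk (.obs O') 1 + LogHeap.chunk (.signal s true) 1) ≤
      World.cap { S with ghost :=
        { S.ghost with sig := Function.update S.ghost.sig s.1 (some (s.2, true)) } } φ O' +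
        (LogHeap.chunk (.obs O) 1 + LogHeap.chunk (.signal s false) 1) := by
  intro r
  cases r with
  | signal t b =>
      obtain ⟨id, L⟩ := s
      obtain ⟨id', L'⟩ := t
      by_cases hid : id' = id
      · subst hid
        simp only at h
        by_cases hL : L' = L
        · subst hL
          cases b <;> simp [World.cap, LogHeap.chunk, h]
        · cases b <;> simp [World.cap, LogHeap.chunk, h, hL, Ne.symm hL]
      · simp [World.cap, LogHeap.chunk, hid]
  | obs X => simp [World.cap, LogHeap.chunk, add_comm]
  | _ => simp [World.cap, LogHeap.chunk]

/-- Exchanging permissions in circulation. -/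
theorem World.cap_permissions (S : World U) (φ : PhaseID.{u}) (O : Bag (Ob U))
    {it : Multiset (PhaseID.{u} × U.Degree)} {wait : Multiset (PhaseID.{u} × U.ID × U.Degree)}
    {old new : LogHeap U}
    (hit : ∀ τ δ, S.cap φ O (.itPerm τ δ) + new (.itPerm τ δ) ≤
      World.cap { S with ghost := ⟨S.ghost.sig, it, wait⟩ } φ O (.itPerm τ δ) +
        old (.itPerm τ δ))
    (hwait : ∀ τ id δ, S.cap φ O (.waitPerm τ id δ) + new (.waitPerm τ id δ) ≤
      World.cap { S with ghost := ⟨S.ghost.sig, it, wait⟩ } φ O (.waitPerm τ id δ) +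
        old (.waitPerm τ id δ))
    (hnew : ∀ r, (∀ τ δ, r ≠ .itPerm τ δ) → (∀ τ id δ, r ≠ .waitPerm τ id δ) → new r = 0) :
    S.cap φ O + new ≤ World.cap { S with ghost := ⟨S.ghost.sig, it, wait⟩ } φ O + old := by
  intro r
  cases r with
  | itPerm τ δ => exact hit τ δ
  | waitPerm τ id δ => exact hwait τ id δ
  | _ => simp [hnew, World.cap]

theorem World.exists_fresh_id {S : World U} (hS : S.Valid) : ∃ id, S.ghost.sig id = none := by
  obtain ⟨id, h⟩ := hS.finite_sig.infinite_compl.nonempty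
  exact ⟨id, by simpa using h⟩

theorem World.exists_fresh_cell {S : World U} (hS : S.Valid) : ∃ g, S.cell g = none := by
  obtain ⟨g, h⟩ := hS.finite_cell.infinite_compl.nonempty
  exact ⟨g, by simpa using h⟩

-- The condition on `old` covers creation and mutation at once: it is vacuous for a fresh cell, and
-- for an existing one it asks for the full chunk with the current value.
open Classical in
theorem World.cap_setCell (S : World U) (φ : PhaseID.{u}) (O : Bag (Ob U)) (g : U.GLoc)
    (v' : U.GVal) {old : LogHeap U}
    (hold : ∀ v, S.cell g = some v → 1 ≤ old (.ghostPointsTo g v)) :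
    S.cap φ O + LogHeap.chunk (.ghostPointsTo g v') 1 ≤
      World.cap { S with cell := Function.update S.cell g (some v') } φ O + old := by
  intro r
  cases r with
  | ghostPointsTo g' w =>
      by_cases hg : g' = g
      · subst hg
        by_cases hw : w = v'
        · subst hw
          by_cases hc : S.cell g' = some w
          · simpa [World.cap, LogHeap.chunk, hc] using hold w hc
          · simp [World.cap, LogHeap.chunk, hc]
        · by_cases hc : S.cell g' = some w
          · simpa [World.cap, LogHeap.chunk, hc, hw, Ne.symm hw] using hold w hc
          · simp [World.cap, LogHeap.chunk, hc, hw, Ne.symm hw]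
      · simp [World.cap, LogHeap.chunk, hg]
  | _ => simp [World.cap, LogHeap.chunk]

open Classical in
/-- A resource at the location `ℓ` takes the place of all others there. -/
theorem World.cap_setLoc (S S' : World U) (φ : PhaseID.{u}) (O : Bag (Ob U)) (ℓ : U.Loc)
    {old new : LogHeap U} (hloc : ∀ ℓ' ≠ ℓ, S'.loc ℓ' = S.loc ℓ') (hg : S'.ghost = S.ghost)
    (hc : S'.cell = S.cell) (hnew : ∀ r, ℓ ∉ r.hlocs → new r = 0)
    (h : ∀ r, ℓ ∈ r.hlocs → S.cap φ O r + new r ≤ S'.cap φ O r + old r) :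
    S.cap φ O + new ≤ S'.cap φ O + old := by
  intro r
  by_cases hr : ℓ ∈ r.hlocs
  · exact h r hr
  · have : S.cap φ O r = S'.cap φ O r := by
      cases r with
      | pointsTo | uninit | mutex | locked =>
          simp only [LogRes.hlocs, Set.mem_singleton_iff] at hr
          simp [World.cap, hloc _ (Ne.symm hr)]
      | _ => simp [World.cap, hg, hc]
    simp only [Pi.add_apply, this, hnew r hr, add_zero]
    exact le_self_add

/-- Only an inequality, since the heap previously stored at `ℓ` is overwritten and validity does not
force it to be zero. -/
theorem World.held_update_le (S : World U) (ℓ : U.Loc) (K : LogHeap U) (loc : U.Loc → LocState U) :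
    World.held { S with loc := loc, inv := S.inv.update ℓ K } ≤ S.held + K := by
  classical
  have h1 : (S.inv.update ℓ K).sum (fun _ H => H) = K + (S.inv.erase ℓ).sum (fun _ H => H) := by
    rw [Finsupp.update_eq_single_add_erase, Finsupp.sum_add_index' (by simp) (by simp),
      Finsupp.sum_single_index rfl]
  have h2 : S.inv.sum (fun _ H => H) = S.inv ℓ + (S.inv.erase ℓ).sum (fun _ H => H) := by
    conv_lhs => rw [← Finsupp.single_add_erase ℓ S.inv]
    rw [Finsupp.sum_add_index' (by simp) (by simp), Finsupp.sum_single_index rfl]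
  simp only [World.held]
  rw [h1, h2, add_comm K]
  gcongr
  exact le_add_self

/-- Taking the resources of a lock invariant out of the world. -/
theorem World.held_update_zero (S : World U) (ℓ : U.Loc) (loc : U.Loc → LocState U) :
    World.held { S with loc := loc, inv := S.inv.update ℓ 0 } + S.inv ℓ = S.held := by
  classical
  simp only [World.held]
  conv_rhs => rw [← Finsupp.single_add_erase ℓ S.inv]
  rw [Finsupp.sum_add_index' (by simp) (by simp), Finsupp.sum_single_index rfl,
    Finsupp.update_eq_single_add_erase, Finsupp.single_zero, zero_add, add_comm]

open Classical in
theorem World.Valid.setLoc {S : World U} (hS : S.Valid) (ℓ : U.Loc) (X : LocState U)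
    (hX : ∀ L P, X ≠ .unlocked L P) :
    World.Valid { S with loc := Function.update S.loc ℓ X } where
  inv_sat ℓ' L P h := by
    by_cases hℓ : ℓ' = ℓ
    · subst hℓ
      exact absurd (by simpa using h) (hX L P)
    · exact hS.inv_sat ℓ' L P (by simpa [hℓ] using h)
  inv_local := hS.inv_local
  finite_sig := hS.finite_sig
  finite_cell := hS.finite_cell

open Classical in
theorem World.Valid.setLocInv {S : World U} (hS : S.Valid) (ℓ : U.Loc) (X : LocState U)
    (K : LogHeap U) (hX : ∀ L P, X = .unlocked L P → Sat K P)
    (hK : ∀ r, r.ThreadLocal → K r = 0) :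
    World.Valid { S with loc := Function.update S.loc ℓ X, inv := S.inv.update ℓ K } where
  inv_sat ℓ' L P h := by
    by_cases hℓ : ℓ' = ℓ
    · subst hℓ
      simpa using hX L P (by simpa using h)
    · simpa [hℓ] using hS.inv_sat ℓ' L P (by simpa [hℓ] using h)
  inv_local ℓ' r hr := by
    by_cases hℓ : ℓ' = ℓ
    · subst hℓ
      simpa using hK r hr
    · simpa [hℓ] using hS.inv_local ℓ' r hr
  finite_sig := hS.finite_sig
  finite_cell := hS.finite_cell

theorem World.eq_loc_of_uninit {S : World U} {φ : PhaseID.{u}} {O : Bag (Ob U)} {ℓ : U.Loc}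
    (h : 0 < S.cap φ O (.uninit ℓ)) : S.loc ℓ = .uninit := by
  by_contra hc
  simp [World.cap, hc] at h

/-- The meaning of a view shift: in every frame it can be carried out by ghost steps. -/
def ShiftSound (φ : PhaseID.{u}) (A B : Assertion U) : Prop :=
  ∀ {S : World U} {O : Bag (Ob U)} {H F : LogHeap U}, S.Valid → H + F + S.held ≤ S.cap φ O →
    Sat H A → ∃ (S' : World U) (O' : Bag (Ob U)) (H' : LogHeap U), S'.Valid ∧
      H' + F + S'.held ≤ S'.cap φ O' ∧ Sat H' B ∧ World.Shifts φ S O S' O'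

theorem exists_shift_of_ghostStep {φ : PhaseID.{u}} {S : World U} {O O' : Bag (Ob U)}
    {H₀ old new F : LogHeap U} {B : Assertion U} {a : Label U} {G : Ghost U}
    (h : GhostStep φ S.ghost O a G O') (hS : S.Valid) (hG : {id | G.sig id ≠ none}.Finite)
    (hC : H₀ + old + F + S.held ≤ S.cap φ O)
    (hcap : S.cap φ O + new ≤ World.cap { S with ghost := G } φ O' + old)
    (hB : Sat (H₀ + new) B) :
    ∃ (S' : World U) (O' : Bag (Ob U)) (H' : LogHeap U), S'.Valid ∧
      H' + F + S'.held ≤ S'.cap φ O' ∧ Sat H' B ∧ World.Shifts φ S O S' O' :=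
  ⟨{ S with ghost := G }, O', H₀ + new, hS.set_ghost hG, LogHeap.exchange hC hcap, hB,
    .of_ghostStep h⟩

/-- The heap satisfying `P` moves from the thread into the world, stripped of its thread-local
fractions. Uninitialized and unlocked mutexes look the same physically, and no ghost step is needed.
-/
theorem ShiftSound.mutInit (φ : PhaseID.{u}) (m : Mutex U) (P : Assertion U) :
    ShiftSound φ (.uninit .one m.1 ∗∗ .and P .noPhaseObs) (.mutex .one m P) := by
  classical
  rintro S O _ F hS hC ⟨H₁, H₂, rfl, h₁, hP, hno⟩
  have h₁ : 1 ≤ H₁ (.uninit m.1) := h₁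
  have hu : S.loc m.1 = .uninit := by
    refine World.eq_loc_of_uninit (φ := φ) (O := O) (lt_of_lt_of_le zero_lt_one ?_)
    refine h₁.trans (le_trans ?_ (LogHeap.le_of_sum_le hC _))
    exact le_self_add
  obtain ⟨H₀, rfl⟩ := LogHeap.exists_eq_add_chunk h₁
  refine ⟨{ S with
      loc := Function.update S.loc m.1 (.unlocked m.2 P)
      inv := S.inv.update m.1 H₂.shareable }, O, H₀ + LogHeap.chunk (.mutex m P) 1,
    hS.setLocInv _ _ _ ?_ fun r hr => LogHeap.shareable_apply_of hr, ?_, ?_, ⟨[], .nil _ _⟩, ?_⟩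
  · rintro L Q hQ
    simp only [LocState.unlocked.injEq] at hQ
    obtain ⟨rfl, rfl⟩ := hQ
    exact hP.of_sim (LogHeap.sim_shareable hno)
  -- From here on `H₂` counts as held by the world; then the uninitialized chunk is traded for the
  -- mutex chunk.
  · have hC' : H₀ + LogHeap.chunk (.uninit m.1) 1 + F + (S.held + H₂) ≤ S.cap φ O :=
      le_trans (le_of_eq (by abel)) hC
    refine le_trans ?_ (LogHeap.exchange hC' (World.cap_setLoc S _ φ O m.1
      (new := LogHeap.chunk (.mutex m P) 1) ?_ rfl rfl ?_ ?_))
    · gcongr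
      exact (World.held_update_le S m.1 _ _).trans (by gcongr; exact H₂.shareable_le)
    · intro ℓ' hℓ'
      simp [hℓ']
    · intro r hr
      exact LogHeap.chunk_of_ne (by rintro rfl; exact hr rfl) _
    · intro r hr
      by_cases hpos : 0 < S.cap φ O r
      · obtain ⟨v, rfl, h⟩ | ⟨rfl, h⟩ | ⟨L, Q, rfl, h | ⟨f, h⟩⟩ | ⟨L, Q, f, rfl, h⟩ :=
          World.loc_of_cap_pos hr hpos <;> rw [hu] at h <;> simp_all
        simp [World.cap, LogHeap.chunk, hu]
      · rw [not_lt, nonpos_iff_eq_zero] at hpos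
        rw [hpos, zero_add]
        by_cases hrm : r = .mutex m P
        · subst hrm
          simp [World.cap, LocState.mutexAmount]
        · simp [LogHeap.chunk_of_ne hrm]
  · exact le_add_self.trans_eq' (by simp)
  · intro ℓ
    by_cases hℓ : ℓ = m.1
    · subst hℓ
      simp [hu, LocState.phys]
    · simp [hℓ]

/-- The implication is available for consistent heaps only. The rounded heap is integral and still
below the capacity, hence consistent, and the conclusion is carried back along `Sim`. -/
theorem ShiftSound.semImp (φ : PhaseID.{u}) {A B : Assertion U}
    (hAB : ∀ H : LogHeap U, H.Consistent → Sat H A → Sat H B) :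
    ShiftSound φ A B := by
  intro S O H F hS hC hA
  refine ⟨S, O, H, hS, hC, ?_, .refl _ _ _⟩
  refine (hAB H.round ?_ (hA.of_sim H.sim_round)).of_sim H.sim_round.symm
  refine LogHeap.consistent_of_le_cap (S := S) (φ := φ) (O := O)
    (H.round_le.trans (LogHeap.le_of_sum_le hC)) fun r hr => ⟨⌊H r⌋₊, ?_⟩
  simp [LogHeap.round, hr]

open Classical in
theorem ShiftSound.newSignal (φ : PhaseID.{u}) (O₁ : Bag (Ob U)) (L : U.Level) :
    ShiftSound φ (.obs O₁)
      (.bigOr fun id : U.ID =>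
        .obs (O₁ + Bag.single (Signal.ob (id, L))) ∗∗ .signal .one (id, L) false) := by
  intro S O H F hS hC hA
  obtain rfl := World.eq_obs_of_one_le (le_trans hA (LogHeap.le_of_sum_le hC _))
  obtain ⟨id, hid⟩ := World.exists_fresh_id hS
  obtain ⟨H₀, rfl⟩ := LogHeap.exists_eq_add_chunk (show 1 ≤ H _ from hA)
  refine exists_shift_of_ghostStep (.newSignal _ _ _ L hid) hS
    (finite_update_ne_none hS.finite_sig _ _) hC (S.cap_newSignal φ O₁ _ L hid) ?_
  rw [← add_assoc]
  exact ⟨id, _, _, rfl, by simp [Sat], by simp [Sat]⟩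

open Classical in
theorem ShiftSound.setSignal (φ : PhaseID.{u}) (O₁ : Bag (Ob U)) (s : Signal U) :
    ShiftSound φ (.obs (O₁ + Bag.single s.ob) ∗∗ .signal .one s false)
      (.obs O₁ ∗∗ .signal .one s true) := by
  rintro S O _ F hS hC ⟨H₁, H₂, rfl, h₁, h₂⟩
  have hle := LogHeap.le_of_sum_le hC
  obtain rfl := World.eq_obs_of_one_le (le_trans h₁ (le_self_add.trans (hle _)))
  have hs := World.sig_of_pos (lt_of_lt_of_le zero_lt_one
    ((le_trans (show 1 ≤ H₂ _ from h₂) le_add_self).trans (hle _)))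
  obtain ⟨K₁, rfl⟩ := LogHeap.exists_eq_add_chunk (show 1 ≤ H₁ _ from h₁)
  obtain ⟨K₂, rfl⟩ := LogHeap.exists_eq_add_chunk (show 1 ≤ H₂ _ from h₂)
  rw [add_add_add_comm] at hC
  refine exists_shift_of_ghostStep (.setSignal _ _ _ hs) hS
    (finite_update_ne_none hS.finite_sig _ _) hC (S.cap_setSignal φ _ O₁ hs) ?_
  rw [add_add_add_comm]
  exact ⟨_, _, rfl, by simp [Sat], by simp [Sat]⟩

open Classical in
theorem ShiftSound.waitPerm (φ : PhaseID.{u}) (τ : PhaseID.{u}) (id : U.ID) {δ δ' : U.Degree} (hδ : δ' < δ) :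
    ShiftSound φ (.itPerm τ δ) (.waitPerm τ id δ') := by
  intro S O H F hS hC hA
  obtain ⟨I, hI⟩ := World.exists_it_of_one_le (le_trans hA (LogHeap.le_of_sum_le hC _))
  obtain ⟨H₀, rfl⟩ := LogHeap.exists_eq_add_chunk (show 1 ≤ H _ from hA)
  refine exists_shift_of_ghostStep (.itToWait _ _ τ id hδ hI)
    hS hS.finite_sig hC
    (S.cap_permissions φ O (new := LogHeap.chunk (.waitPerm τ id δ') 1) ?_ ?_ ?_) (by simp [Sat])
  · intro τ' δ'
    simp [World.cap, LogHeap.chunk, hI, Multiset.count_cons]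
  · intro τ' id' δ'
    simp [World.cap, LogHeap.chunk, Multiset.count_cons]
  · intro r _ h2
    exact LogHeap.chunk_of_ne (h2 _ _ _) _

open Classical in
theorem ShiftSound.wait (φ : PhaseID.{u}) {τ τ' : PhaseID.{u}} {O₁ : Bag (Ob U)} {s : Signal U} (f : Frac) (δ : U.Degree)
    (hτ : τ' <+: τ) (hs : LevelBelow s.2 O₁) :
    ShiftSound φ (.phase τ ∗∗ .obs O₁ ∗∗ .waitPerm τ' s.1 δ ∗∗ .signal f s false)
      (.phase τ ∗∗ .obs O₁ ∗∗ .waitPerm τ' s.1 δ ∗∗ .signal f s false ∗∗ .itPerm τ δ) := by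
  rintro S O _ F hS hC ⟨H₁, _, rfl, h₁, H₂, _, rfl, h₂, H₃, H₄, rfl, h₃, h₄⟩
  have hle := LogHeap.le_of_sum_le hC
  simp only [Pi.add_apply] at hle
  obtain rfl := World.eq_phase_of_one_le (le_trans h₁ (le_self_add.trans (hle _)))
  obtain rfl := World.eq_obs_of_one_le
    (le_trans h₂ ((le_self_add.trans le_add_self).trans (hle _)))
  obtain ⟨W, hW⟩ := World.exists_wait_of_one_le
    (le_trans h₃ (((le_self_add.trans le_add_self).trans le_add_self).trans (hle _)))
  have hsig := World.sig_of_pos (lt_of_lt_of_le f.toNNRat_pos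
    (le_trans h₄ (((le_add_self.trans le_add_self).trans le_add_self).trans (hle _))))
  -- Waiting uses up nothing, so the new permission is traded for the empty heap.
  have hC' : H₁ + (H₂ + (H₃ + H₄)) + 0 + F + S.held ≤ S.cap τ O₁ := by simpa using hC
  refine exists_shift_of_ghostStep (.wait _ _ hτ (hW ▸ Multiset.mem_cons_self _ _) hsig hs)
    hS hS.finite_sig hC'
    (S.cap_permissions τ O₁ (new := LogHeap.chunk (.itPerm τ δ) 1) ?_ ?_ ?_) ?_
  · intro τ' δ'
    simp [World.cap, LogHeap.chunk, Multiset.count_cons]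
  · intro τ' id' δ'
    simp [World.cap, LogHeap.chunk]
  · intro r h1 _
    exact LogHeap.chunk_of_ne (h1 _ _) _
  · exact ⟨H₁, H₂ + (H₃ + (H₄ + LogHeap.chunk (.itPerm τ δ) 1)), by simp only [add_assoc], h₁, H₂, _,
      rfl, h₂, H₃, _, rfl, h₃, H₄, _, rfl, h₄, by simp [Sat]⟩

open Classical in
theorem ShiftSound.specItPerm (φ : PhaseID.{u}) {τ τ' : PhaseID.{u}} (δ : U.Degree) (hτ : τ' <+: τ) :
    ShiftSound φ (.itPerm τ' δ) (.itPerm τ δ) := by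
  intro S O H F hS hC hA
  obtain ⟨I, hI⟩ := World.exists_it_of_one_le (le_trans hA (LogHeap.le_of_sum_le hC _))
  obtain ⟨H₀, rfl⟩ := LogHeap.exists_eq_add_chunk (show 1 ≤ H _ from hA)
  refine exists_shift_of_ghostStep (.specIt _ _ _ hτ hI)
    hS hS.finite_sig hC
    (S.cap_permissions φ O (new := LogHeap.chunk (.itPerm τ δ) 1) ?_ ?_ ?_) (by simp [Sat])
  · intro τ' δ'
    simp only [World.cap, LogHeap.chunk, hI, Multiset.count_cons, LogRes.itPerm.injEq,
      Prod.mk.injEq, Nat.cast_add, Nat.cast_ite, Nat.cast_one, Nat.cast_zero]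
    rw [add_right_comm]
  · intro τ' id' δ'
    simp [World.cap, LogHeap.chunk]
  · intro r h1 _
    exact LogHeap.chunk_of_ne (h1 _ _) _

open Classical in
theorem ShiftSound.specWaitPerm (φ : PhaseID.{u}) {τ τ' : PhaseID.{u}} (id : U.ID) (δ : U.Degree) (hτ : τ' <+: τ) :
    ShiftSound φ (.waitPerm τ' id δ) (.waitPerm τ id δ) := by
  intro S O H F hS hC hA
  obtain ⟨W, hW⟩ := World.exists_wait_of_one_le (le_trans hA (LogHeap.le_of_sum_le hC _))
  obtain ⟨H₀, rfl⟩ := LogHeap.exists_eq_add_chunk (show 1 ≤ H _ from hA)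
  refine exists_shift_of_ghostStep (.specWait _ _ _ _ hτ hW)
    hS hS.finite_sig hC
    (S.cap_permissions φ O (new := LogHeap.chunk (.waitPerm τ id δ) 1) ?_ ?_ ?_) (by simp [Sat])
  · intro τ' δ'
    simp [World.cap, LogHeap.chunk]
  · intro τ' id' δ'
    simp only [World.cap, LogHeap.chunk, hW, Multiset.count_cons, LogRes.waitPerm.injEq,
      Prod.mk.injEq, Nat.cast_add, Nat.cast_ite, Nat.cast_one, Nat.cast_zero]
    rw [add_right_comm]
  · intro r _ h2
    exact LogHeap.chunk_of_ne (h2 _ _ _) _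

open Classical in
theorem ShiftSound.weakItPerm (φ : PhaseID.{u}) (τ : PhaseID.{u}) {δ δ' : U.Degree} (n : ℕ) (hδ : δ' < δ) :
    ShiftSound φ (.itPerm τ δ) (.bigStar (List.replicate n (.itPerm τ δ'))) := by
  intro S O H F hS hC hA
  obtain ⟨I, hI⟩ := World.exists_it_of_one_le (le_trans hA (LogHeap.le_of_sum_le hC _))
  obtain ⟨H₀, rfl⟩ := LogHeap.exists_eq_add_chunk (show 1 ≤ H _ from hA)
  refine exists_shift_of_ghostStep (.weaken _ _ _ n hδ hI)
    hS hS.finite_sig hC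
    (S.cap_permissions φ O (new := LogHeap.itPerms τ (List.replicate n δ')) ?_ ?_ ?_) ?_
  · intro τ₁ δ₁
    rw [LogHeap.itPerms_apply]
    simp only [World.cap, LogHeap.chunk, hI, Multiset.count_cons, LogRes.itPerm.injEq,
      Prod.mk.injEq, Multiset.count_add, Multiset.coe_replicate, Multiset.map_replicate,
      Nat.cast_add, Nat.cast_ite, Nat.cast_one, Nat.cast_zero]
    exact le_of_eq (by ring)
  · intro τ' id' δ'
    simp [World.cap, LogHeap.itPerms_apply]
  · intro r h1 _
    rw [LogHeap.itPerms_apply]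
    cases r <;> simp_all
  · have := sat_bigStar_itPerms τ (List.replicate n δ') H₀
    rwa [List.map_replicate, add_comm] at this

open Classical in
theorem ShiftSound.newGhostCell (φ : PhaseID.{u}) (v : U.GVal) :
    ShiftSound φ .tt (.bigOr fun ℓ : U.GLoc => .ghostPointsTo .one ℓ v) := by
  intro S O H F hS hC hA
  obtain ⟨g, hg⟩ := World.exists_fresh_cell hS
  have hC' : H + 0 + F + S.held ≤ S.cap φ O := by simpa using hC
  refine ⟨{ S with cell := Function.update S.cell g (some v) }, O,
      H + LogHeap.chunk (.ghostPointsTo g v) 1,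
    ⟨hS.inv_sat, hS.inv_local, hS.finite_sig, finite_update_ne_none hS.finite_cell g (some v)⟩,
    LogHeap.exchange hC' (S.cap_setCell φ O g v ?_), ⟨g, by simp [Sat]⟩,
    ⟨⟨[], .nil _ _⟩, fun _ => rfl⟩⟩
  intro w hw
  simp [hg] at hw

open Classical in
theorem ShiftSound.mutateGhostCell (φ : PhaseID.{u}) (g : U.GLoc) (v v' : U.GVal) :
    ShiftSound φ (.ghostPointsTo .one g v) (.ghostPointsTo .one g v') := by
  intro S O H F hS hC hA
  have hle := le_trans hA (LogHeap.le_of_sum_le hC _)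
  have hg : S.cell g = some v := by
    by_contra hc
    simp [World.cap, hc] at hle
  obtain ⟨H₀, rfl⟩ := LogHeap.exists_eq_add_chunk (show 1 ≤ H _ from hA)
  refine ⟨{ S with cell := Function.update S.cell g (some v') }, O,
      H₀ + LogHeap.chunk (.ghostPointsTo g v') 1,
    ⟨hS.inv_sat, hS.inv_local, hS.finite_sig, finite_update_ne_none hS.finite_cell g (some v')⟩,
    LogHeap.exchange hC (S.cap_setCell φ O g v' ?_), by simp [Sat],
    ⟨⟨[], .nil _ _⟩, fun _ => rfl⟩⟩
  intro w hw
  obtain rfl : v = w := by simpa [hg] using hw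
  simp

theorem ViewShift.sound (φ : PhaseID.{u}) {A B : Assertion U} (h : ViewShift A B) :
    ShiftSound φ A B := by
  induction h with
  | semImp hAB => exact ShiftSound.semImp φ hAB
  | trans _ _ ih₁ ih₂ =>
      intro S O H F hS hC hA
      obtain ⟨S₁, O₁, H₁, hS₁, hC₁, hA₁, hs₁⟩ := ih₁ hS hC hA
      obtain ⟨S₂, O₂, H₂, hS₂, hC₂, hA₂, hs₂⟩ := ih₂ hS₁ hC₁ hA₁
      exact ⟨S₂, O₂, H₂, hS₂, hC₂, hA₂, hs₁.trans hs₂⟩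
  | or _ _ ih₁ ih₂ =>
      intro S O H F hS hC hA
      exact hA.elim (ih₁ hS hC) (ih₂ hS hC)
  | frame R _ ih =>
      rintro S O _ F hS hC ⟨H₁, H₂, rfl, h₁, h₂⟩
      -- The framed heap joins the universally quantified frame.
      obtain ⟨S', O', H', hS', hC', hA', hs'⟩ :=
        ih hS (F := H₂ + F) (le_trans (le_of_eq (by abel)) hC) h₁
      exact ⟨S', O', H' + H₂, hS', le_trans (le_of_eq (by abel)) hC', ⟨H', H₂, rfl, hA', h₂⟩, hs'⟩
  | newSignal O L => exact ShiftSound.newSignal φ O L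
  | setSignal O s => exact ShiftSound.setSignal φ O s
  | waitPerm τ id hδ => exact ShiftSound.waitPerm φ τ id hδ
  | wait f δ hτ hs => exact ShiftSound.wait φ f δ hτ hs
  | specItPerm δ hτ => exact ShiftSound.specItPerm φ δ hτ
  | specWaitPerm id δ hτ => exact ShiftSound.specWaitPerm φ id δ hτ
  | weakItPerm τ n hδ => exact ShiftSound.weakItPerm φ τ n hδ
  | mutInit m P => exact ShiftSound.mutInit φ m P
  | newGhostCell v => exact ShiftSound.newGhostCell φ v
  | mutateGhostCell ℓ v v' => exact ShiftSound.mutateGhostCell φ ℓ v v'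

/-! ## Proofs with step budgets -/

/-- A bound on the number of steps between two iterations of a loop. -/
def Cmd.size : Cmd U → ℕ
  | .whileSkip c => c.size + 2
  | .fork c => c.size + 1
  | .letIn _ c c' => c.size + c'.size + 1
  | .ifThen c c' => c.size + c'.size + 1
  | .exp _ => 0
  | _ => 1

/-- Expressions contribute nothing to the size. This gives the body of a `let` one budget for all
values bound to its variable. -/
theorem Cmd.size_subst (x : U.Var) (v : U.Val) (c : Cmd U) : (c.subst x v).size = c.size := by
  induction c with
  | letIn y c c' ih ih' =>
      simp only [Cmd.subst, Cmd.size, ih]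
      split_ifs <;> simp [ih']
  | _ => simp_all [Cmd.subst, Cmd.size]

/-- What holds after the condition of a loop with invariant given by `J` and postcondition `B`. -/
noncomputable def loopPost (J : PhaseID.{u} → Assertion U) (B : Assertion U) (b : U.Val) :
    Assertion U :=
  .or
    (.pure (b = U.ofBool true) ∗∗
      .bigOr fun p : PhaseID.{u} × PhaseID.{u} × U.Degree =>
        .pure (p.2.1 <+: p.1) ∗∗ .phase p.1 ∗∗ .itPerm p.2.1 p.2.2 ∗∗ J p.1)
    (.pure (b = U.ofBool false) ∗∗ B)

/-- The proof relation, with a bound on the number of steps until a loop starts its next iteration,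
and with a rule for loops that are evaluating their condition. -/
inductive Budgeted : ℕ → Assertion U → Cmd U → (U.Val → Assertion U) → Prop where
  | frame {n : ℕ} {A : Assertion U} {c : Cmd U} {B : U.Val → Assertion U} (F : Assertion U)
      (hc : Budgeted n A c B) :
      Budgeted n (A ∗∗ F) c (fun r => B r ∗∗ F)
  | viewShift {n : ℕ} {A A' : Assertion U} {c : Cmd U} {B B' : U.Val → Assertion U}
      (hA : ViewShift A A') (hc : Budgeted n A' c B') (hB : ∀ r, ViewShift (B' r) (B r)) :
      Budgeted n A c B
  | exp {e : Exp U} {v : U.Val} (B : U.Val → Assertion U) (he : e.eval = some v) :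
      Budgeted 0 (B v) (.exp e) B
  | bigOr {n : ℕ} {ι : Type u} {A : ι → Assertion U} {c : Cmd U} {B : U.Val → Assertion U}
      (hc : ∀ i, Budgeted n (A i) c B) :
      Budgeted n (.bigOr A) c B
  | fork {n : ℕ} {τ : PhaseID.{u}} {Om Of : Bag (Ob U)} {A : Assertion U} {c : Cmd U}
      (hc : Budgeted n (.phase (τ ++ [.forkee]) ∗∗ .obs Of ∗∗ A) c (fun _ => .obs 0)) :
      Budgeted (n + 1) (.phase τ ∗∗ .obs (Om + Of) ∗∗ A) (.fork c)
        (fun r => .pure (r = U.unit) ∗∗ .phase (τ ++ [.forker]) ∗∗ .obs Om)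
  | ifThen {n n' : ℕ} {A : Assertion U} {c c' : Cmd U} {C B : U.Val → Assertion U}
      (hc : Budgeted n A c
        (fun b => .and (C b) (.pure (b = U.ofBool true ∨ b = U.ofBool false))))
      (hTrue : Budgeted n' (C (U.ofBool true)) c' B)
      (hFalse : ViewShift (C (U.ofBool false)) (B U.unit)) :
      Budgeted (n + n' + 1) A (.ifThen c c') B
  | whileSkip {n : ℕ} {I B : Assertion U} {J : PhaseID.{u} → Assertion U} {c : Cmd U}
      (hc : Budgeted n I c (loopPost J B)) (hI : ∀ τ, ViewShift (.phase τ ∗∗ J τ) I) :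
      Budgeted (n + 2) I (.whileSkip c) (fun r => .pure (r = U.unit) ∗∗ B)
  | loop {n m : ℕ} {A I B : Assertion U} {J : PhaseID.{u} → Assertion U} {c c' : Cmd U}
      (hc : Budgeted n A c (loopPost J B)) (hc' : Budgeted m I c' (loopPost J B))
      (hI : ∀ τ, ViewShift (.phase τ ∗∗ J τ) I) :
      Budgeted (n + 1) A (.ifThen c (.whileSkip c')) (fun r => .pure (r = U.unit) ∗∗ B)
  | letIn {n n' : ℕ} {A : Assertion U} {x : U.Var} {c c' : Cmd U} {C B : U.Val → Assertion U}
      (hc : Budgeted n A c C) (hc' : ∀ v, Budgeted n' (C v) (c'.subst x v) B) :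
      Budgeted (n + n' + 1) A (.letIn x c c') B
  | acquire {e : Exp U} {m : Mutex U} {P : Assertion U} {f : Frac} {O : Bag (Ob U)}
      (he : e.eval = some (U.ofLoc m.1)) :
      Budgeted 1 (.obs O ∗∗ .mutex f m P) (.acquire e)
        (fun r => .pure (r = U.unit) ∗∗ .obs (O + Bag.single m.ob) ∗∗ .locked .one m P f ∗∗ P)
  | release {e : Exp U} {m : Mutex U} {P A B : Assertion U} {f : Frac} {O O' : Bag (Ob U)}
      (he : e.eval = some (U.ofLoc m.1))
      (hA : ViewShift (.obs O ∗∗ A) (.obs O' ∗∗ .and P .noPhaseObs ∗∗ B)) :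
      Budgeted 1 (.obs (O + Bag.single m.ob) ∗∗ .locked .one m P f ∗∗ A) (.release e)
        (fun r => .pure (r = U.unit) ∗∗ .obs O' ∗∗ .mutex f m P ∗∗ B)
  | newMutex :
      Budgeted 1 .tt .newMutex
        (fun r => .bigOr fun ℓ : U.Loc => .pure (r = U.ofLoc ℓ) ∗∗ .uninit .one ℓ)
  | alloc {e : Exp U} {v : U.Val} (he : e.eval = some v) :
      Budgeted 1 .tt (.alloc e)
        (fun r => .bigOr fun ℓ : U.Loc => .pure (r = U.ofLoc ℓ) ∗∗ .pointsTo .one ℓ v)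
  | read {e : Exp U} {ℓ : U.Loc} {f : Frac} {v : U.Val} (he : e.eval = some (U.ofLoc ℓ)) :
      Budgeted 1 (.pointsTo f ℓ v) (.read e) (fun r => .pure (r = v) ∗∗ .pointsTo f ℓ v)
  | assign {e e' : Exp U} {ℓ : U.Loc} {v v' : U.Val} (he : e.eval = some (U.ofLoc ℓ))
      (he' : e'.eval = some v') :
      Budgeted 1 (.pointsTo .one ℓ v) (.assign e e')
        (fun r => .pure (r = U.unit) ∗∗ .pointsTo .one ℓ v')

/-- The budget depends on the command alone, so rules with infinitely many premises have the common
bound that they need. -/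
theorem Provable.budgeted {A : Assertion U} {c : Cmd U} {B : U.Val → Assertion U}
    (h : Provable A c B) : Budgeted c.size A c B := by
  induction h with
  | frame F _ ih => exact .frame F ih
  | viewShift hA _ hB ih => exact .viewShift hA ih hB
  -- In `Budgeted` a value may have any postcondition, which is what remains to be proved of a
  -- command that has just reduced to a value. The original rule is the instance with a pure
  -- postcondition.
  | @exp e v he =>
      exact .viewShift (.semImp fun H _ _ => sat_pure.2 rfl) (.exp (fun r => .pure (r = v)) he)
        fun r => .semImp fun H _ h => h
  | fork _ ih => exact .fork ih
  | ifThen _ _ hFalse ih₁ ih₂ => exact .ifThen ih₁ ih₂ hFalse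
  | whileSkip _ hI ih => exact .whileSkip ih hI
  | letIn _ _ ih₁ ih₂ => exact .letIn ih₁ fun v => Cmd.size_subst (U := U) _ v _ ▸ ih₂ v
  | acquire he _ => exact .acquire he
  | release he hA => exact .release he hA
  | newMutex => exact .newMutex
  | alloc he => exact .alloc he
  | read he => exact .read he
  | assign he he' => exact .assign he he'
  | _ =>
      rename_i ih
      exact .bigOr ih

/-- The postcondition holds for a thread that has become a value, after some ghost steps. -/
theorem Budgeted.value {n : ℕ} {A : Assertion U} {e : Exp U} {B : U.Val → Assertion U}
    (h : Budgeted n A (.exp e) B) {v : U.Val} (he : e.eval = some v) (φ : PhaseID.{u}) :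
    ShiftSound φ A (B v) := by
  generalize hc : Cmd.exp e = c at h
  induction h with
  | frame F _ ih =>
      rintro S O _ F hS hC ⟨H₁, H₂, rfl, h₁, h₂⟩
      obtain ⟨S', O', H', hS', hC', hA', hs'⟩ :=
        ih hc hS (F := H₂ + F) (le_trans (le_of_eq (by abel)) hC) h₁
      exact ⟨S', O', H' + H₂, hS', le_trans (le_of_eq (by abel)) hC', ⟨H', H₂, rfl, hA', h₂⟩, hs'⟩
  | viewShift hA _ hB ih =>
      intro S O H F hS hC h
      obtain ⟨S₁, O₁, H₁, hS₁, hC₁, h₁, hs₁⟩ := hA.sound φ hS hC h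
      obtain ⟨S₂, O₂, H₂, hS₂, hC₂, h₂, hs₂⟩ := ih hc hS₁ hC₁ h₁
      obtain ⟨S₃, O₃, H₃, hS₃, hC₃, h₃, hs₃⟩ := (hB v).sound φ hS₂ hC₂ h₂
      exact ⟨S₃, O₃, H₃, hS₃, hC₃, h₃, (hs₁.trans hs₂).trans hs₃⟩
  | exp B he' =>
      cases hc
      rw [he] at he'
      cases he'
      intro S O H F hS hC h
      exact ⟨S, O, H, hS, hC, h, .refl _ _ _⟩
  | bigOr _ ih =>
      rintro S O H F hS hC ⟨i, h⟩
      exact ih i hc hS hC h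
  | _ => cases hc

/-! ## Physical heaps -/

def PhysRes.loc : PhysRes U → U.Loc
  | .pointsTo ℓ _ => ℓ
  | .unlocked ℓ => ℓ
  | .locked ℓ => ℓ

/-- The physical heap is the one described by the world. -/
def World.Phys (S : World U) (h : PhysHeap U) : Prop :=
  ∀ r : PhysRes U, r ∈ h ↔ (S.loc r.loc).phys r.loc = some r

theorem World.Phys.congr {S S' : World U} {h : PhysHeap U} (hS : S.Phys h)
    (hs : ∀ ℓ, (S'.loc ℓ).phys ℓ = (S.loc ℓ).phys ℓ) : S'.Phys h := fun r => by
  rw [hS r, hs]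

theorem PhysRes.loc_of_phys {X : LocState U} {ℓ : U.Loc} {r : PhysRes U}
    (h : X.phys ℓ = some r) : r.loc = ℓ := by
  cases X <;> simp only [LocState.phys, Option.some.injEq, reduceCtorEq] at h <;> subst h <;> rfl

theorem World.Phys.free {S : World U} {h : PhysHeap U} (hS : S.Phys h) {ℓ : U.Loc}
    (hℓ : ℓ ∉ h.locs) : S.loc ℓ = .free := by
  have key : ∀ r, (S.loc ℓ).phys ℓ = some r → False := by
    intro r hr
    have hl := PhysRes.loc_of_phys hr
    have hm : r ∈ h := (hS r).2 (by rw [hl, hr])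
    apply hℓ
    cases r <;> simp only [PhysRes.loc] at hl <;> subst hl
    · exact Or.inr (Or.inr ⟨_, hm⟩)
    · exact Or.inl hm
    · exact Or.inr (Or.inl hm)
  cases hX : S.loc ℓ <;> rw [hX] at key <;> simp_all [LocState.phys]

open Classical in
theorem World.Phys.add {S S' : World U} {h : PhysHeap U} (hS : S.Phys h) {ℓ : U.Loc}
    {X : LocState U} {r : PhysRes U} (hℓ : S.loc ℓ = .free)
    (hS' : S'.loc = Function.update S.loc ℓ X) (hX : X.phys ℓ = some r) : S'.Phys (h.add r) := by
  have hr := PhysRes.loc_of_phys hX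
  intro r'
  simp only [PhysHeap.add, Finset.mem_insert, hS r', hS']
  by_cases h' : r'.loc = ℓ
  · rw [h', hℓ, Function.update_self, hX]
    simp [LocState.phys, eq_comm]
  · rw [Function.update_of_ne h']
    refine ⟨fun h => h.resolve_left ?_, Or.inr⟩
    rintro rfl
    exact h' hr

open Classical in
theorem World.Phys.replace {S S' : World U} {h : PhysHeap U} (hS : S.Phys h) {ℓ : U.Loc}
    {X : LocState U} {r r₀ : PhysRes U} (hℓ : (S.loc ℓ).phys ℓ = some r₀)
    (hS' : S'.loc = Function.update S.loc ℓ X) (hX : X.phys ℓ = some r) :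
    S'.Phys ((h.remove r₀).add r) := by
  have hr := PhysRes.loc_of_phys hX
  have hr₀ := PhysRes.loc_of_phys hℓ
  intro r'
  simp only [PhysHeap.add, PhysHeap.remove, Finset.mem_insert, Finset.mem_erase, hS r', hS']
  by_cases h' : r'.loc = ℓ
  · rw [h', hℓ, Function.update_self, hX]
    simp only [Option.some.injEq]
    constructor
    · rintro (h | ⟨h, h''⟩)
      · exact h.symm
      · exact absurd h''.symm h
    · exact fun h => Or.inl h.symm
  · rw [Function.update_of_ne h']
    constructor
    · rintro (rfl | h)
      · exact absurd hr h'
      · exact h.2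
    · refine fun h => Or.inr ⟨?_, h⟩
      rintro rfl
      exact h' hr₀

/-! ## Inversion of single-thread steps -/

/-- The index `E.fill c` of `STStep.evalCtxt` is not a constructor application, which obstructs case
analysis on the step of a concrete command. Here `c` is a variable, and the conclusion computes once
`c` is known. -/
theorem STStep.inv {h h' : PhysHeap U} {c d : Cmd U} {T : Option (Cmd U)}
    (hs : STStep h c h' d T) :
    match c with
    | .whileSkip c => h' = h ∧ d = .ifThen c (.whileSkip c) ∧ T = none
    | .fork c => h' = h ∧ d = .exp (.val U.unit) ∧ T = some c
    | .letIn x c₁ c₂ =>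
        (∃ c', d = .letIn x c' c₂ ∧ STStep h c₁ h' c' T) ∨
        ∃ e v, c₁ = .exp e ∧ e.eval = some v ∧ h' = h ∧ d = c₂.subst x v ∧ T = none
    | .ifThen c₁ c₂ =>
        (∃ c', d = .ifThen c' c₂ ∧ STStep h c₁ h' c' T) ∨
        (∃ e, c₁ = .exp e ∧ e.eval = some (U.ofBool true) ∧ h' = h ∧ d = c₂ ∧ T = none) ∨
        ∃ e, c₁ = .exp e ∧ e.eval = some (U.ofBool false) ∧ h' = h ∧
          d = .exp (.val U.unit) ∧ T = none
    | .alloc e => ∃ v ℓ, e.eval = some v ∧ ℓ ∉ h.locs ∧ h' = h.add (.pointsTo ℓ v) ∧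
        d = .exp (.val (U.ofLoc ℓ)) ∧ T = none
    | .read e => ∃ ℓ v, e.eval = some (U.ofLoc ℓ) ∧ .pointsTo ℓ v ∈ h ∧ h' = h ∧
        d = .exp (.val v) ∧ T = none
    | .assign e e' => ∃ ℓ v v', e.eval = some (U.ofLoc ℓ) ∧ e'.eval = some v' ∧
        .pointsTo ℓ v ∈ h ∧ h' = (h.remove (.pointsTo ℓ v)).add (.pointsTo ℓ v') ∧
        d = .exp (.val U.unit) ∧ T = none
    | .newMutex => ∃ ℓ, ℓ ∉ h.locs ∧ h' = h.add (.unlocked ℓ) ∧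
        d = .exp (.val (U.ofLoc ℓ)) ∧ T = none
    | .acquire e => ∃ ℓ, e.eval = some (U.ofLoc ℓ) ∧ .unlocked ℓ ∈ h ∧
        h' = (h.remove (.unlocked ℓ)).add (.locked ℓ) ∧ d = .exp (.val U.unit) ∧ T = none
    | .release e => ∃ ℓ, e.eval = some (U.ofLoc ℓ) ∧ .locked ℓ ∈ h ∧
        h' = (h.remove (.locked ℓ)).add (.unlocked ℓ) ∧ d = .exp (.val U.unit) ∧ T = none
    | .exp _ => False
    | .consumeItPerm => False := by
  cases hs with
  | evalCtxt E hc =>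
      cases E with
      | ifThen c' => exact Or.inl ⟨_, rfl, hc⟩
      | letIn x c' => exact Or.inl ⟨_, rfl, hc⟩
  | fork => exact ⟨rfl, rfl, rfl⟩
  | whileSkip => exact ⟨rfl, rfl, rfl⟩
  | ifTrue e c he => exact Or.inr (Or.inl ⟨e, rfl, he, rfl, rfl, rfl⟩)
  | ifFalse e c he => exact Or.inr (Or.inr ⟨e, rfl, he, rfl, rfl, rfl⟩)
  | letIn x e v c he => exact Or.inr ⟨e, v, rfl, he, rfl, rfl, rfl⟩
  | alloc e v ℓ he hℓ => exact ⟨v, ℓ, he, hℓ, rfl, rfl, rfl⟩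
  | read e ℓ v he hℓ => exact ⟨ℓ, v, he, hℓ, rfl, rfl, rfl⟩
  | assign e e' ℓ v v' he he' hℓ => exact ⟨ℓ, v, v', he, he', hℓ, rfl, rfl, rfl⟩
  | newMutex ℓ hℓ => exact ⟨ℓ, hℓ, rfl, rfl, rfl⟩
  | acquire e ℓ he hℓ => exact ⟨ℓ, he, hℓ, rfl, rfl, rfl⟩
  | release e ℓ he hℓ => exact ⟨ℓ, he, hℓ, rfl, rfl, rfl⟩

/-- Every step changes the size of the command. -/
theorem STStep.size_ne {h h' : PhysHeap U} {c d : Cmd U} {T : Option (Cmd U)}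
    (hs : STStep h c h' d T) : d.size ≠ c.size := by
  induction hs with
  | evalCtxt E _ ih => cases E <;> simp only [EvalCtxt.fill, Cmd.size] <;> omega
  | letIn => rw [Cmd.size_subst]; simp only [Cmd.size]; omega
  | _ =>
      simp only [Cmd.size]
      omega

/-! ## Soundness of single-thread steps -/

/-- The effect of forking `T`: the forked thread takes over the obligations `Ok` and the heap
`Hk`. -/
def Forked (n : ℕ) (φ : PhaseID.{u}) (S : World U) (O₁ : Bag (Ob U)) (φ' : PhaseID.{u})
    (O' : Bag (Ob U)) (Hk : LogHeap U) : Option (Cmd U) → Prop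
  | none => φ' = φ ∧ O' = O₁ ∧ Hk = 0
  | some c => φ' = φ ++ [.forker] ∧ ∃ (Ok : Bag (Ob U)) (A : Assertion U) (k : ℕ),
      O₁ = O' + Ok ∧ k < n ∧ Budgeted k A c (fun _ => .obs 0) ∧ Sat Hk A ∧
        ∀ r : LogRes U, r.ThreadLocal → Hk r ≤ S.cap (φ ++ [.forkee]) Ok r

/-- What there is after a step of a thread with budget `n` to the command `c'` with postcondition
`B`. -/
structure StepResult (n : ℕ) (φ : PhaseID.{u}) (S : World U) (O : Bag (Ob U)) (F : LogHeap U)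
    (h' : PhysHeap U) (c' : Cmd U) (B : U.Val → Assertion U) (T : Option (Cmd U)) :
    Type (u + 1) where
  world : World U
  bag : Bag (Ob U)
  bag' : Bag (Ob U)
  phase : PhaseID.{u}
  labels : List (Label U)
  heap : LogHeap U
  forked : LogHeap U
  pre : Assertion U
  budget : ℕ
  valid : world.Valid
  phys : world.Phys h'
  steps : GhostSteps φ S.ghost O labels world.ghost bag
  proof : Budgeted budget pre c' B
  sat : Sat heap pre
  budget_lt : budget < n ∨ .consume ∈ labels
  le_cap : heap + forked.shareable + F + world.held ≤ world.cap phase bag'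
  fork : Forked n φ world bag phase bag' forked T

theorem Forked.mono {n n' : ℕ} (hn : n ≤ n') {φ φ' : PhaseID.{u}} {S : World U}
    {O₁ O' : Bag (Ob U)} {Hk : LogHeap U} {T : Option (Cmd U)}
    (h : Forked n φ S O₁ φ' O' Hk T) : Forked n' φ S O₁ φ' O' Hk T := by
  cases T with
  | none => exact h
  | some c =>
      obtain ⟨h₁, Ok, A, k, h₂, h₃, h₄⟩ := h
      exact ⟨h₁, Ok, A, k, h₂, h₃.trans_le hn, h₄⟩

section

variable {n : ℕ} {φ : PhaseID.{u}} {S : World U} {O : Bag (Ob U)} {F : LogHeap U}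
  {h' : PhysHeap U} {c' : Cmd U} {B : U.Val → Assertion U} {T : Option (Cmd U)}

theorem StepResult.prepend {S₀ : World U} {O₀ : Bag (Ob U)} (hs : World.Shifts φ S₀ O₀ S O)
    (R : StepResult n φ S O F h' c' B T) : Nonempty (StepResult n φ S₀ O₀ F h' c' B T) := by
  obtain ⟨⟨l, hl⟩, -⟩ := hs
  exact ⟨{ R with
    labels := l ++ R.labels
    steps := hl.append R.steps
    budget_lt := R.budget_lt.imp id fun h => List.mem_append_right _ h }⟩

/-- Meant for steps inside an evaluation context: `m` is the budget of the part of the command that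
waits for the result. -/
def StepResult.map (R : StepResult n φ S O F h' c' B T) {m : ℕ} {c'' : Cmd U}
    {B' : U.Val → Assertion U}
    (h : ∀ k A, Budgeted k A c' B → Budgeted (k + m) A c'' B') :
    StepResult (n + m) φ S O F h' c'' B' T :=
  { R with
    budget := R.budget + m
    proof := h _ _ R.proof
    budget_lt := R.budget_lt.imp (fun h => Nat.add_lt_add_right h m) id
    fork := R.fork.mono (Nat.le_add_right n m) }

def StepResult.frame {H₂ : LogHeap U} (R : StepResult n φ S O (H₂ + F) h' c' B T)
    {A : Assertion U} (hA : Sat H₂ A) :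
    StepResult n φ S O F h' c' (fun r => B r ∗∗ A) T :=
  { R with
    heap := R.heap + H₂
    pre := R.pre ∗∗ A
    proof := R.proof.frame A
    sat := ⟨_, _, rfl, R.sat, hA⟩
    le_cap := le_trans (le_of_eq (by abel)) R.le_cap }

/-- A step that forks nothing and consumes no iteration permission. -/
theorem StepResult.of_shift {S' : World U} {O' : Bag (Ob U)} {H' : LogHeap U}
    {A : Assertion U} {k : ℕ} (hs : ∃ l, GhostSteps φ S.ghost O l S'.ghost O') (hS' : S'.Valid)
    (hh : S'.Phys h') (hC : H' + F + S'.held ≤ S'.cap φ O') (hA : Sat H' A)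
    (hb : Budgeted k A c' B) (hk : k < n) :
    Nonempty (StepResult n φ S O F h' c' B none) :=
  ⟨{ world := S', bag := O', bag' := O', phase := φ, labels := hs.choose, heap := H', forked := 0,
     pre := A, budget := k, valid := hS', phys := hh, steps := hs.choose_spec, proof := hb,
     sat := hA, budget_lt := Or.inl hk
     le_cap := by rwa [LogHeap.shareable_zero, add_zero]
     fork := ⟨rfl, rfl, rfl⟩ }⟩

theorem StepResult.of_value {S' : World U} {O' : Bag (Ob U)} {H' : LogHeap U} {v : U.Val}
    (hs : ∃ l, GhostSteps φ S.ghost O l S'.ghost O') (hS' : S'.Valid) (hh : S'.Phys h')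
    (hC : H' + F + S'.held ≤ S'.cap φ O') (hA : Sat H' (B v)) (hn : 0 < n) :
    Nonempty (StepResult n φ S O F h' (.exp (.val v)) B none) :=
  StepResult.of_shift hs hS' hh hC hA (.exp B (by simp [Exp.eval])) hn

end

-- Steps of atomic commands and of forks.

theorem sat_pure_star {H : LogHeap U} {p : Prop} {A : Assertion U} (hp : p) (hA : Sat H A) :
    Sat H (.pure p ∗∗ A) :=
  ⟨0, H, (zero_add H).symm, sat_pure.2 hp, hA⟩

open Classical in
theorem World.cap_setObs (S : World U) (φ : PhaseID.{u}) (O O' : Bag (Ob U)) :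
    S.cap φ O + LogHeap.chunk (.obs O') 1 ≤ S.cap φ O' + LogHeap.chunk (.obs O) 1 := by
  intro r
  cases r with
  | obs X => simp [World.cap, LogHeap.chunk, add_comm]
  | _ => simp [World.cap, LogHeap.chunk]

/-- A single resource comes into being at the location `ℓ`. -/
theorem World.cap_setLoc_chunk {S S' : World U} {φ : PhaseID.{u}} {O : Bag (Ob U)} {ℓ : U.Loc}
    {old : LogHeap U} {r₁ : LogRes U} {a : NNRat} (hloc : ∀ ℓ' ≠ ℓ, S'.loc ℓ' = S.loc ℓ')
    (hg : S'.ghost = S.ghost) (hc : S'.cell = S.cell) (hr₁ : ℓ ∈ r₁.hlocs)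
    (h₁ : a ≤ S'.cap φ O r₁)
    (h : ∀ r, ℓ ∈ r.hlocs → 0 < S.cap φ O r →
      S.cap φ O r + LogHeap.chunk r₁ a r ≤ S'.cap φ O r + old r) :
    S.cap φ O + LogHeap.chunk r₁ a ≤ S'.cap φ O + old := by
  refine World.cap_setLoc S S' φ O ℓ hloc hg hc ?_ ?_
  · intro r hr
    exact LogHeap.chunk_of_ne (by rintro rfl; exact hr hr₁) _
  · intro r hr
    by_cases hpos : 0 < S.cap φ O r
    · exact h r hr hpos
    · rw [not_lt, nonpos_iff_eq_zero] at hpos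
      rw [hpos, zero_add]
      by_cases hrr : r = r₁
      · subst hrr
        simpa using h₁.trans le_self_add
      · simp [LogHeap.chunk_of_ne hrr]

/-- Soundness of a command: each of its steps can be accompanied by ghost steps. -/
def StepSound (n : ℕ) (A : Assertion U) (c : Cmd U) (B : U.Val → Assertion U) : Prop :=
  ∀ {h h' : PhysHeap U} {c' : Cmd U} {T : Option (Cmd U)} {S : World U} {φ : PhaseID.{u}}
    {O : Bag (Ob U)} {H F : LogHeap U}, STStep h c h' c' T → S.Valid → S.Phys h →
    H + F + S.held ≤ S.cap φ O → Sat H A → Nonempty (StepResult n φ S O F h' c' B T)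

-- Cells and mutexes are allocated by the same argument: a location absent from the physical heap is
-- free in the world, so no capacity is in use there and the new resource fits.
open Classical in
theorem StepSound.newLoc {n : ℕ} (hn : 0 < n) {c : Cmd U} {r₀ : U.Loc → PhysRes U}
    {r₁ : U.Loc → LogRes U} {X : LocState U} {A : U.Loc → Assertion U}
    (hX : ∀ L P, X ≠ .unlocked L P) (hr₀ : ∀ ℓ, X.phys ℓ = some (r₀ ℓ))
    (hr₁ : ∀ ℓ, ℓ ∈ (r₁ ℓ).hlocs)
    (hcap : ∀ (S : World U) φ O ℓ, S.loc ℓ = X → 1 ≤ S.cap φ O (r₁ ℓ))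
    (hA : ∀ (H : LogHeap U) ℓ, 1 ≤ H (r₁ ℓ) → Sat H (A ℓ))
    (hc : ∀ {h h' c' T}, STStep h c h' c' T → ∃ ℓ, ℓ ∉ h.locs ∧ h' = h.add (r₀ ℓ) ∧
      c' = .exp (.val (U.ofLoc ℓ)) ∧ T = none) :
    StepSound n .tt c (fun r => .bigOr fun ℓ : U.Loc => .pure (r = U.ofLoc ℓ) ∗∗ A ℓ) := by
  intro h h' c' T S φ O H F hs hS hh hC _
  obtain ⟨ℓ, hℓ, rfl, rfl, rfl⟩ := hc hs
  have hfree := hh.free hℓ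
  have hC' : H + 0 + F + S.held ≤ S.cap φ O := by simpa using hC
  refine StepResult.of_value (S' := { S with loc := Function.update S.loc ℓ X }) (O' := O)
    (H' := H + LogHeap.chunk (r₁ ℓ) 1) ⟨[], .nil _ _⟩ (hS.setLoc ℓ X hX)
    (hh.add hfree rfl (hr₀ ℓ)) (LogHeap.exchange hC' (World.cap_setLoc_chunk (ℓ := ℓ) ?_ rfl rfl
      (hr₁ ℓ) ?_ ?_)) ⟨ℓ, sat_pure_star rfl (hA _ _ ?_)⟩ hn
  · intro ℓ' hℓ'
    simp [hℓ']
  · exact hcap _ _ _ _ (by simp)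
  · intro r hr hpos
    rcases World.loc_of_cap_pos hr hpos with
      ⟨v, rfl, h⟩ | ⟨rfl, h⟩ | ⟨L, P, rfl, h | ⟨f, h⟩⟩ | ⟨L, P, f, rfl, h⟩ <;>
      simp [hfree] at h
  · simp

theorem StepSound.newMutex : StepSound (U := U) 1 .tt .newMutex
    (fun r => .bigOr fun ℓ : U.Loc => .pure (r = U.ofLoc ℓ) ∗∗ .uninit .one ℓ) :=
  StepSound.newLoc (r₀ := .unlocked) (r₁ := .uninit) (X := .uninit) (A := .uninit .one) Nat.one_pos (by simp)
    (fun _ => rfl) (fun _ => rfl) (fun S φ O ℓ h => by simp [World.cap, h]) (fun H ℓ h => h)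
    fun hs => hs.inv

theorem StepSound.alloc {e : Exp U} {v : U.Val} (he : e.eval = some v) :
    StepSound 1 .tt (.alloc e)
      (fun r => .bigOr fun ℓ : U.Loc => .pure (r = U.ofLoc ℓ) ∗∗ .pointsTo .one ℓ v) :=
  StepSound.newLoc (r₀ := fun ℓ => .pointsTo ℓ v) (r₁ := fun ℓ => .pointsTo ℓ v) (X := .cell v)
    (A := fun ℓ => .pointsTo .one ℓ v)     Nat.one_pos (by simp) (fun _ => rfl) (fun _ => rfl)
    (fun S φ O ℓ h => by simp [World.cap, h]) (fun H ℓ h => h) fun hs => by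
      obtain ⟨v', ℓ, he', h⟩ := hs.inv
      rw [he] at he'
      cases he'
      exact ⟨ℓ, h⟩

theorem World.loc_of_pointsTo {S : World U} {φ : PhaseID.{u}} {O : Bag (Ob U)} {ℓ : U.Loc}
    {v : U.Val} (h : 0 < S.cap φ O (.pointsTo ℓ v)) : S.loc ℓ = .cell v := by
  by_contra hc
  simp [World.cap, hc] at h

theorem StepSound.read {e : Exp U} {ℓ : U.Loc} {f : Frac} {v : U.Val}
    (he : e.eval = some (U.ofLoc ℓ)) :
    StepSound 1 (.pointsTo f ℓ v) (.read e) (fun r => .pure (r = v) ∗∗ .pointsTo f ℓ v) := by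
  intro h h' c' T S φ O H F hs hS hh hC hA
  obtain ⟨ℓ', w, he', hm, rfl, rfl, rfl⟩ := hs.inv
  rw [he] at he'
  obtain rfl := U.ofLoc_injective (Option.some.inj he')
  have hl := World.loc_of_pointsTo
    (lt_of_lt_of_le f.toNNRat_pos (le_trans hA (LogHeap.le_of_sum_le hC _)))
  have hm' := (hh _).1 hm
  simp only [PhysRes.loc, hl, LocState.phys, Option.some.injEq, PhysRes.pointsTo.injEq,
    true_and] at hm'
  exact StepResult.of_value ⟨[], .nil _ _⟩ hS hh hC (sat_pure_star hm'.symm hA) Nat.one_pos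

open Classical in
theorem StepSound.assign {e e' : Exp U} {ℓ : U.Loc} {v v' : U.Val}
    (he : e.eval = some (U.ofLoc ℓ)) (he' : e'.eval = some v') :
    StepSound 1 (.pointsTo .one ℓ v) (.assign e e')
      (fun r => .pure (r = U.unit) ∗∗ .pointsTo .one ℓ v') := by
  intro h h' c' T S φ O H F hs hS hh hC hA
  obtain ⟨ℓ', w, w', h₁, h₂, hm, rfl, rfl, rfl⟩ := hs.inv
  rw [he] at h₁
  obtain rfl := U.ofLoc_injective (Option.some.inj h₁)
  rw [he'] at h₂
  obtain rfl := Option.some.inj h₂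
  have hl := World.loc_of_pointsTo
    (lt_of_lt_of_le zero_lt_one (le_trans hA (LogHeap.le_of_sum_le hC _)))
  have hm' := (hh _).1 hm
  simp only [PhysRes.loc, hl, LocState.phys, Option.some.injEq, PhysRes.pointsTo.injEq,
    true_and] at hm'
  subst hm'
  obtain ⟨H₀, rfl⟩ := LogHeap.exists_eq_add_chunk (show 1 ≤ H _ from hA)
  refine StepResult.of_value (S' := { S with loc := Function.update S.loc ℓ (.cell v') }) (O' := O)
    (H' := H₀ + LogHeap.chunk (.pointsTo ℓ v') 1) ⟨[], .nil _ _⟩ (hS.setLoc ℓ _ (by simp))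
    (hh.replace (by rw [hl]; rfl) rfl rfl)
    (LogHeap.exchange hC (World.cap_setLoc_chunk (ℓ := ℓ) ?_ rfl rfl rfl ?_ ?_))
    (sat_pure_star rfl ?_) Nat.one_pos
  · intro ℓ' hℓ'
    simp [hℓ']
  · simp [World.cap]
  · intro r hr hpos
    rcases World.loc_of_cap_pos hr hpos with
      ⟨v, rfl, h⟩ | ⟨rfl, h⟩ | ⟨L, P, rfl, h | ⟨f, h⟩⟩ | ⟨L, P, f, rfl, h⟩ <;>
      simp only [hl, reduceCtorEq, LocState.cell.injEq] at h
    subst h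
    simp [World.cap, hl, LogHeap.chunk, add_comm, eq_comm]
  · simp [Sat]

theorem World.loc_of_mutex {S : World U} {φ : PhaseID.{u}} {O : Bag (Ob U)} {m : Mutex U}
    {P : Assertion U} (h : 0 < S.cap φ O (.mutex m P)) :
    S.loc m.1 = .unlocked m.2 P ∨ ∃ f, S.loc m.1 = .locked m.2 P f := by
  have hm : m.1 ∈ (LogRes.mutex m P).hlocs := rfl
  rcases World.loc_of_cap_pos hm h with
    ⟨v, h, -⟩ | ⟨h, -⟩ | ⟨L, Q, h, h'⟩ | ⟨L, Q, f, h, -⟩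
  · cases h
  · cases h
  · simp only [LogRes.mutex.injEq] at h
    obtain ⟨hL, rfl⟩ := h
    obtain rfl : m.2 = L := congrArg Prod.snd hL
    exact h'
  · cases h

theorem World.loc_of_locked {S : World U} {φ : PhaseID.{u}} {O : Bag (Ob U)} {m : Mutex U}
    {P : Assertion U} {f : Frac} (h : 0 < S.cap φ O (.locked m P f)) :
    S.loc m.1 = .locked m.2 P f := by
  by_contra hc
  simp [World.cap, hc] at h

-- The mutex chunk shows that the world knows `m` with invariant `P`, and the physical heap shows
-- that it is unlocked. So the world holds a heap for `P`, which goes to the thread.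
open Classical in
theorem StepSound.acquire {e : Exp U} {m : Mutex U} {P : Assertion U} {f : Frac} {O₁ : Bag (Ob U)}
    (he : e.eval = some (U.ofLoc m.1)) :
    StepSound 1 (.obs O₁ ∗∗ .mutex f m P) (.acquire e)
      (fun r => .pure (r = U.unit) ∗∗ .obs (O₁ + Bag.single m.ob) ∗∗ .locked .one m P f ∗∗ P) := by
  rintro h h' c' T S φ O _ F hs hS hh hC ⟨H₁, H₂, rfl, h₁, h₂⟩
  obtain ⟨ℓ, he', hm, rfl, rfl, rfl⟩ := hs.inv
  rw [he] at he'
  obtain rfl := U.ofLoc_injective (Option.some.inj he')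
  have hle := LogHeap.le_of_sum_le hC
  simp only [Pi.add_apply] at hle
  obtain rfl := World.eq_obs_of_one_le (le_trans h₁ (le_self_add.trans (hle _)))
  have hm' := (hh _).1 hm
  simp only [PhysRes.loc] at hm'
  have hl : S.loc m.1 = .unlocked m.2 P := by
    rcases World.loc_of_mutex
      (lt_of_lt_of_le f.toNNRat_pos (le_trans h₂ (le_add_self.trans (hle _)))) with h | ⟨f', h⟩
    · exact h
    · simp [h, LocState.phys] at hm'
  obtain ⟨K₁, rfl⟩ := LogHeap.exists_eq_add_chunk (show 1 ≤ H₁ _ from h₁)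
  obtain ⟨K₂, rfl⟩ := LogHeap.exists_eq_add_chunk (show f.toNNRat ≤ H₂ _ from h₂)
  let loc' := Function.update S.loc m.1 (.locked m.2 P f)
  -- The contents of the invariant change sides, from the held resources to the heap of the thread;
  -- the total is the same.
  have hC₁ : (K₁ + K₂ + S.inv m.1 + LogHeap.chunk (.obs O₁) 1) +
      LogHeap.chunk (.mutex m P) f.toNNRat + F +
      World.held { S with loc := loc', inv := S.inv.update m.1 0 } ≤ S.cap φ O₁ := by
    refine le_trans (le_of_eq ?_) hC
    rw [← World.held_update_zero S m.1 loc']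
    abel
  have hC₂ := LogHeap.exchange hC₁ (World.cap_setLoc_chunk (a := 1) (r₁ := .locked m P f)
    (S' := { S with loc := loc', inv := S.inv.update m.1 0 }) (ℓ := m.1) ?_ rfl rfl rfl ?_ ?_)
  · rw [add_right_comm (K₁ + K₂ + S.inv m.1)] at hC₂
    have hC₃ := LogHeap.exchange hC₂ (World.cap_setObs _ φ O₁ (O₁ + Bag.single m.ob))
    refine StepResult.of_value (S' := { S with loc := loc', inv := S.inv.update m.1 0 })
      ⟨[.silent], .cons (.acquire _ _ m) (.nil _ _)⟩
      (hS.setLocInv _ _ _ (by simp) (by simp)) (hh.replace hm' rfl rfl) hC₃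
      (sat_pure_star rfl ?_) Nat.one_pos
    refine ⟨K₁ + K₂ + LogHeap.chunk (.obs (O₁ + Bag.single m.ob)) 1,
      LogHeap.chunk (.locked m P f) 1 + S.inv m.1, by abel, by simp [Sat], _, _, rfl, by simp [Sat],
      hS.inv_sat _ _ _ hl⟩
  · intro ℓ' hℓ'
    simp [loc', hℓ']
  · simp [World.cap, loc']
  · intro r hr hpos
    rcases World.loc_of_cap_pos hr hpos with
      ⟨v, rfl, h⟩ | ⟨rfl, h⟩ | ⟨L, P, rfl, h | ⟨f, h⟩⟩ | ⟨L, P, f, rfl, h⟩ <;>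
      simp only [hl, reduceCtorEq, LocState.unlocked.injEq] at h
    obtain ⟨rfl, rfl⟩ := h
    -- The mutex capacity falls from 1 to `1 - f`, and the fraction `f` given up by the thread makes
    -- up the difference.
    simp only [World.cap, hl, LocState.mutexAmount, LogHeap.chunk, loc',
      Function.update_self]
    simp [tsub_add_cancel_of_le f.toNNRat_le_one]

-- Three stages: the obligation for `m` is dropped, the view shift is carried out, and only then is
-- the mutex unlocked and the heap for `P` stored in the world.
open Classical in
theorem StepSound.release {e : Exp U} {m : Mutex U} {P A B : Assertion U} {f : Frac}
    {O₁ O₂ : Bag (Ob U)} (he : e.eval = some (U.ofLoc m.1))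
    (hA : ViewShift (.obs O₁ ∗∗ A) (.obs O₂ ∗∗ .and P .noPhaseObs ∗∗ B)) :
    StepSound 1 (.obs (O₁ + Bag.single m.ob) ∗∗ .locked .one m P f ∗∗ A) (.release e)
      (fun r => .pure (r = U.unit) ∗∗ .obs O₂ ∗∗ .mutex f m P ∗∗ B) := by
  rintro h h' c' T S φ O _ F hs hS hh hC ⟨H₁, _, rfl, h₁, H₂, H₃, rfl, h₂, h₃⟩
  obtain ⟨ℓ, he', hm, rfl, rfl, rfl⟩ := hs.inv
  rw [he] at he'
  obtain rfl := U.ofLoc_injective (Option.some.inj he')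
  obtain rfl := World.eq_obs_of_one_le
    (le_trans h₁ ((le_self_add (b := (H₂ + H₃) _)).trans (LogHeap.le_of_sum_le hC _)))
  obtain ⟨K₁, rfl⟩ := LogHeap.exists_eq_add_chunk (show 1 ≤ H₁ _ from h₁)
  obtain ⟨K₂, rfl⟩ := LogHeap.exists_eq_add_chunk (show 1 ≤ H₂ _ from h₂)
  have hC₁ : (K₁ + K₂ + LogHeap.chunk (.locked m P f) 1 + H₃) +
      LogHeap.chunk (.obs (O₁ + Bag.single m.ob)) 1 + F + S.held ≤
      S.cap φ (O₁ + Bag.single m.ob) := by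
    refine le_trans (le_of_eq ?_) hC
    abel
  have hC₂ := LogHeap.exchange hC₁ (World.cap_setObs S φ _ O₁)
  -- The locked chunk is put into the frame of the view shift, so that afterwards it still testifies
  -- that `m` is locked with the same level, invariant and fraction.
  have hC₃ : LogHeap.chunk (.obs O₁) 1 + H₃ + (K₁ + K₂ + LogHeap.chunk (.locked m P f) 1 + F) +
      S.held ≤ S.cap φ O₁ := by
    refine le_trans (le_of_eq ?_) hC₂
    abel
  obtain ⟨S', O', H', hS', hC', ⟨J₁, _, rfl, j₁, J₂, J₃, rfl, ⟨j₂, j₂'⟩, j₃⟩, ⟨l, hl⟩, hs'⟩ :=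
    hA.sound φ hS hC₃ ⟨_, _, rfl, by simp [Sat], h₃⟩
  obtain rfl := World.eq_obs_of_one_le
    (le_trans j₁ ((le_self_add (b := (J₂ + J₃) _)).trans (LogHeap.le_of_sum_le hC' _)))
  have hC₄ : (J₁ + J₃ + K₁ + K₂) + LogHeap.chunk (.locked m P f) 1 + F + (S'.held + J₂) ≤
      S'.cap φ O₂ := by
    refine le_trans (le_of_eq ?_) hC'
    abel
  have hloc : S'.loc m.1 = .locked m.2 P f := by
    have hpos : 0 < S'.cap φ O₂ (.locked m P f) := by
      refine lt_of_lt_of_le zero_lt_one (le_trans ?_ (hC₄ _))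
      simp only [Pi.add_apply, LogHeap.chunk_self, add_assoc]
      exact le_self_add.trans' (by simp) |>.trans (le_add_self.trans
        (le_add_self.trans (le_add_self.trans le_add_self)))
    exact World.loc_of_locked hpos
  let loc' := Function.update S'.loc m.1 (.unlocked m.2 P)
  have hC₅ : (J₁ + J₃ + K₁ + K₂) + LogHeap.chunk (.locked m P f) 1 + F +
      World.held { S' with loc := loc', inv := S'.inv.update m.1 J₂.shareable } ≤
      S'.cap φ O₂ := by
    refine le_trans ?_ hC₄
    gcongr
    exact (World.held_update_le S' m.1 _ _).trans (by gcongr; exact J₂.shareable_le)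
  have hC₆ := LogHeap.exchange hC₅ (World.cap_setLoc_chunk (a := f.toNNRat) (r₁ := .mutex m P)
    (S' := { S' with loc := loc', inv := S'.inv.update m.1 J₂.shareable }) (ℓ := m.1)
    ?_ rfl rfl rfl ?_ ?_)
  · refine StepResult.of_value
      (S' := { S' with loc := loc', inv := S'.inv.update m.1 J₂.shareable }) ⟨.silent :: l, .cons (.release _ _ m) hl⟩
      (hS'.setLocInv _ _ _ ?_ fun r hr => LogHeap.shareable_apply_of hr)
      ((hh.congr hs').replace (by rw [hloc]; rfl) rfl rfl) hC₆ (sat_pure_star rfl ?_) Nat.one_pos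
    · intro L Q hQ
      simp only [LocState.unlocked.injEq] at hQ
      obtain ⟨rfl, rfl⟩ := hQ
      exact j₂.of_sim (LogHeap.sim_shareable j₂')
    · exact ⟨J₁, K₁ + K₂ + LogHeap.chunk (.mutex m P) f.toNNRat + J₃, by abel, j₁, _, _, rfl,
        by simp [Sat], j₃⟩
  · intro ℓ' hℓ'
    simp [loc', hℓ']
  · simp [World.cap, loc', LocState.mutexAmount, f.toNNRat_le_one]
  · intro r hr hpos
    rcases World.loc_of_cap_pos hr hpos with
      ⟨v, rfl, h⟩ | ⟨rfl, h⟩ | ⟨L, P, rfl, h | ⟨f, h⟩⟩ | ⟨L, P, f, rfl, h⟩ <;>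
      simp only [hloc, reduceCtorEq, LocState.locked.injEq] at h
    · obtain ⟨rfl, rfl, rfl⟩ := h
      simp only [World.cap, hloc, LocState.mutexAmount, LogHeap.chunk, loc',
        Function.update_self]
      simp [tsub_add_cancel_of_le f.toNNRat_le_one]
    · obtain ⟨rfl, rfl, rfl⟩ := h
      simp [World.cap, hloc, LogHeap.chunk, loc']

theorem eq_zero_of_one_add_le_one {a b : NNRat} (ha : 1 ≤ a) (h : a + b ≤ 1) : b = 0 := by
  have : 1 + b ≤ 1 + 0 := le_trans (by gcongr) (h.trans (by simp))
  simpa using le_of_add_le_add_left this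

-- The old phase and obligations chunks are discarded and fresh ones are made for both threads. The
-- heap for `A` goes to the forked thread.
open Classical in
theorem StepSound.fork {n : ℕ} {τ : PhaseID.{u}} {Om Of : Bag (Ob U)} {A : Assertion U} {c : Cmd U}
    (hc : Budgeted n (.phase (τ ++ [.forkee]) ∗∗ .obs Of ∗∗ A) c (fun _ => .obs 0)) :
    StepSound (n + 1) (.phase τ ∗∗ .obs (Om + Of) ∗∗ A) (.fork c)
      (fun r => .pure (r = U.unit) ∗∗ .phase (τ ++ [.forker]) ∗∗ .obs Om) := by
  rintro h h' c' T S φ O _ F hs hS hh hC ⟨H₁, _, rfl, h₁, H₂, H₃, rfl, h₂, h₃⟩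
  obtain ⟨rfl, rfl, rfl⟩ := hs.inv
  obtain rfl := World.eq_phase_of_one_le
    (le_trans h₁ ((le_self_add (b := (H₂ + H₃) _)).trans (LogHeap.le_of_sum_le hC _)))
  obtain rfl := World.eq_obs_of_one_le (le_trans h₂ (((le_self_add (b := H₃ _)).trans
    (le_add_self (b := H₁ _))).trans (LogHeap.le_of_sum_le hC _)))
  have h₁ : 1 ≤ H₁ _ := h₁
  have h₂ : 1 ≤ H₂ _ := h₂
  -- The thread's own chunks exhaust the thread-local capacity. Without this, leftover fractions of
  -- the old phase or bag would exceed the capacity for the new ones, which is 0 there.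
  have hzero : ∀ r : LogRes U, r.ThreadLocal → H₃ r = 0 ∧ F r = 0 ∧ S.held r = 0 := by
    intro r hr
    suffices h : H₃ r + F r = 0 by
      exact ⟨(add_eq_zero.1 h).1, (add_eq_zero.1 h).2, hS.held_threadLocal hr⟩
    have hCr := hC r
    simp only [Pi.add_apply, hS.held_threadLocal hr, add_zero] at hCr
    cases r with
    | phase σ =>
        by_cases hσ : σ = τ
        · subst hσ
          simp only [World.cap, if_true] at hCr
          have := eq_zero_of_one_add_le_one h₁
            (b := H₂ (.phase σ) + H₃ (.phase σ) + F (.phase σ)) (by simpa only [add_assoc] using hCr)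
          simp only [add_eq_zero] at this ⊢
          exact ⟨this.1.2, this.2⟩
        · simp only [World.cap, hσ, if_false, nonpos_iff_eq_zero, add_eq_zero] at hCr
          simp [hCr]
    | obs X =>
        by_cases hX : X = Om + Of
        · subst hX
          simp only [World.cap, if_true] at hCr
          have := eq_zero_of_one_add_le_one h₂
            (b := H₁ (.obs (Om + Of)) + H₃ (.obs (Om + Of)) + F (.obs (Om + Of)))
            (le_trans (le_of_eq (by ring)) hCr)
          simp only [add_eq_zero] at this ⊢
          exact ⟨this.1.2, this.2⟩
        · simp only [World.cap, hX, if_false, nonpos_iff_eq_zero, add_eq_zero] at hCr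
          simp [hCr]
    | _ => exact absurd hr (by simp [LogRes.ThreadLocal])
  refine ⟨{
    world := S, bag := Om + Of, bag' := Om, phase := τ ++ [.forker], labels := []
    heap := LogHeap.chunk (.phase (τ ++ [.forker])) 1 + LogHeap.chunk (.obs Om) 1
    forked := LogHeap.chunk (.phase (τ ++ [.forkee])) 1 + (LogHeap.chunk (.obs Of) 1 + H₃)
    pre := _, budget := 0, valid := hS, phys := hh, steps := .nil _ _
    proof := .exp _ (by simp [Exp.eval])
    sat := sat_pure_star rfl ⟨_, _, rfl, by simp [Sat], by simp [Sat]⟩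
    budget_lt := Or.inl n.succ_pos
    le_cap := ?_
    fork := ⟨rfl, Of, _, n, rfl, n.lt_succ_self, hc,
      ⟨_, _, rfl, by simp [Sat], _, _, rfl, by simp [Sat], h₃⟩, ?_⟩ }⟩
  · intro r
    by_cases hr : r.ThreadLocal
    · simp only [Pi.add_apply, LogHeap.shareable_apply_of hr, hzero r hr, add_zero]
      cases r with
      | phase | obs => simp [World.cap, LogHeap.chunk]
      | _ => exact absurd hr (by simp [LogRes.ThreadLocal])
    · rw [S.cap_congr_of_not_threadLocal hr _ τ _ (Om + Of)]
      refine le_trans ?_ (hC r)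
      have hne : ∀ σ, r ≠ .phase σ := by rintro σ rfl; exact hr trivial
      have hne' : ∀ X, r ≠ .obs X := by rintro σ rfl; exact hr trivial
      simp only [Pi.add_apply, LogHeap.shareable_apply_of_not hr, LogHeap.chunk_of_ne (hne _),
        LogHeap.chunk_of_ne (hne' _), zero_add]
      gcongr
      exact le_add_self.trans le_add_self
  · intro r hr
    simp only [Pi.add_apply, hzero r hr, add_zero]
    cases r with
    | phase | obs => simp [World.cap, LogHeap.chunk]
    | _ => exact absurd hr (by simp [LogRes.ThreadLocal])

-- Steps of compound commands.

theorem StepSound.ifThen {n n' : ℕ} {A : Assertion U} {c c₂ : Cmd U} {C B : U.Val → Assertion U}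
    (hc : Budgeted n A c
      (fun b => .and (C b) (.pure (b = U.ofBool true ∨ b = U.ofBool false))))
    (hTrue : Budgeted n' (C (U.ofBool true)) c₂ B)
    (hFalse : ViewShift (C (U.ofBool false)) (B U.unit))
    (ih : StepSound n A c
      (fun b => .and (C b) (.pure (b = U.ofBool true ∨ b = U.ofBool false)))) :
    StepSound (n + n' + 1) A (.ifThen c c₂) B := by
  intro h h' c' T S φ O H F hs hS hh hC hA
  rcases hs.inv with ⟨d, rfl, hd⟩ | ⟨e, rfl, he, rfl, rfl, rfl⟩ | ⟨e, rfl, he, rfl, rfl, rfl⟩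
  · obtain ⟨R⟩ := ih hd hS hh hC hA
    exact ⟨R.map (m := n' + 1) fun k A hk => hk.ifThen hTrue hFalse⟩
  · obtain ⟨S₁, O₁, H₁, hS₁, hC₁, h₁, hs₁⟩ := hc.value he φ hS hC hA
    exact StepResult.of_shift hs₁.1 hS₁ (hh.congr hs₁.2) hC₁ h₁.1 hTrue (by omega)
  · obtain ⟨S₁, O₁, H₁, hS₁, hC₁, h₁, hs₁⟩ := hc.value he φ hS hC hA
    obtain ⟨S₂, O₂, H₂, hS₂, hC₂, h₂, hs₂⟩ := hFalse.sound φ hS₁ hC₁ h₁.1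
    have hs₃ := hs₁.trans hs₂
    exact StepResult.of_value hs₃.1 hS₂ (hh.congr hs₃.2) hC₂ h₂ (by omega)

theorem StepSound.letIn {n n' : ℕ} {A : Assertion U} {x : U.Var} {c c₂ : Cmd U}
    {C B : U.Val → Assertion U} (hc : Budgeted n A c C)
    (hc' : ∀ v, Budgeted n' (C v) (c₂.subst x v) B) (ih : StepSound n A c C) :
    StepSound (n + n' + 1) A (.letIn x c c₂) B := by
  intro h h' c' T S φ O H F hs hS hh hC hA
  rcases hs.inv with ⟨d, rfl, hd⟩ | ⟨e, v, rfl, he, rfl, rfl, rfl⟩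
  · obtain ⟨R⟩ := ih hd hS hh hC hA
    exact ⟨R.map (m := n' + 1) fun k A hk => hk.letIn hc'⟩
  · obtain ⟨S₁, O₁, H₁, hS₁, hC₁, h₁, hs₁⟩ := hc.value he φ hS hC hA
    exact StepResult.of_shift hs₁.1 hS₁ (hh.congr hs₁.2) hC₁ h₁ (hc' v) (by omega)

theorem World.cap_setIt_le (S : World U) (φ : PhaseID.{u}) (O : Bag (Ob U)) {τ : PhaseID.{u}}
    {δ : U.Degree} {I : Multiset (PhaseID.{u} × U.Degree)} (hI : S.ghost.it = (τ, δ) ::ₘ I) :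
    S.cap φ O ≤ World.cap { S with ghost := { S.ghost with it := I } } φ O +
      LogHeap.chunk (.itPerm τ δ) 1 := by
  classical
  intro r
  cases r with
  | itPerm τ' δ' =>
      by_cases h : τ' = τ ∧ δ' = δ
      · obtain ⟨rfl, rfl⟩ := h
        simp [World.cap, hI]
      · have h' : (τ', δ') ≠ (τ, δ) := by simpa using h
        simp [World.cap, hI, Multiset.count_cons_of_ne h']
  | _ => simp [World.cap]

/-- When the condition has become true, an iteration permission is consumed and the loop starts
afresh with a budget unrelated to the previous one. This is the only source of steps that do not
lower the budget. -/
theorem StepSound.loop {n m : ℕ} {A I B : Assertion U} {J : PhaseID.{u} → Assertion U}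
    {c c₀ : Cmd U} (hc : Budgeted n A c (loopPost J B)) (hc' : Budgeted m I c₀ (loopPost J B))
    (hI : ∀ τ, ViewShift (.phase τ ∗∗ J τ) I) (ih : StepSound n A c (loopPost J B)) :
    StepSound (n + 1) A (.ifThen c (.whileSkip c₀)) (fun r => .pure (r = U.unit) ∗∗ B) := by
  intro h h' c' T S φ O H F hs hS hh hC hA
  rcases hs.inv with ⟨d, rfl, hd⟩ | ⟨e, rfl, he, rfl, rfl, rfl⟩ | ⟨e, rfl, he, rfl, rfl, rfl⟩
  · obtain ⟨R⟩ := ih hd hS hh hC hA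
    exact ⟨R.map (m := 1) fun k A hk => hk.loop hc' hI⟩
  · obtain ⟨S₁, O₁, H₁, hS₁, hC₁, h₁ | ⟨_, _, -, h, -⟩, hs₁⟩ := hc.value he φ hS hC hA
    · obtain ⟨K₁, _, rfl, -, ⟨τ, τ', δ⟩, K₂, _, rfl, hτ, K₃, _, rfl, h₃, K₄, K₅, rfl, h₄, h₅⟩ := h₁
      have hτ : τ' <+: τ := sat_pure.1 hτ
      have hle := LogHeap.le_of_sum_le hC₁
      simp only [Pi.add_apply] at hle
      obtain rfl := World.eq_phase_of_one_le
        (le_trans h₃ ((le_self_add.trans (le_add_self.trans le_add_self)).trans (hle _)))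
      obtain ⟨M, hM⟩ := World.exists_it_of_one_le (le_trans h₄ ((le_self_add.trans
        (le_add_self.trans (le_add_self.trans le_add_self))).trans (hle _)))
      obtain ⟨K, rfl⟩ := LogHeap.exists_eq_add_chunk (show 1 ≤ K₄ _ from h₄)
      have hC₂ : (K₁ + K₂ + K + K₃ + K₅) + LogHeap.chunk (.itPerm τ' δ) 1 + F + S₁.held ≤
          S₁.cap τ O₁ := le_trans (le_of_eq (by simp only; abel)) hC₁
      have hC₃ := LogHeap.exchange (new := 0) hC₂
        (by simpa using World.cap_setIt_le S₁ τ O₁ hM)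
      -- The invariant has to be re-established from the phase chunk and `J` alone, so everything
      -- else is thrown away.
      have hC₄ : K₃ + K₅ + F + World.held { S₁ with ghost := { S₁.ghost with it := M } } ≤
          World.cap { S₁ with ghost := { S₁.ghost with it := M } } τ O₁ := by
        rw [add_zero] at hC₃
        refine le_trans ?_ hC₃
        gcongr
        · exact le_add_self
        · exact le_rfl
      obtain ⟨⟨l, hl⟩, hp⟩ := hs₁
      exact ⟨{
        world := { S₁ with ghost := { S₁.ghost with it := M } }, bag := O₁, bag' := O₁
        phase := τ, labels := l ++ [.consume], heap := K₃ + K₅, forked := 0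
        pre := .phase τ ∗∗ J τ, budget := m + 2
        valid := hS₁.set_ghost hS₁.finite_sig
        phys := hh.congr hp
        steps := hl.append (.cons (.consume _ _ hτ hM) (.nil _ _))
        proof := .viewShift (hI τ) (.whileSkip hc' hI) fun r => .semImp fun _ _ h => h
        sat := ⟨K₃, K₅, rfl, h₃, h₅⟩
        budget_lt := Or.inr (by simp)
        le_cap := by rwa [LogHeap.shareable_zero, add_zero]
        fork := ⟨rfl, rfl, rfl⟩ }⟩
    · exact absurd (U.ofBool_injective (sat_pure.1 h)) (by simp)
  · obtain ⟨S₁, O₁, H₁, hS₁, hC₁, ⟨_, _, -, h, -⟩ | ⟨K₁, K₂, rfl, -, h₂⟩, hs₁⟩ :=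
      hc.value he φ hS hC hA
    · exact absurd (U.ofBool_injective (sat_pure.1 h)) (by simp)
    · exact StepResult.of_value hs₁.1 hS₁ (hh.congr hs₁.2) hC₁
        ⟨K₁, K₂, rfl, sat_pure.2 rfl, h₂⟩ (by omega)

theorem Budgeted.sound {n : ℕ} {A : Assertion U} {c : Cmd U} {B : U.Val → Assertion U}
    (hb : Budgeted n A c B) : StepSound n A c B := by
  induction hb with
  | frame R _ ih =>
      rintro h h' c' T S φ O _ F hs hS hh hC ⟨H₁, H₂, rfl, h₁, h₂⟩
      obtain ⟨Q⟩ := ih hs hS hh (F := H₂ + F) (le_trans (le_of_eq (by abel)) hC) h₁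
      exact ⟨Q.frame h₂⟩
  | viewShift hA _ hB ih =>
      intro h h' c' T S φ O H F hs hS hh hC h₀
      obtain ⟨S₁, O₁, H₁, hS₁, hC₁, h₁, hs₁⟩ := hA.sound φ hS hC h₀
      obtain ⟨Q⟩ := ih hs hS₁ (hh.congr hs₁.2) hC₁ h₁
      exact (Q.map (m := 0) fun k A hk => hk.viewShift (.semImp fun _ _ h => h) hB).prepend hs₁
  | exp B he => exact fun hs => hs.inv.elim
  | bigOr _ ih =>
      rintro h h' c' T S φ O H F hs hS hh hC ⟨i, hi⟩
      exact ih i hs hS hh hC hi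
  | fork hc _ => exact StepSound.fork hc
  | ifThen hc hTrue hFalse ih _ => exact StepSound.ifThen hc hTrue hFalse ih
  | whileSkip hc hI ih =>
      intro h h' c' T S φ O H F hs hS hh hC hA
      obtain ⟨rfl, rfl, rfl⟩ := hs.inv
      exact StepResult.of_shift ⟨[], .nil _ _⟩ hS hh hC hA (hc.loop hc hI) (by omega)
  | loop hc hc' hI ih _ => exact StepSound.loop hc hc' hI ih
  | letIn hc hc' ih _ => exact StepSound.letIn hc hc' ih
  | acquire he => exact StepSound.acquire he
  | release he hA => exact StepSound.release he hA
  | newMutex => exact StepSound.newMutex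
  | alloc he => exact StepSound.alloc he
  | read he => exact StepSound.read he
  | assign he he' => exact StepSound.assign he he'

/-! ## Signals and obligations along ghost steps -/

section

variable {φ : PhaseID.{u}} {G G' : Ghost U} {O O' : Bag (Ob U)} {a : Label U}
  {l : List (Label U)} {id : U.ID} {L : U.Level} {b : Bool}

/-- New signals take fresh IDs, so an existing signal is never overwritten: its level is fixed, and
once set it stays set. -/
theorem GhostStep.sig_some (h : GhostStep φ G O a G' O') (hs : G.sig id = some (L, b)) :
    ∃ b', G'.sig id = some (L, b') ∧ (b = true → b' = true) := by
  classical
  cases h with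
  | newSignal _ id' L' h =>
      have : id ≠ id' := by rintro rfl; simp [hs] at h
      exact ⟨b, by simp [this, hs], fun h => h⟩
  | setSignal _ s h =>
      by_cases hid : id = s.1
      · subst hid
        rw [hs] at h
        simp only [Option.some.injEq, Prod.mk.injEq] at h
        exact ⟨true, by simp [h.1], fun _ => rfl⟩
      · exact ⟨b, by simp [hid, hs], fun h => h⟩
  | _ => exact ⟨b, hs, fun h => h⟩

theorem GhostSteps.sig_some (h : GhostSteps φ G O l G' O') :
    ∀ {b}, G.sig id = some (L, b) → ∃ b', G'.sig id = some (L, b') ∧ (b = true → b' = true) := by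
  induction h with
  | nil => exact fun hs => ⟨_, hs, fun h => h⟩
  | cons h _ ih =>
      intro b hs
      obtain ⟨b₁, h₁, hb₁⟩ := h.sig_some hs
      obtain ⟨b₂, h₂, hb₂⟩ := ih h₁
      exact ⟨b₂, h₂, hb₂ ∘ hb₁⟩

theorem GhostStep.sig_true (h : GhostStep φ G O a G' O') (hs : G.sig id = some (L, true)) :
    G'.sig id = some (L, true) := by
  obtain ⟨b, hb, hb'⟩ := h.sig_some hs
  rw [hb, hb' rfl]

theorem GhostSteps.sig_true (h : GhostSteps φ G O l G' O') (hs : G.sig id = some (L, true)) :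
    G'.sig id = some (L, true) := by
  obtain ⟨b, hb, hb'⟩ := h.sig_some hs
  rw [hb, hb' rfl]

/-- Only setting this very signal can remove its obligation; releasing a mutex removes an obligation
of the other kind. -/
theorem GhostStep.one_le_bag (h : GhostStep φ G O a G' O') (hs : G'.sig id ≠ some (L, true))
    (hO : 1 ≤ O (.inr id, L)) : 1 ≤ O' (.inr id, L) := by
  classical
  cases h with
  | newSignal => exact hO.trans le_self_add
  | acquire => exact hO.trans le_self_add
  | setSignal _ s h =>
      have : ((Sum.inr id, L) : Ob U) ≠ s.ob := by
        intro h'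
        simp only [Signal.ob, Prod.mk.injEq, Sum.inr.injEq] at h'
        apply hs
        simp [h'.1, h'.2]
      simpa [Bag.single, this] using hO
  | release _ m =>
      have : ((Sum.inr id, L) : Ob U) ≠ m.ob := by simp [Mutex.ob]
      simpa [Bag.single, this] using hO
  | _ => exact hO

theorem GhostSteps.one_le_bag (h : GhostSteps φ G O l G' O') (hs : G'.sig id ≠ some (L, true))
    (hO : 1 ≤ O (.inr id, L)) : 1 ≤ O' (.inr id, L) := by
  induction h with
  | nil => exact hO
  | cons h h' ih => exact ih hs (h.one_le_bag (fun h => hs (h'.sig_true h)) hO)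

/-- If the signal did not exist before, it has just been created, together with its obligation. This
keeps a holder for every unset signal. -/
theorem GhostStep.sig_false (h : GhostStep φ G O a G' O') (hs : G'.sig id = some (L, false)) :
    G.sig id = some (L, false) ∨ 1 ≤ O' (.inr id, L) := by
  classical
  cases h with
  | newSignal _ id' L' h =>
      by_cases hid : id = id'
      · subst hid
        obtain rfl : L' = L := by simpa using hs
        right
        simp [Bag.single, Signal.ob]
      · left
        simpa [hid] using hs
  | setSignal _ s h =>
      by_cases hid : id = s.1
      · subst hid
        simp at hs
      · left
        simpa [hid] using hs
  | _ => exact Or.inl hs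

theorem GhostSteps.sig_false (h : GhostSteps φ G O l G' O') (hs : G'.sig id = some (L, false)) :
    G.sig id = some (L, false) ∨ 1 ≤ O' (.inr id, L) := by
  induction h with
  | nil => exact Or.inl hs
  | cons h h' ih =>
      rcases ih hs with h₂ | h₂
      · exact (h.sig_false h₂).imp_right fun h => h'.one_le_bag (by simp [hs]) h
      · exact Or.inr h₂

/-- A signal that is waited for exists, is unset at that time, and has a level below those of the
obligations of the waiting thread. -/
theorem GhostSteps.wait (h : GhostSteps φ G O l G' O') (hl : .wait id ∈ l) :
    ∃ L, (∃ b, G'.sig id = some (L, b)) ∧ (∀ L', G.sig id ≠ some (L', true)) ∧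
      ∀ id₀ L₀, G'.sig id₀ ≠ some (L₀, true) → 1 ≤ O (.inr id₀, L₀) → L < L₀ := by
  induction h with
  | nil => simp at hl
  | cons h h' ih =>
      rcases List.mem_cons.1 hl with rfl | hl
      · cases h with
        | @wait _ τ _ δ L hτ hw hs hL =>
            obtain ⟨b, hb, -⟩ := h'.sig_some hs
            exact ⟨L, ⟨b, hb⟩, by simp [hs], fun id₀ L₀ _ h₀ => hL _ h₀⟩
      · obtain ⟨L, hb, h₁, h₂⟩ := ih hl
        exact ⟨L, hb, fun L' hL' => h₁ L' (h.sig_true hL'), fun id₀ L₀ hs h₀ =>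
          h₂ id₀ L₀ hs (h.one_le_bag (fun h => hs (h'.sig_true h)) h₀)⟩

end

/-! ## Configurations -/

/-- A world together with the running threads, their phases, obligations, budgets and heaps. -/
structure Conf (U : Univ.{u}) : Type (u + 1) where
  world : World U
  run : Finset U.ThreadID
  phase : U.ThreadID → PhaseID.{u}
  bag : U.ThreadID → Bag (Ob U)
  budget : U.ThreadID → ℕ
  heap : U.ThreadID → LogHeap U

/-- Thread-local resources are bounded thread by thread, by the phase and bag of each. All others
share one capacity, which does not depend on phase and bag; hence the dummies `[]` and `0`. -/
structure Conf.Inv (C : Conf U) (h : PhysHeap U) (tp : ThreadPool U) : Prop where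
  valid : C.world.Valid
  phys : C.world.Phys h
  mem_run : ∀ θ, θ ∈ C.run ↔ ∃ c, tp.get θ = some (.running c)
  proof : ∀ θ c, tp.get θ = some (.running c) →
    ∃ A, Budgeted (C.budget θ) A c (fun _ => .obs 0) ∧ Sat (C.heap θ) A
  own : ∀ θ ∈ C.run, ∀ r : LogRes U, r.ThreadLocal →
    C.heap θ r ≤ C.world.cap (C.phase θ) (C.bag θ) r
  shared : ∀ r : LogRes U, ¬ r.ThreadLocal →
    ∑ θ ∈ C.run, C.heap θ r + C.world.held r ≤ C.world.cap [] 0 r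
  phases : ∀ θ ∈ C.run, ∀ θ' ∈ C.run, θ ≠ θ' → ¬ C.phase θ <+: C.phase θ'
  sig : ∀ id L, C.world.ghost.sig id = some (L, false) → ∃ θ ∈ C.run, 1 ≤ C.bag θ (.inr id, L)

/-- A step of thread `θ`, which is replaced by the threads in `K`: itself, unless it terminates,
and the thread it forks, if any. -/
structure Conf.StepTo (C : Conf U) (θ : U.ThreadID) (l : List (Label U)) (K : Finset U.ThreadID)
    (C' : Conf U) : Prop where
  mem : θ ∈ C.run
  mem_run : ∀ θ', θ' ∈ C'.run ↔ (θ' ∈ C.run ∧ θ' ≠ θ) ∨ θ' ∈ K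
  disj : ∀ κ ∈ K, κ ∈ C.run → κ = θ
  steps : GhostSteps (C.phase θ) C.world.ghost (C.bag θ) l C'.world.ghost (∑ κ ∈ K, C'.bag κ)
  phase : ∀ κ ∈ K, C.phase θ <+: C'.phase κ
  budget : ∀ κ ∈ K, C'.budget κ < C.budget θ ∨ .consume ∈ l
  others : ∀ θ' ∈ C.run, θ' ≠ θ → C'.phase θ' = C.phase θ' ∧ C'.bag θ' = C.bag θ' ∧
    C'.budget θ' = C.budget θ' ∧ C'.heap θ' = C.heap θ'

theorem Finset.exists_one_le_of_sum {ι : Type*} {s : Finset ι} {X : Type u} {f : ι → Bag X} {x : X}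
    (h : 1 ≤ (∑ i ∈ s, f i) x) : ∃ i ∈ s, 1 ≤ f i x := by
  by_contra! hc
  rw [Finset.sum_apply, Finset.sum_eq_zero fun i hi => Nat.lt_one_iff.1 (hc i hi)] at h
  omega

/-- An obligation for an unset signal stays with the thread or passes to one of its successors. -/
theorem Conf.StepTo.exists_holder {C C' : Conf U} {θ : U.ThreadID} {l : List (Label U)}
    {K : Finset U.ThreadID} (hs : C.StepTo θ l K C') {id : U.ID} {L : U.Level}
    (hsig : C'.world.ghost.sig id = some (L, false)) {θ₀ : U.ThreadID} (h₀ : θ₀ ∈ C.run)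
    (hO : 1 ≤ C.bag θ₀ (.inr id, L)) :
    ∃ θ₁ ∈ C'.run, 1 ≤ C'.bag θ₁ (.inr id, L) ∧ C.phase θ₀ <+: C'.phase θ₁ ∧
      (θ₀ ≠ θ → θ₁ = θ₀) := by
  by_cases h : θ₀ = θ
  · subst h
    obtain ⟨κ, hκ, h₁⟩ := Finset.exists_one_le_of_sum (hs.steps.one_le_bag (by simp [hsig]) hO)
    exact ⟨κ, (hs.mem_run κ).2 (Or.inr hκ), h₁, hs.phase κ hκ, fun h => absurd rfl h⟩
  · obtain ⟨h₁, h₂, -⟩ := hs.others θ₀ h₀ h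
    exact ⟨θ₀, (hs.mem_run θ₀).2 (Or.inl ⟨h₀, h⟩), h₂ ▸ hO, h₁ ▸ List.prefix_rfl, fun _ => rfl⟩

/-- Termination, an ordinary step and a fork are treated together: `K` has none, one or two members.
Only facts about the members of `K` and the common capacity have to be supplied. -/
theorem Conf.Inv.step {C C' : Conf U} {h h' : PhysHeap U} {tp tp' : ThreadPool U} (hC : C.Inv h tp)
    {θ : U.ThreadID} {l : List (Label U)} {K : Finset U.ThreadID} (hs : C.StepTo θ l K C')
    (valid : C'.world.Valid) (phys : C'.world.Phys h')
    (hK : ∀ κ ∈ K, ∃ c A, tp'.get κ = some (.running c) ∧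
      Budgeted (C'.budget κ) A c (fun _ => .obs 0) ∧ Sat (C'.heap κ) A ∧
      ∀ r : LogRes U, r.ThreadLocal → C'.heap κ r ≤ C'.world.cap (C'.phase κ) (C'.bag κ) r)
    (hθ : θ ∉ K → ∀ c, tp'.get θ ≠ some (.running c))
    (hoff : ∀ θ', θ' ∉ K → θ' ≠ θ → tp'.get θ' = tp.get θ')
    (hphases : ∀ κ ∈ K, ∀ κ' ∈ K, κ ≠ κ' → ¬ C'.phase κ <+: C'.phase κ')
    (hshared : ∀ r : LogRes U, ¬ r.ThreadLocal →
      ∑ κ ∈ K, C'.heap κ r + ∑ θ' ∈ C.run with θ' ≠ θ, C.heap θ' r + C'.world.held r ≤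
        C'.world.cap [] 0 r) :
    C'.Inv h' tp' := by
  classical
  have hnotK : ∀ θ' ∈ C.run, θ' ≠ θ → θ' ∉ K := fun θ' h₁ h₂ h₃ => h₂ (hs.disj θ' h₃ h₁)
  -- Whatever is incomparable with a phase is incomparable with all its extensions, in particular
  -- with the phases of its successors.
  have hpre : ∀ {σ τ ρ : PhaseID.{u}}, σ <+: τ → ¬ σ <+: ρ → ¬ ρ <+: σ →
      ¬ τ <+: ρ ∧ ¬ ρ <+: τ := by
    intro σ τ ρ h₁ h₂ h₃
    exact ⟨fun h => h₂ (h₁.trans h), fun h => (List.prefix_or_prefix_of_prefix h₁ h).elim h₂ h₃⟩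
  have hrun : C'.run = K ∪ C.run.filter (· ≠ θ) := by
    ext θ'
    rw [hs.mem_run, Finset.mem_union, Finset.mem_filter, or_comm]
  refine ⟨valid, phys, ?_, ?_, ?_, ?_, ?_, ?_⟩
  · intro θ'
    rw [hs.mem_run]
    constructor
    · rintro (⟨h₁, h₂⟩ | h₁)
      · rw [hoff θ' (hnotK θ' h₁ h₂) h₂]
        exact (hC.mem_run θ').1 h₁
      · obtain ⟨c, A, h, -⟩ := hK θ' h₁
        exact ⟨c, h⟩
    · rintro ⟨c, hc⟩
      by_cases h₁ : θ' ∈ K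
      · exact Or.inr h₁
      · by_cases h₂ : θ' = θ
        · subst h₂
          exact absurd hc (hθ h₁ c)
        · rw [hoff θ' h₁ h₂] at hc
          exact Or.inl ⟨(hC.mem_run θ').2 ⟨c, hc⟩, h₂⟩
  · intro θ' c hc
    by_cases h₁ : θ' ∈ K
    · obtain ⟨c', A, h, h₂, h₃, -⟩ := hK θ' h₁
      rw [hc] at h
      cases h
      exact ⟨A, h₂, h₃⟩
    · by_cases h₂ : θ' = θ
      · subst h₂
        exact absurd hc (hθ h₁ c)
      · rw [hoff θ' h₁ h₂] at hc
        obtain ⟨-, -, h₃, h₄⟩ := hs.others θ' ((hC.mem_run θ').2 ⟨c, hc⟩) h₂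
        rw [h₃, h₄]
        exact hC.proof θ' c hc
  · intro θ' hθ' r hr
    rcases (hs.mem_run θ').1 hθ' with ⟨h₁, h₂⟩ | h₁
    · obtain ⟨h₃, h₄, -, h₅⟩ := hs.others θ' h₁ h₂
      rw [h₃, h₄, h₅, World.cap_congr_of_threadLocal _ C.world hr]
      exact hC.own θ' h₁ r hr
    · obtain ⟨c, A, -, -, -, h⟩ := hK θ' h₁
      exact h r hr
  · intro r hr
    rw [hrun, Finset.sum_union]
    · refine le_trans (le_of_eq ?_) (hshared r hr)
      congr 2
      refine Finset.sum_congr rfl fun θ' hθ' => ?_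
      obtain ⟨h₁, h₂⟩ := Finset.mem_filter.1 hθ'
      rw [(hs.others θ' h₁ h₂).2.2.2]
    · refine Finset.disjoint_right.2 fun θ' hθ' => ?_
      obtain ⟨h₁, h₂⟩ := Finset.mem_filter.1 hθ'
      exact hnotK θ' h₁ h₂
  · intro θ₁ h₁ θ₂ h₂ hne
    rcases (hs.mem_run θ₁).1 h₁ with ⟨h₁, h₁'⟩ | h₁ <;>
      rcases (hs.mem_run θ₂).1 h₂ with ⟨h₂, h₂'⟩ | h₂
    · rw [(hs.others θ₁ h₁ h₁').1, (hs.others θ₂ h₂ h₂').1]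
      exact hC.phases θ₁ h₁ θ₂ h₂ hne
    · rw [(hs.others θ₁ h₁ h₁').1]
      exact (hpre (hs.phase θ₂ h₂) (hC.phases θ hs.mem θ₁ h₁ (Ne.symm h₁'))
        (hC.phases θ₁ h₁ θ hs.mem h₁')).2
    · rw [(hs.others θ₂ h₂ h₂').1]
      exact (hpre (hs.phase θ₁ h₁) (hC.phases θ hs.mem θ₂ h₂ (Ne.symm h₂'))
        (hC.phases θ₂ h₂ θ hs.mem h₂')).1
    · exact hphases θ₁ h₁ θ₂ h₂ hne
  · intro id L hsig
    rcases hs.steps.sig_false hsig with h₁ | h₁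
    · obtain ⟨θ₀, h₀, hO⟩ := hC.sig id L h₁
      obtain ⟨θ₁, h₁, h₂, -⟩ := hs.exists_holder hsig h₀ hO
      exact ⟨θ₁, h₁, h₂⟩
    · obtain ⟨κ, hκ, h₂⟩ := Finset.exists_one_le_of_sum h₁
      exact ⟨κ, (hs.mem_run κ).2 (Or.inr hκ), h₂⟩

/-! ## Steps of configurations -/

theorem ThreadPool.get_fresh (tp : ThreadPool U) : tp.get tp.fresh = none :=
  wellFounded_lt.min_mem {θ | tp.get θ = none} tp.exists_fresh

theorem ThreadPool.get_set_self (tp : ThreadPool U) (θ : U.ThreadID) (t : Thread U) :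
    (tp.set θ t).get θ = some t := by
  simp [ThreadPool.set]

theorem ThreadPool.get_set_of_ne (tp : ThreadPool U) {θ θ' : U.ThreadID} (t : Thread U)
    (h : θ' ≠ θ) : (tp.set θ t).get θ' = tp.get θ' := by
  simp [ThreadPool.set, h]

/-- For a step of `θ` the heaps of the other threads serve as the frame, without their phase and
obligations chunks, which the capacity of `θ` does not provide for. -/
theorem Conf.Inv.le_cap {C : Conf U} {h : PhysHeap U} {tp : ThreadPool U} (hC : C.Inv h tp)
    {θ : U.ThreadID} (hθ : θ ∈ C.run) :
    C.heap θ + LogHeap.shareable (∑ θ' ∈ C.run with θ' ≠ θ, C.heap θ') + C.world.held ≤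
      C.world.cap (C.phase θ) (C.bag θ) := by
  classical
  intro r
  by_cases hr : r.ThreadLocal
  · simpa [LogHeap.shareable_apply_of hr, hC.valid.held_threadLocal hr] using hC.own θ hθ r hr
  · rw [C.world.cap_congr_of_not_threadLocal hr _ [] _ 0]
    refine le_trans (le_of_eq ?_) (hC.shared r hr)
    simp only [Pi.add_apply, LogHeap.shareable_apply_of_not hr, Finset.sum_apply]
    rw [Finset.filter_ne', Finset.add_sum_erase _ (fun θ => C.heap θ r) hθ]

/-- The postcondition asserts an empty bag, which must be the actual bag by the capacity. So no
obligation is lost when a thread terminates. -/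
theorem Conf.Inv.exists_terminate {C : Conf U} {h : PhysHeap U} {tp : ThreadPool U}
    (hC : C.Inv h tp) {θ : U.ThreadID} {e : Exp U} {v : U.Val}
    (hθ : tp.get θ = some (.running (.exp e))) (he : e.eval = some v) :
    ∃ C' l, C'.Inv h (tp.set θ .terminated) ∧ C.StepTo θ l ∅ C' := by
  classical
  have hmem := (hC.mem_run θ).2 ⟨_, hθ⟩
  obtain ⟨A, hA, hsat⟩ := hC.proof θ _ hθ
  obtain ⟨S', O', H', hS', hcap, hobs, ⟨l, hl⟩, hp⟩ :=
    hA.value he (C.phase θ) hC.valid (hC.le_cap hmem) hsat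
  obtain rfl := World.eq_obs_of_one_le (le_trans hobs (LogHeap.le_of_sum_le hcap _))
  have hs : C.StepTo θ l ∅ { C with world := S', run := C.run.erase θ } :=
    { mem := hmem
      mem_run := fun θ' => by simp [and_comm]
      disj := by simp
      steps := hl
      phase := by simp
      budget := by simp
      others := fun _ _ _ => ⟨rfl, rfl, rfl, rfl⟩ }
  refine ⟨_, l, hC.step hs hS' (hC.phys.congr hp) (by simp) ?_ ?_ (by simp) ?_, hs⟩
  · intro _ c
    simp [ThreadPool.get_set_self]
  · intro θ' _ hne
    exact ThreadPool.get_set_of_ne _ _ hne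
  · intro r hr
    rw [S'.cap_congr_of_not_threadLocal hr _ (C.phase θ) _ 0]
    refine le_trans ?_ (hcap r)
    simp only [Pi.add_apply, LogHeap.shareable_apply_of_not hr, Finset.sum_apply,
      Finset.sum_empty, zero_add]
    gcongr
    exact le_add_self

theorem Conf.Inv.exists_step {C : Conf U} {h h' : PhysHeap U} {tp tp' : ThreadPool U}
    (hC : C.Inv h tp) {θ : U.ThreadID} (ht : TPStep h tp θ h' tp') :
    ∃ C' l K, C'.Inv h' tp' ∧ C.StepTo θ l K C' := by
  classical
  cases ht with
  | term hθ he =>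
      obtain ⟨C', l, h⟩ := hC.exists_terminate hθ he
      exact ⟨C', l, ∅, h⟩
  | @lift _ _ _ c c' T hθ hc =>
      have hmem := (hC.mem_run θ).2 ⟨_, hθ⟩
      obtain ⟨A, hA, hsat⟩ := hC.proof θ _ hθ
      obtain ⟨R⟩ := hA.sound hc hC.valid hC.phys (hC.le_cap hmem) hsat
      have hfork := R.fork
      have hle := R.le_cap
      have hown : ∀ r : LogRes U, r.ThreadLocal → R.heap r ≤ R.world.cap R.phase R.bag' r := by
        intro r hr
        refine le_trans ?_ (hle r)
        simp only [Pi.add_apply, add_assoc]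
        exact le_self_add
      cases T with
      | none =>
          obtain ⟨hφ, hbag, hforked⟩ := hfork
          have hs : C.StepTo θ R.labels {θ}
              ⟨R.world, C.run, C.phase, Function.update C.bag θ R.bag',
                Function.update C.budget θ R.budget, Function.update C.heap θ R.heap⟩ :=
            { mem := hmem
              mem_run := fun θ' => by
                simp only [Finset.mem_singleton]
                constructor
                · exact fun h => (eq_or_ne θ' θ).symm.imp (fun h' => ⟨h, h'⟩) id
                · rintro (h | rfl)
                  exacts [h.1, hmem]
              disj := by simp
              steps := by simpa [hbag] using R.steps
              phase := by simp
              budget := by simpa using R.budget_lt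
              others := fun θ' _ hne => by simp [hne] }
          refine ⟨_, _, _, hC.step hs R.valid R.phys ?_ (by simp) ?_ (by simp) ?_, hs⟩
          · intro κ hκ
            obtain rfl := Finset.mem_singleton.1 hκ
            refine ⟨c', R.pre, ThreadPool.get_set_self _ _ _, ?_, ?_, ?_⟩
            · simpa using R.proof
            · simpa using R.sat
            · simpa [hφ] using hown
          · intro θ' _ hne
            exact ThreadPool.get_set_of_ne _ _ hne
          · intro r hr
            rw [R.world.cap_congr_of_not_threadLocal hr _ R.phase _ R.bag']
            refine le_trans (le_of_eq ?_) (hle r)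
            simp [LogHeap.shareable_apply_of_not hr, hforked, add_comm]
      | some ck =>
          obtain ⟨hφ, Ok, Ak, n, hbag, hn, hAk, hsatk, hownk⟩ := hfork
          set tp₁ := tp.set θ (.running c')
          have hk : tp₁.fresh ≠ θ := by
            intro h
            have := tp₁.get_fresh
            rw [h, ThreadPool.get_set_self] at this
            cases this
          have hkrun : tp₁.fresh ∉ C.run := by
            intro h
            obtain ⟨d, hd⟩ := (hC.mem_run _).1 h
            have := tp₁.get_fresh
            rw [ThreadPool.get_set_of_ne _ _ hk, hd] at this
            cases this
          generalize hkk : tp₁.fresh = k at hk hkrun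
          have hs : C.StepTo θ R.labels {θ, k}
              ⟨R.world, insert k C.run,
                Function.update (Function.update C.phase θ R.phase) k (C.phase θ ++ [.forkee]),
                Function.update (Function.update C.bag θ R.bag') k Ok,
                Function.update (Function.update C.budget θ R.budget) k n,
                Function.update (Function.update C.heap θ R.heap) k R.forked⟩ :=
            { mem := hmem
              mem_run := fun θ' => by
                simp only [Finset.mem_insert, Finset.mem_singleton]
                constructor
                · rintro (h | h)
                  · exact Or.inr (Or.inr h)
                  · by_cases h' : θ' = θ
                    · exact Or.inr (Or.inl h')
                    · exact Or.inl ⟨h, h'⟩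
                · rintro (h | rfl | h)
                  exacts [Or.inr h.1, Or.inr hmem, Or.inl h]
              disj := by
                intro κ hκ h
                rcases Finset.mem_insert.1 hκ with hκ | hκ
                · exact hκ
                · rw [Finset.mem_singleton.1 hκ] at h
                  exact absurd h hkrun
              steps := by
                rw [Finset.sum_pair hk.symm]
                simpa [hk.symm, ← hbag] using R.steps
              phase := by
                intro κ hκ
                rcases Finset.mem_insert.1 hκ with rfl | hκ
                · simp [hk.symm, hφ]
                · rw [Finset.mem_singleton.1 hκ]
                  simp
              budget := by
                intro κ hκ
                rcases Finset.mem_insert.1 hκ with rfl | hκ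
                · simpa [hk.symm] using R.budget_lt
                · rw [Finset.mem_singleton.1 hκ]
                  simp [hn]
              others := fun θ' hθ' hne => by
                have : θ' ≠ k := by
                  rintro rfl
                  exact hkrun hθ'
                simp [hne, this] }
          have hget : (ThreadPool.add tp₁ (some ck)).get = Function.update tp₁.get k
              (some (.running ck)) := by
            rw [← hkk]
            rfl
          refine ⟨_, _, _, hC.step hs R.valid R.phys ?_ (by simp) ?_ ?_ ?_, hs⟩
          · intro κ hκ
            rcases Finset.mem_insert.1 hκ with rfl | hκ
            · refine ⟨c', R.pre, ?_, ?_, ?_, ?_⟩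
              · rw [hget, Function.update_of_ne hk.symm]
                exact ThreadPool.get_set_self _ _ _
              · simpa [hk.symm] using R.proof
              · simpa [hk.symm] using R.sat
              · simpa [hk.symm] using hown
            · obtain rfl := Finset.mem_singleton.1 hκ
              refine ⟨ck, Ak, ?_, ?_, ?_, ?_⟩
              · rw [hget, Function.update_self]
              · simpa using hAk
              · simpa using hsatk
              · simpa using hownk
          · intro θ' hθ' hne
            have hne' : θ' ≠ k := by
              rintro rfl
              exact hθ' (by simp)
            rw [hget, Function.update_of_ne hne']
            exact ThreadPool.get_set_of_ne _ _ hne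
          · intro κ hκ κ' hκ' hne
            simp only [Finset.mem_insert, Finset.mem_singleton] at hκ hκ'
            rcases hκ with rfl | rfl <;> rcases hκ' with rfl | rfl
            · exact absurd rfl hne
            · simp [hk.symm, hφ]
            · simp [hk.symm, hφ]
            · exact absurd rfl hne
          · intro r hr
            rw [R.world.cap_congr_of_not_threadLocal hr _ R.phase _ R.bag',
              Finset.sum_pair hk.symm]
            refine le_trans (le_of_eq ?_) (hle r)
            simp [LogHeap.shareable_apply_of_not hr, hk.symm]

/-- A single-thread step changes the size of the command, hence the command, and a forked thread is
stored under a different ID. -/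
theorem TPStep.get_ne {h h' : PhysHeap U} {tp tp' : ThreadPool U} {θ : U.ThreadID}
    (ht : TPStep h tp θ h' tp') : tp'.get θ ≠ tp.get θ := by
  cases ht with
  | term hθ he => simp [ThreadPool.get_set_self, hθ]
  | @lift _ _ _ c c' T hθ hc =>
      have hne : c' ≠ c := fun h => hc.size_ne (h ▸ rfl)
      cases T with
      | none => simpa [ThreadPool.add, ThreadPool.get_set_self, hθ] using hne
      | some ck =>
          have hk : θ ≠ (tp.set θ (.running c')).fresh := by
            intro h
            have := (tp.set θ (.running c')).get_fresh
            rw [← h, ThreadPool.get_set_self] at this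
            cases this
          rw [ThreadPool.add, ThreadPool.get_set_of_ne _ _ hk, ThreadPool.get_set_self, hθ]
          simpa using hne

theorem TPStep.get_eq {h h' : PhysHeap U} {tp tp' : ThreadPool U} {θ θ' : U.ThreadID}
    (ht : TPStep h tp θ h' tp') (hne : θ' ≠ θ) (hθ' : tp.get θ' ≠ none) :
    tp'.get θ' = tp.get θ' := by
  cases ht with
  | term hθ he => exact ThreadPool.get_set_of_ne _ _ hne
  | @lift _ _ _ c c' T hθ hc =>
      cases T with
      | none => exact ThreadPool.get_set_of_ne _ _ hne
      | some ck =>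
          have hk : θ' ≠ (tp.set θ (.running c')).fresh := by
            intro h
            have := (tp.set θ (.running c')).get_fresh
            rw [← h, ThreadPool.get_set_of_ne _ _ hne] at this
            exact hθ' this
          rw [ThreadPool.add, ThreadPool.get_set_of_ne _ _ hk, ThreadPool.get_set_of_ne _ _ hne]

/-- The thread that takes a step is determined by the step. -/
theorem TPStep.unique {h h' h₂ h₂' : PhysHeap U} {tp tp' : ThreadPool U} {θ θ' : U.ThreadID}
    (ht : TPStep h tp θ h' tp') (ht' : TPStep h₂ tp θ' h₂' tp') : θ = θ' := by
  by_contra hne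
  refine ht.get_ne (ht'.get_eq hne ?_)
  cases ht with
  | term hθ => simp [hθ]
  | lift hθ => simp [hθ]

/-! ## The termination measure -/

/-- The reflexive closure of the Dershowitz–Manna order. -/
def DMLE {α : Type*} [Preorder α] (M N : Multiset α) : Prop :=
  M = N ∨ M.IsDershowitzMannaLT N

theorem DMLE.trans {α : Type*} [Preorder α] {M N P : Multiset α} (h : DMLE M N) (h' : DMLE N P) :
    DMLE M P := by
  rcases h with rfl | h
  · exact h'
  · rcases h' with rfl | h'
    · exact Or.inr h
    · exact Or.inr (h.trans h')

theorem DMLE.trans_lt {α : Type*} [Preorder α] {M N P : Multiset α} (h : DMLE M N)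
    (h' : N.IsDershowitzMannaLT P) : M.IsDershowitzMannaLT P := by
  rcases h with rfl | h
  · exact h'
  · exact h.trans h'

theorem DMLE.of_le {α : Type*} [Preorder α] {M N : Multiset α} (h : M ≤ N) : DMLE M N := by
  obtain ⟨Z, rfl⟩ := exists_add_of_le h
  by_cases hZ : Z = ∅
  · exact Or.inl (by simp [hZ])
  · exact Or.inr ⟨M, 0, Z, hZ, by simp, rfl, by simp⟩

theorem isDershowitzMannaLT_add_singleton {α : Type*} [Preorder α] (X : Multiset α)
    {Y : Multiset α} {z : α} (h : ∀ y ∈ Y, y < z) : (X + Y).IsDershowitzMannaLT (X + {z}) :=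
  ⟨X, Y, {z}, by simp, rfl, rfl, fun y hy => ⟨z, by simp, h y hy⟩⟩

theorem multiset_bind_mono {α β : Type*} {f g : α → Multiset β} (h : ∀ a, f a ≤ g a)
    (S : Multiset α) : S.bind f ≤ S.bind g := by
  induction S using Multiset.induction_on with
  | empty => simp
  | cons a S ih =>
      rw [Multiset.cons_bind, Multiset.cons_bind]
      exact add_le_add (h a) ih

open Classical in
/-- The degree of an iteration permission at a phase in `Rel`. -/
noncomputable def itWeight (Rel : PhaseID.{u} → Prop) (p : PhaseID.{u} × U.Degree) :
    Multiset U.Degree :=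
  if Rel p.1 then {p.2} else 0

open Classical in
/-- The degrees of the iteration permissions that can still be obtained from a wait permission at a
phase in `Rel` if `m id` waits for `id` remain. -/
noncomputable def waitWeight (Rel : PhaseID.{u} → Prop) (m : U.ID → ℕ)
    (w : PhaseID.{u} × U.ID × U.Degree) : Multiset U.Degree :=
  if Rel w.1 then Multiset.replicate (m w.2.1) w.2.2 else 0

noncomputable def Ghost.weight (Rel : PhaseID.{u} → Prop) (m : U.ID → ℕ) (G : Ghost U) :
    Multiset U.Degree :=
  G.it.bind (itWeight Rel) + G.wait.bind (waitWeight Rel m)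

section

variable {Rel : PhaseID.{u} → Prop} {φ : PhaseID.{u}} {G G' : Ghost U} {O O' : Bag (Ob U)}
  {a : Label U} {l : List (Label U)}

theorem waitWeight_mono (Rel : PhaseID.{u} → Prop) {m m' : U.ID → ℕ} (hm : m ≤ m')
    (w : PhaseID.{u} × U.ID × U.Degree) : waitWeight Rel m w ≤ waitWeight Rel m' w := by
  unfold waitWeight
  split_ifs
  · exact (Multiset.replicate_le_replicate _).2 (hm _)
  · exact le_rfl

/-- Trading a permission for others of lower degree is a Dershowitz–Manna descent, with `m id`
copies in the case of a wait permission. Lengthening a phase can only leave `Rel`, by closure under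
prefixes, and a wait outside `Rel` yields a permission of weight 0. -/
theorem GhostStep.weight_le (hRel : ∀ {σ τ}, σ <+: τ → Rel τ → Rel σ)
    (h : GhostStep φ G O a G' O') (m : U.ID → ℕ) (ha : ∀ id, a = .wait id → ¬ Rel φ) :
    DMLE (G'.weight Rel m) (G.weight Rel m) := by
  classical
  cases h with
  | itToWait _ τ id hδ hI =>
      rename_i δ δ' I
      unfold Ghost.weight
      have h₁ : itWeight Rel (τ, δ) = if Rel τ then {δ} else 0 := rfl
      have h₂ : waitWeight Rel m (τ, id, δ') = if Rel τ then .replicate (m id) δ' else 0 := rfl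
      simp only [hI, Multiset.cons_bind, h₁, h₂]
      split_ifs with hτ
      · right
        convert isDershowitzMannaLT_add_singleton
          (I.bind (itWeight Rel) + G.wait.bind (waitWeight Rel m))
          (Y := Multiset.replicate (m id) δ') (z := δ)
          (fun y hy => by rwa [Multiset.eq_of_mem_replicate hy]) using 1
        · abel
        · abel
      · left
        simp
  | wait =>
      have := ha _ rfl
      left
      simp [Ghost.weight, itWeight, this]
  | specIt _ δ hτ hI =>
      unfold Ghost.weight
      simp only [hI, Multiset.cons_bind]
      refine DMLE.of_le ?_
      gcongr
      unfold itWeight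
      split_ifs with h₁ h₂
      · exact le_rfl
      · exact absurd (hRel hτ h₁) h₂
      · simp
      · exact le_rfl
  | specWait _ id δ hτ hW =>
      unfold Ghost.weight
      simp only [hW, Multiset.cons_bind]
      refine DMLE.of_le ?_
      gcongr
      unfold waitWeight
      split_ifs with h₁ h₂
      · exact le_rfl
      · exact absurd (hRel hτ h₁) h₂
      · simp
      · exact le_rfl
  | weaken _ τ n hδ hI =>
      rename_i δ δ' I
      have hrep : (Multiset.replicate n (τ, δ')).bind (itWeight Rel) =
          if Rel τ then Multiset.replicate n δ' else 0 := by
        induction n with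
        | zero => simp
        | succ n ih =>
            rw [Multiset.replicate_succ, Multiset.cons_bind, ih]
            unfold itWeight
            split_ifs
            · rw [Multiset.replicate_succ, Multiset.singleton_add]
            · simp
      unfold Ghost.weight
      have h₁ : itWeight Rel (τ, δ) = if Rel τ then {δ} else 0 := rfl
      simp only [hI, Multiset.cons_bind, Multiset.add_bind, hrep, h₁]
      split_ifs with hτ
      · right
        convert isDershowitzMannaLT_add_singleton
          (I.bind (itWeight Rel) + G.wait.bind (waitWeight Rel m))
          (Y := Multiset.replicate n δ') (z := δ)
          (fun y hy => by rwa [Multiset.eq_of_mem_replicate hy]) using 1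
        · abel
        · abel
      · left
        simp
  | consume _ hτ hI =>
      unfold Ghost.weight
      simp only [hI, Multiset.cons_bind]
      refine DMLE.of_le ?_
      gcongr
      exact le_add_self
  | _ => exact Or.inl rfl

/-- The consumed permission sits at a prefix of `φ`, hence in `Rel`, so its degree really disappears
from the weight. -/
theorem GhostStep.weight_lt (hRel : ∀ {σ τ}, σ <+: τ → Rel τ → Rel σ)
    (h : GhostStep φ G O .consume G' O') (m : U.ID → ℕ) (hφ : Rel φ) :
    (G'.weight Rel m).IsDershowitzMannaLT (G.weight Rel m) := by
  cases h with
  | @consume _ τ δ hτ I hI =>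
      unfold Ghost.weight
      simp only [hI, Multiset.cons_bind]
      convert isDershowitzMannaLT_add_singleton
        (I.bind (itWeight Rel) + G.wait.bind (waitWeight Rel m)) (Y := 0) (z := δ) (by simp) using 1
      · simp
      · simp only [itWeight, hRel hτ hφ, if_true]
        abel

/-- The new iteration permission is paid for in advance: the wait permission that is used loses at
least one copy of `δ` when the number of remaining waits drops. -/
theorem GhostStep.weight_wait (hRel : ∀ {σ τ}, σ <+: τ → Rel τ → Rel σ) {id : U.ID}
    (h : GhostStep φ G O (.wait id) G' O') {m m' : U.ID → ℕ} (hm : m ≤ m') (hid : m id < m' id)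
    (hφ : Rel φ) : DMLE (G'.weight Rel m) (G.weight Rel m') := by
  cases h with
  | @wait _ τ _ δ L hτ hw hs hL =>
      obtain ⟨W, hW⟩ := Multiset.exists_cons_of_mem hw
      refine DMLE.of_le ?_
      unfold Ghost.weight
      simp only [hW, Multiset.cons_bind]
      have h₁ : itWeight Rel (φ, δ) = {δ} := by simp [itWeight, hφ]
      have h₂ : {δ} + waitWeight Rel m (τ, id, δ) ≤ waitWeight Rel m' (τ, id, δ) := by
        simp only [waitWeight, hRel hτ hφ, if_true]
        rw [Multiset.singleton_add, ← Multiset.replicate_succ]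
        exact (Multiset.replicate_le_replicate _).2 hid
      have h₃ := multiset_bind_mono (waitWeight_mono Rel hm) W
      rw [h₁]
      calc _ = G.it.bind (itWeight Rel) + ({δ} + waitWeight Rel m (τ, id, δ) +
            W.bind (waitWeight Rel m)) := by abel
        _ ≤ _ := by gcongr

-- Here `m'` and `m` are the numbers of waits that remain before and after `l`. Waits in `l` count
-- only if the thread is in `Rel`.
open Classical in
theorem GhostSteps.weight (hRel : ∀ {σ τ}, σ <+: τ → Rel τ → Rel σ)
    (h : GhostSteps φ G O l G' O') : ∀ m m' : U.ID → ℕ,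
    (∀ id, m' id = (if Rel φ then l.count (.wait id) else 0) + m id) →
    DMLE (G'.weight Rel m) (G.weight Rel m') ∧
      (.consume ∈ l → Rel φ → (G'.weight Rel m).IsDershowitzMannaLT (G.weight Rel m')) := by
  induction h with
  | nil =>
      intro m m' hm
      obtain rfl : m' = m := funext fun id => by simp [hm]
      exact ⟨Or.inl rfl, by simp⟩
  | @cons G₁ G₂ G₃ _ _ _ a l h _ ih =>
      intro m m' hm
      obtain ⟨h₁, h₂⟩ := ih m (fun id => (if Rel φ then l.count (.wait id) else 0) + m id)
        fun _ => rfl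
      by_cases ha : Rel φ ∧ ∃ id, a = .wait id
      · obtain ⟨hφ, id, rfl⟩ := ha
        have hle := h.weight_wait hRel (m := fun id => (if Rel φ then l.count (.wait id) else 0) + m id)
          (m' := m') (fun id' => by
            rw [hm]
            simp only [hφ, if_true]
            gcongr
            exact List.count_le_count_cons) (by simp [hm, hφ]) hφ
        refine ⟨h₁.trans hle, fun hc _ => ?_⟩
        have hlt := h₂ (by simpa using hc) hφ
        rcases hle with hle | hle
        · rwa [← hle]
        · exact hlt.trans hle
      · have hm' : m' = fun id => (if Rel φ then l.count (.wait id) else 0) + m id := by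
          funext id
          rw [hm]
          split_ifs with hφ
          · rw [List.count_cons_of_ne fun h => ha ⟨hφ, id, h⟩]
          · rfl
        rw [hm']
        have hle := h.weight_le hRel (fun id => (if Rel φ then l.count (.wait id) else 0) + m id)
          fun id h hφ => ha ⟨hφ, id, h⟩
        refine ⟨h₁.trans hle, fun hc hφ => ?_⟩
        rcases List.mem_cons.1 hc with rfl | hc
        · exact h₁.trans_lt (h.weight_lt hRel _ hφ)
        · have hlt := h₂ hc hφ
          rcases hle with hle | hle
          · rwa [← hle]
          · exact hlt.trans hle

end

/-! ## Finiteness of the steps of the relevant threads -/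

/-- Once a minimal value among those after `N₀` is reached, the sequence can only stay constant. -/
theorem WellFounded.eventually_not_rel {α : Type*} {r : α → α → Prop} (hr : WellFounded r)
    (a : ℕ → α) (N₀ : ℕ) (ha : ∀ i ≥ N₀, a (i + 1) = a i ∨ r (a (i + 1)) (a i)) :
    ∃ N ≥ N₀, ∀ i ≥ N, ¬ r (a (i + 1)) (a i) := by
  obtain ⟨x, ⟨N, hN, rfl⟩, hmin⟩ := hr.has_min (a '' Set.Ici N₀) ⟨_, N₀, Set.mem_Ici.2 le_rfl, rfl⟩
  have hN : N₀ ≤ N := hN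
  have key : ∀ i ≥ N, a i = a N := by
    intro i hi
    induction i, hi using Nat.le_induction with
    | base => rfl
    | succ i hi ih =>
        rcases ha i (hN.trans hi) with h | h
        · rw [h, ih]
        · rw [ih] at h
          exact absurd h (hmin _ ⟨i + 1, Set.mem_Ici.2 ((hN.trans hi).trans (Nat.le_succ i)), rfl⟩)
  refine ⟨N, hN, fun i hi h => ?_⟩
  rw [key i hi] at h
  exact hmin _ ⟨i + 1, Set.mem_Ici.2 ((hN.trans hi).trans (Nat.le_succ i)), rfl⟩ h

open Classical in
/-- The budgets of the running threads with phases in `Rel`. -/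
noncomputable def Conf.budgets (Rel : PhaseID.{u} → Prop) (C : Conf U) : Multiset ℕ :=
  ∑ θ ∈ C.run, if Rel (C.phase θ) then {C.budget θ} else 0

/-- Successors have longer phases, so a thread outside `Rel` has none in `Rel`. A thread in `Rel`
that consumes nothing is replaced by at most two threads with smaller budgets or by none, whence the
multiset order. -/
theorem Conf.StepTo.budgets {Rel : PhaseID.{u} → Prop} (hRel : ∀ {σ τ}, σ <+: τ → Rel τ → Rel σ)
    {C C' : Conf U} {θ : U.ThreadID} {l : List (Label U)} {K : Finset U.ThreadID}
    (h : C.StepTo θ l K C') :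
    (¬ Rel (C.phase θ) → C'.budgets Rel = C.budgets Rel) ∧
      (Rel (C.phase θ) → .consume ∉ l →
        (C'.budgets Rel).IsDershowitzMannaLT (C.budgets Rel)) := by
  classical
  have hrun : C'.run = C.run.erase θ ∪ K := by
    ext θ'
    rw [h.mem_run, Finset.mem_union, Finset.mem_erase, and_comm]
  have hdisj : Disjoint (C.run.erase θ) K := Finset.disjoint_right.2 fun κ hκ hκ' =>
    (Finset.mem_erase.1 hκ').1 (h.disj κ hκ (Finset.mem_erase.1 hκ').2)
  have h' : C'.budgets Rel =
      (∑ θ' ∈ C.run.erase θ, if Rel (C.phase θ') then {C.budget θ'} else 0) +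
        ∑ κ ∈ K, if Rel (C'.phase κ) then {C'.budget κ} else 0 := by
    rw [Conf.budgets, hrun, Finset.sum_union hdisj]
    congr 1
    refine Finset.sum_congr rfl fun θ' hθ' => ?_
    obtain ⟨h₁, h₂⟩ := Finset.mem_erase.1 hθ'
    obtain ⟨h₃, -, h₄, -⟩ := h.others θ' h₂ h₁
    rw [h₃, h₄]
  have h₀ : C.budgets Rel =
      (∑ θ' ∈ C.run.erase θ, if Rel (C.phase θ') then {C.budget θ'} else 0) +
        if Rel (C.phase θ) then {C.budget θ} else 0 := by
    rw [Conf.budgets, add_comm, Finset.add_sum_erase _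
      (fun θ => (if Rel (C.phase θ) then {C.budget θ} else 0 : Multiset ℕ)) h.mem]
  rw [h', h₀]
  constructor
  · intro hφ
    congr 1
    rw [if_neg hφ]
    exact Finset.sum_eq_zero fun κ hκ => if_neg fun hκ' => hφ (hRel (h.phase κ hκ) hκ')
  · intro hφ hl
    rw [if_pos hφ]
    refine isDershowitzMannaLT_add_singleton _ fun y hy => ?_
    obtain ⟨κ, hκ, hy⟩ := Multiset.mem_sum.1 hy
    split_ifs at hy
    · rw [Multiset.mem_singleton.1 hy]
      exact (h.budget κ hκ).resolve_right hl
    · simp at hy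

/-- If the threads with phases in `Rel` wait finitely often for each signal, then they take
finitely many steps. -/
theorem Conf.eventually_not_rel {Rel : PhaseID.{u} → Prop}
    (hRel : ∀ {σ τ}, σ <+: τ → Rel τ → Rel σ) {C : ℕ → Conf U} {θ : ℕ → U.ThreadID}
    {l : ℕ → List (Label U)} {K : ℕ → Finset U.ThreadID}
    (hs : ∀ i, (C i).StepTo (θ i) (l i) (K i) (C (i + 1)))
    (hw : ∀ id, ∃ N, ∀ i ≥ N, Rel ((C i).phase (θ i)) → .wait id ∉ l i) :
    ∃ N, ∀ i ≥ N, ¬ Rel ((C i).phase (θ i)) := by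
  classical
  choose N hN using hw
  let f : U.ID → ℕ → ℕ := fun id i =>
    if Rel ((C i).phase (θ i)) then (l i).count (.wait id) else 0
  -- The number of waits for `id` by relevant threads from time `i` on; there are none after `N id`,
  -- so the sum is finite and exact.
  let n : ℕ → U.ID → ℕ := fun i id => ∑ j ∈ Finset.Ico i (N id), f id j
  have hn : ∀ i id, n i id = f id i + n (i + 1) id := by
    intro i id
    by_cases hi : i < N id
    · exact Finset.sum_eq_sum_Ico_succ_bot hi _
    · have hf : f id i = 0 := by
        simp only [f]
        split_ifs with h
        · exact List.count_eq_zero.2 (hN id i (not_lt.1 hi) h)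
        · rfl
      simp only [n]
      rw [hf, Finset.Ico_eq_empty hi, Finset.Ico_eq_empty (by omega)]
      simp
  have hweight := fun i => (hs i).steps.weight hRel (n (i + 1)) (n i) (hn i)
  obtain ⟨N₁, -, hN₁⟩ := WellFounded.eventually_not_rel
    Multiset.wellFounded_isDershowitzMannaLT (fun i => (C i).world.ghost.weight Rel (n i)) 0
    fun i _ => (hweight i).1
  have hcons : ∀ i ≥ N₁, Rel ((C i).phase (θ i)) → .consume ∉ l i :=
    fun i hi hφ hl => hN₁ i hi ((hweight i).2 hl hφ)
  -- No relevant thread consumes a permission after `N₁`, so each relevant step lowers the budgets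
  -- and other steps leave them alone.
  obtain ⟨N₂, hN₂, h₂⟩ := WellFounded.eventually_not_rel
    Multiset.wellFounded_isDershowitzMannaLT (fun i => (C i).budgets Rel) N₁ fun i hi => by
      by_cases hφ : Rel ((C i).phase (θ i))
      · exact Or.inr (((hs i).budgets hRel).2 hφ (hcons i hi hφ))
      · exact Or.inl (((hs i).budgets hRel).1 hφ)
  exact ⟨N₂, fun i hi hφ => h₂ i hi (((hs i).budgets hRel).2 hφ (hcons i (hN₂.trans hi) hφ))⟩

/-! ## Soundness -/

theorem exists_dependent_sequence {α : Type*} {P : ℕ → α → Prop} {R : ℕ → α → α → Prop} {a : α}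
    (ha : P 0 a) (h : ∀ i a, P i a → ∃ b, P (i + 1) b ∧ R i a b) :
    ∃ f : ℕ → α, f 0 = a ∧ ∀ i, P i (f i) ∧ R i (f i) (f (i + 1)) := by
  choose! g hg using h
  let f : ℕ → α := fun n => Nat.rec a g n
  have hf : ∀ i, P i (f i) := fun i => by
    induction i with
    | zero => exact ha
    | succ i ih => exact (hg i _ ih).1
  exact ⟨f, rfl, fun i => ⟨hf i, (hg i _ (hf i)).2⟩⟩

noncomputable def Conf.init (τ : PhaseID.{u}) (ds : List U.Degree) (n : ℕ) (θ₀ : U.ThreadID) :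
    Conf U where
  world :=
    { loc := fun _ => .free
      inv := 0
      cell := fun _ => none
      ghost := ⟨fun _ => none, (ds : Multiset U.Degree).map fun δ => (τ, δ), 0⟩ }
  run := {θ₀}
  phase _ := τ
  bag _ := 0
  budget _ := n
  heap _ := LogHeap.chunk (.phase τ) 1 + (LogHeap.chunk (.obs 0) 1 + LogHeap.itPerms τ ds)

theorem Conf.init_inv {τ : PhaseID.{u}} {ds : List U.Degree} {c : Cmd U}
    (hc : Provable (.phase τ ∗∗ .obs 0 ∗∗ .bigStar (ds.map fun δ => .itPerm τ δ)) c
      fun _ => .obs 0) (θ₀ : U.ThreadID) :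
    (Conf.init τ ds c.size θ₀).Inv ∅ (ThreadPool.single θ₀ (.running c)) := by
  classical
  have hrun : ∀ θ c', (ThreadPool.single θ₀ (.running c)).get θ = some (.running c') →
      θ = θ₀ ∧ c' = c := by
    intro θ c' h
    by_cases hθ : θ = θ₀
    · subst hθ
      rw [ThreadPool.single, ThreadPool.get_set_self] at h
      cases h
      exact ⟨rfl, rfl⟩
    · rw [ThreadPool.single, ThreadPool.get_set_of_ne _ _ hθ] at h
      cases h
  refine
    { valid := ⟨by simp [Conf.init], by simp [Conf.init], by simp [Conf.init],
        by simp [Conf.init]⟩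
      phys := fun r => ?_
      mem_run := fun θ => ?_
      proof := fun θ c' hθ => ?_
      own := fun θ _ r hr => ?_
      shared := fun r hr => ?_
      phases := ?_
      sig := by simp [Conf.init] }
  · simp only [Conf.init, LocState.phys, reduceCtorEq, iff_false]
    exact Finset.notMem_empty r
  · simp only [Conf.init, Finset.mem_singleton]
    constructor
    · rintro rfl
      exact ⟨c, ThreadPool.get_set_self _ _ _⟩
    · rintro ⟨c', h⟩
      exact (hrun θ c' h).1
  · obtain ⟨-, rfl⟩ := hrun θ c' hθ
    refine ⟨_, hc.budgeted, _, _, rfl, by simp [Sat], _, _, rfl, by simp [Sat], ?_⟩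
    simpa using sat_bigStar_itPerms τ ds 0
  · simp only [Conf.init, Pi.add_apply, LogHeap.itPerms_apply]
    cases r with
    | phase τ' =>
        by_cases h : τ' = τ
        · subst h
          simp [World.cap, LogHeap.chunk]
        · simp [World.cap, LogHeap.chunk, h]
    | obs O =>
        by_cases h : O = 0
        · subst h
          simp [World.cap, LogHeap.chunk]
        · simp [World.cap, LogHeap.chunk, h]
    | _ => exact absurd hr (by simp [LogRes.ThreadLocal])
  · simp only [Conf.init, Finset.sum_singleton, World.held, Finsupp.sum_zero_index, Pi.add_apply,
      LogHeap.itPerms_apply]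
    cases r with
    | phase => exact absurd trivial hr
    | obs => exact absurd trivial hr
    | _ => simp [World.cap, LogHeap.chunk]
  · intro θ hθ θ' hθ' hne
    simp only [Conf.init, Finset.mem_singleton] at hθ hθ'
    exact absurd (hθ.trans hθ'.symm) hne

section

variable {C : ℕ → Conf U} {θ : ℕ → U.ThreadID} {l : ℕ → List (Label U)}
  {K : ℕ → Finset U.ThreadID}

theorem Conf.sig_persists (hs : ∀ i, (C i).StepTo (θ i) (l i) (K i) (C (i + 1))) {id : U.ID}
    {L : U.Level} {b : Bool} {i j : ℕ} (hij : i ≤ j)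
    (hi : (C i).world.ghost.sig id = some (L, b)) :
    ∃ b', (C j).world.ghost.sig id = some (L, b') ∧ (b = true → b' = true) := by
  induction j, hij using Nat.le_induction with
  | base => exact ⟨b, hi, fun h => h⟩
  | succ j _ ih =>
      obtain ⟨b₁, h₁, hb₁⟩ := ih
      obtain ⟨b₂, h₂, hb₂⟩ := (hs j).steps.sig_some h₁
      exact ⟨b₂, h₂, hb₂ ∘ hb₁⟩

/-- A signal that is waited for infinitely often is never set. -/
theorem Conf.exists_level_of_frequently_wait
    (hs : ∀ i, (C i).StepTo (θ i) (l i) (K i) (C (i + 1))) {id : U.ID}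
    (hid : ∀ N, ∃ i ≥ N, .wait id ∈ l i) :
    ∃ L N, ∀ i ≥ N, (C i).world.ghost.sig id = some (L, false) := by
  obtain ⟨i, -, hi⟩ := hid 0
  obtain ⟨L, ⟨b, hb⟩, -⟩ := (hs i).steps.wait hi
  refine ⟨L, i + 1, fun j hj => ?_⟩
  obtain ⟨b', hb', -⟩ := Conf.sig_persists hs hj hb
  cases b' with
  | false => exact hb'
  | true =>
      obtain ⟨k, hk, hk'⟩ := hid j
      obtain ⟨b'', hb'', h⟩ := Conf.sig_persists hs hk hb'
      obtain ⟨-, -, h', -⟩ := (hs k).steps.wait hk'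
      rw [h rfl] at hb''
      exact absurd hb'' (h' L)

/-- Along an infinite run some signal is waited for infinitely often. -/
theorem Conf.exists_frequently_wait
    (hs : ∀ i, (C i).StepTo (θ i) (l i) (K i) (C (i + 1))) :
    ∃ id, ∀ N, ∃ i ≥ N, .wait id ∈ l i := by
  by_contra! hc
  obtain ⟨N, hN⟩ := Conf.eventually_not_rel (Rel := fun _ => True) (fun _ _ => trivial) hs
    fun id => (hc id).imp fun N h i hi _ => h i hi
  exact hN N le_rfl trivial

/-- The threads that hold the obligation for a signal that is never set. -/
theorem Conf.exists_holders {h : ℕ → PhysHeap U} {tp : ℕ → ThreadPool U}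
    (hC : ∀ i, (C i).Inv (h i) (tp i)) (hs : ∀ i, (C i).StepTo (θ i) (l i) (K i) (C (i + 1)))
    {id : U.ID} {L : U.Level} (hsig : ∀ i, (C i).world.ghost.sig id = some (L, false)) :
    ∃ p : ℕ → U.ThreadID, ∀ i, (p i ∈ (C i).run ∧ 1 ≤ (C i).bag (p i) (.inr id, L)) ∧
      (C i).phase (p i) <+: (C (i + 1)).phase (p (i + 1)) ∧ (p i ≠ θ i → p (i + 1) = p i) := by
  obtain ⟨θ₀, h₀, hO⟩ := (hC 0).sig id L (hsig 0)
  obtain ⟨p, -, hp⟩ := exists_dependent_sequence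
    (P := fun i θ => θ ∈ (C i).run ∧ 1 ≤ (C i).bag θ (.inr id, L))
    (R := fun i θ₁ θ₂ => (C i).phase θ₁ <+: (C (i + 1)).phase θ₂ ∧ (θ₁ ≠ θ i → θ₂ = θ₁))
    ⟨h₀, hO⟩ fun i θ' hθ' => by
      obtain ⟨θ₁, h₁, h₂, h₃⟩ := (hs i).exists_holder (hsig (i + 1)) hθ'.1 hθ'.2
      exact ⟨θ₁, ⟨h₁, h₂⟩, h₃⟩
  exact ⟨p, hp⟩

/-- No infinite run is fair to the threads that hold the obligation for a signal of minimal level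
among those that are waited for infinitely often. -/
theorem Conf.not_fair {h : ℕ → PhysHeap U} {tp : ℕ → ThreadPool U}
    (hC : ∀ i, (C i).Inv (h i) (tp i)) (hs : ∀ i, (C i).StepTo (θ i) (l i) (K i) (C (i + 1)))
    {id₀ : U.ID} {L₀ : U.Level} (hsig : ∀ i, (C i).world.ghost.sig id₀ = some (L₀, false))
    (hmin : ∀ id L, (∀ N, ∃ i ≥ N, .wait id ∈ l i) →
      (∃ N, ∀ i ≥ N, (C i).world.ghost.sig id = some (L, false)) → ¬ L < L₀)
    (hfair : ∀ i, ∀ θ' ∈ (C i).run, ∃ k ≥ i, θ k = θ') : False := by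
  obtain ⟨p, hp⟩ := Conf.exists_holders hC hs hsig
  have hmono : ∀ {i j}, i ≤ j → (C i).phase (p i) <+: (C j).phase (p j) := by
    intro i j hij
    induction j, hij using Nat.le_induction with
    | base => exact List.prefix_rfl
    | succ j _ ih => exact ih.trans (hp j).2.1
  -- The prefixes of the limit of the phases of the holders: exactly the places of permissions that
  -- some holder can ever use.
  let Rel : PhaseID.{u} → Prop := fun σ => ∃ j, σ <+: (C j).phase (p j)
  have hRel : ∀ {σ τ}, σ <+: τ → Rel τ → Rel σ := fun h ⟨j, hj⟩ => ⟨j, h.trans hj⟩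
  have heq : ∀ i, Rel ((C i).phase (θ i)) → θ i = p i := by
    rintro i ⟨j, hj⟩
    by_contra hne
    -- Both phases at time `i` are prefixes of the holder's phase at the later of the times `i` and
    -- `j`, hence comparable, which is impossible for distinct running threads.
    rcases List.prefix_or_prefix_of_prefix (hj.trans (hmono (le_max_right i j)))
      (hmono (le_max_left i j)) with h | h
    · exact (hC i).phases _ (hs i).mem _ (hp i).1.1 hne h
    · exact (hC i).phases _ (hp i).1.1 _ (hs i).mem (Ne.symm hne) h
  obtain ⟨N, hN⟩ := Conf.eventually_not_rel hRel hs fun id => by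
    by_contra! hc
    obtain ⟨L, N, hL⟩ := Conf.exists_level_of_frequently_wait hs fun N =>
      (hc N).imp fun i hi => ⟨hi.1, hi.2.2⟩
    obtain ⟨i, hi, hφ, hl⟩ := hc N
    obtain ⟨L', ⟨b, hb⟩, -, hlt⟩ := (hs i).steps.wait hl
    rw [hL (i + 1) (Nat.le_succ_of_le hi)] at hb
    cases hb
    refine hmin id L (fun N => (hc N).imp fun i hi => ⟨hi.1, hi.2.2⟩) ⟨N, hL⟩
      (hlt id₀ L₀ (by simp [hsig (i + 1)]) ?_)
    rw [heq i hφ]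
    exact (hp i).1.2
  -- The current holder is itself relevant, so from `N` on it is not the thread that steps.
  have hne : ∀ i ≥ N, p i ≠ θ i := fun i hi h => hN i hi ⟨i, h ▸ List.prefix_rfl⟩
  have hconst : ∀ i ≥ N, p i = p N := by
    intro i hi
    induction i, hi using Nat.le_induction with
    | base => rfl
    | succ i hi ih => rw [(hp i).2.2 (hne i hi), ih]
  obtain ⟨k, hk, hθ⟩ := hfair N (p N) (hp N).1.1
  exact hne k hk (by rw [hθ, hconst k hk])

end

end GhostSignals

open GhostSignals in
theorem mainTheorem1 (U : GhostSignals.Univ) (c : Cmd U) (τ : PhaseID) (N : ℕ)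
    (δ : Fin N → U.Degree)
    (hc : Provable
      (.phase τ ∗∗ .obs 0 ∗∗ .bigStar (List.ofFn fun i => .itPerm τ (δ i)))
      c (fun _ => .obs 0))
    (θ₀ : U.ThreadID) :
    ¬ ∃ (h : ℕ → PhysHeap U) (tp : ℕ → ThreadPool U),
        IsReductionSequence h tp ∧ IsFair h tp ∧
          h 0 = ∅ ∧ tp 0 = ThreadPool.single θ₀ (.running c) := by
  rintro ⟨h, tp, ⟨θ, hθ⟩, hfair, h0, htp0⟩
  have hds : (List.ofFn fun i => Assertion.itPerm τ (δ i)) =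
      (List.ofFn δ).map fun δ => Assertion.itPerm τ δ := by
    rw [List.map_ofFn]
    rfl
  rw [hds] at hc
  have hinit := Conf.init_inv hc θ₀
  rw [← h0, ← htp0] at hinit
  obtain ⟨C, -, hC⟩ := exists_dependent_sequence
    (P := fun i (C : Conf U) => C.Inv (h i) (tp i))
    (R := fun i C C' => ∃ l K, C.StepTo (θ i) l K C') hinit fun i C hC => by
      obtain ⟨C', l, K, h₁, h₂⟩ := hC.exists_step (hθ i)
      exact ⟨C', h₁, l, K, h₂⟩
  choose hC l K hs using hC
  -- A minimal level among the signals that are waited for infinitely often and eventually exist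
  -- unset for ever. The run is then cut off at `N₀`, from where on the chosen signal exists unset.
  obtain ⟨L₀, ⟨id₀, hid₀, N₀, hN₀⟩, hmin⟩ := (wellFounded_lt (α := U.Level)).has_min
    {L | ∃ id, (∀ N, ∃ i ≥ N, .wait id ∈ l i) ∧
      ∃ N, ∀ i ≥ N, (C i).world.ghost.sig id = some (L, false)} (by
      obtain ⟨id, hid⟩ := Conf.exists_frequently_wait hs
      obtain ⟨L, hL⟩ := Conf.exists_level_of_frequently_wait hs hid
      exact ⟨L, id, hid, hL⟩)
  have shift : ∀ {P : ℕ → Prop}, (∀ N, ∃ i ≥ N, P (N₀ + i)) → ∀ N, ∃ i ≥ N, P i :=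
    fun h N => (h N).elim fun i hi => ⟨N₀ + i, by omega, hi.2⟩
  refine Conf.not_fair (C := fun i => C (N₀ + i)) (fun i => hC (N₀ + i)) (fun i => hs (N₀ + i))
    (fun i => hN₀ (N₀ + i) (by omega)) ?_ ?_
  · rintro id L hid ⟨M, hM⟩
    refine hmin L ⟨id, shift hid, N₀ + M, fun i hi => ?_⟩
    obtain ⟨j, rfl⟩ := exists_add_of_le (show N₀ ≤ i by omega)
    exact hM j (by omega)
  · intro i θ' hθ'
    obtain ⟨c', hc'⟩ := ((hC (N₀ + i)).mem_run θ').1 hθ'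
    -- Fairness only says that some step of `θ'` has the right source and target; a step determines
    -- its thread, so `θ'` is the one chosen at time `k`.
    obtain ⟨k, hk, ht⟩ := hfair _ θ' c' hc'
    obtain ⟨j, rfl⟩ := exists_add_of_le (show N₀ ≤ k by omega)
    exact ⟨j, by omega, (hθ (N₀ + j)).unique ht⟩
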